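/- **Setting.** Let $N\ge 1$, let $\Omega\subset\mathbb R^N$ be a bounded domain (a nonempty, bounded, connected open set), and let $A=(A_{ij})$ be a real symmetric matrix-valued function on $\mathbb R^N$ with $A_{ij}\in L^\infty(\mathbb R^N)$ and $\theta^{-1}|\xi|^2\le\sum_{i,j}A_{ij}(x)\xi_i\xi_j\le\theta|\xi|^2$ for all $x,\xi\in\mathbb R^N$ and some $\theta\ge1$. Let $\phi,\tilde\phi$ be Lipschitz homeomorphisms, with Lipschitz inverses, of $\Omega$ onto bounded domains $\phi(\Omega)$, $\tilde\phi(\Omega)$. Fix Dirichlet boundary conditions throughout, or Neumann boundary conditions throughout, and correspondingly let $\mathcal W=W^{1,2}_0(\phi(\Omega))$ or $\mathcal W=W^{1,2}(\phi(\Omega))$ (complex-valued functions). Let $L$ be the non-negative self-adjoint operator on $L^2(\phi(\Omega))$ associated with the form $\int_{\phi(\Omega)}\sum_{i,j}A_{ij}\,\partial_iv\,\overline{\partial_jv}\,dy$, $v\in\mathcal W$. Put $$g=|\det\nabla\phi|,\qquad a=(\nabla\phi)^{-1}A(\phi)(\nabla\phi)^{-t},\qquad C_\phi[\mathcal W]=\{v\circ\phi: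 v\in\mathcal W\},$$ and let $H$ be the operator on $L^2(\Omega,g\,dx)$ associated with the form $\int_\Omega (a\nabla u\cdot\nabla\bar u)\,g\,dx$, $u\in C_\phi[\mathcal W]$. Let $\tilde L,\tilde g,\tilde a,\tilde H$ be the same objects for $\tilde\phi$. Put $$w=g^{1/2}\tilde g^{-1/2},\qquad S=w^{-2}a^{-1/2}\,\tilde a\,a^{-1/2},$$ and let $T^*ST$ be the operator on $L^2(\Omega,g\,dx)$ associated with the form $\int_\Omega(\tilde a\nabla u\cdot\nabla\bar u)\,\tilde g\,dx$, $u\in C_\phi[\mathcal W]$. Let $w^{-1}\tilde Hw$ be the operator on $L^2(\Omega,g\,dx)$ obtained from $\tilde H$ by conjugation with multiplication by $w$, which is unitary from $L^2(\Omega,g\,dx)$ onto $L^2(\Omega,\tilde g\,dx)$. For $0<q\le\infty$ let $$\delta_q(\phi,\tilde\phi)=\|w-1\|_q+\|w^{-1}-1\|_q+\|(S^{1/2}-S^{-1/2})a^{1/2}\|_q+\|(S-I)a^{1/2}\|_q ,$$ where $\|\cdot\|_q$ is the norm of $L^q(\Omega,g\,dx)$ and matrices carry the operator norm. For a non-negative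 self-adjoint operator $E$ with compact resolvent let $\lambda_1[E]\le\lambda_2[E]\le\cdots$ be its eigenvalues, repeated according to multiplicity. If $E$ acts on $L^2(\Omega,g\,dx)$ let $\psi_n[E]$ be a corresponding orthonormal sequence of eigenfunctions. For $q_0\in(2,\infty]$ and $\gamma,C_2>0$, consider the properties * (P1): $\|\psi_n[E]\|_{L^{q_0}(\Omega,g\,dx)}\le C_2\lambda_n[E]^\gamma$ for all $n$ with $\lambda_n[E]\neq0$; * (P2): $\|\nabla\psi_n[E]\|_{L^{q_0}(\Omega,g\,dx)}\le C_2\lambda_n[E]^{1/2+\gamma}$ for all $n$. **Theorem (stability of eigenvalues).** Assume that $L$, $\tilde L$ and $T^*ST$ have compact resolvents and that, for some $\alpha,C_1>0$, the eigenvalues of each of them satisfy $\lambda_n\ge C_1n^{1/\alpha}$ for all $n\ge1$ with $\lambda_n\ne0$. Assume that $H$ and $T^*ST$ satisfy (P1) and (P2) and that $w^{-1}\tilde Hw$ satisfies (P1), with the same parameters $q_0\in(2,\infty]$, $\gamma>0$, $C_2>0$. Then for all $k\in\mathbb N$ that are large enough, depending only on $\alpha$ and $\gamma$, and for every real $s>q_0(\alpha+2\gamma)/(q_0-2)$,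 there is $c>0$ such that $$\Bigl(\sum_{n=1}^\infty\bigl[(\lambda_n[\tilde L]+1)^{-k}-(\lambda_n[L]+1)^{-k}\bigr]^2\Bigr)^{1/2}\le c\,[1+\delta_s(\phi,\tilde\phi)]\,\delta_{\frac{2q_0}{q_0-2}}(\phi,\tilde\phi),$$ with $q_0/(q_0-2)=1$ if $q_0=\infty$. The constant $c$ depends only on $\alpha,k,\gamma,s,C_1,C_2$ and, in the case of Neumann boundary conditions, also on $\|g\|_{L^{q_0}(\Omega)}$. -/

import Mathlib

open MeasureTheory Set
open scoped ENNReal NNReal ContDiff MatrixOrder ComplexConjugate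

namespace SpectralStability

noncomputable section

/-- Euclidean space `ℝ^N`. -/
abbrev Eu (N : ℕ) : Type := EuclideanSpace ℝ (Fin N)

/-- Real `N × N` matrices. -/
abbrev Mat (N : ℕ) : Type := Matrix (Fin N) (Fin N) ℝ

/-- Dirichlet or Neumann boundary conditions. -/
inductive BC : Type
  | dirichlet : BC
  | neumann : BC

/-! ### Domains, transformations, coefficients -/

/-- A bounded domain: a bounded, (nonempty) connected, open set. -/
def IsBoundedDomain {N : ℕ} (Ω : Set (Eu N)) : Prop :=
  IsOpen Ω ∧ IsConnected Ω ∧ Bornology.IsBounded Ω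

/-- `φ` is a Lipschitz homeomorphism, with Lipschitz inverse, of `Ω` onto a bounded domain
`φ(Ω)`. Only the values of `φ` on `Ω` matter. -/
def IsTransformation {N : ℕ} (Ω : Set (Eu N)) (φ : Eu N → Eu N) : Prop :=
  IsBoundedDomain (φ '' Ω) ∧
    ∃ K : ℝ, ∀ x ∈ Ω, ∀ y ∈ Ω,
      dist (φ x) (φ y) ≤ K * dist x y ∧ dist x y ≤ K * dist (φ x) (φ y)

/-- Real symmetric, bounded, uniformly elliptic coefficients on `ℝ^N`. -/
def IsEllipticCoeff {N : ℕ} (A : Eu N → Mat N) : Prop :=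
  (∀ i j, MemLp (fun x => A x i j) ∞ volume) ∧
  (∀ x, (A x).IsSymm) ∧
  ∃ θ : ℝ, 1 ≤ θ ∧ ∀ x ξ : Eu N,
    θ⁻¹ * ‖ξ‖ ^ 2 ≤ ∑ i, ∑ j, A x i j * ξ i * ξ j ∧
      ∑ i, ∑ j, A x i j * ξ i * ξ j ≤ θ * ‖ξ‖ ^ 2

/-! ### Weak gradients and Sobolev spaces of complex valued functions -/

/-- Smooth complex valued functions with compact support contained in `U`. -/
def IsTest {N : ℕ} (U : Set (Eu N)) (ζ : Eu N → ℂ) : Prop :=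
  ContDiff ℝ ∞ ζ ∧ HasCompactSupport ζ ∧ tsupport ζ ⊆ U

/-- The classical gradient of a complex valued function. -/
def grad {N : ℕ} (ζ : Eu N → ℂ) (x : Eu N) : EuclideanSpace ℂ (Fin N) :=
  WithLp.toLp 2 fun i => fderiv ℝ ζ x (EuclideanSpace.single i 1)

/-- `G` is the weak gradient of `u` in the open set `U`. -/
def HasWeakGrad {N : ℕ} (U : Set (Eu N)) (u : Eu N → ℂ)
    (G : Eu N → EuclideanSpace ℂ (Fin N)) : Prop :=
  LocallyIntegrableOn u U volume ∧ LocallyIntegrableOn G U volume ∧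
    ∀ ζ : Eu N → ℂ, IsTest U ζ → ∀ i : Fin N,
      ∫ x in U, u x * grad ζ x i = -∫ x in U, G x i * ζ x

/-- `u ∈ W^{1,2}(U)`. -/
def MemW12 {N : ℕ} (U : Set (Eu N)) (u : Eu N → ℂ) : Prop :=
  MemLp u 2 (volume.restrict U) ∧
    ∃ G, HasWeakGrad U u G ∧ MemLp G 2 (volume.restrict U)

/-- `u ∈ W^{1,2}_0(U)`, the closure of the test functions in `W^{1,2}(U)`. -/
def MemW120 {N : ℕ} (U : Set (Eu N)) (u : Eu N → ℂ) : Prop :=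
  MemLp u 2 (volume.restrict U) ∧
    ∃ G, HasWeakGrad U u G ∧ MemLp G 2 (volume.restrict U) ∧
      ∀ ε : ℝ≥0∞, 0 < ε → ∃ ζ, IsTest U ζ ∧
        eLpNorm (fun x => u x - ζ x) 2 (volume.restrict U) < ε ∧
        eLpNorm (fun x => G x - grad ζ x) 2 (volume.restrict U) < ε

/-- The space `𝒲`: `W^{1,2}_0(U)` (Dirichlet) or `W^{1,2}(U)` (Neumann). -/
def MemW {N : ℕ} (b : BC) (U : Set (Eu N)) (u : Eu N → ℂ) : Prop :=
  match b with
  | BC.dirichlet => MemW120 U u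
  | BC.neumann => MemW12 U u

/-- The pulled back space `C_φ[𝒲] = {v ∘ φ : v ∈ 𝒲}`, as a space of functions on `Ω`. -/
def MemPullback {N : ℕ} (b : BC) (Ω : Set (Eu N)) (φ : Eu N → Eu N) (u : Eu N → ℂ) : Prop :=
  ∃ v, MemW b (φ '' Ω) v ∧ u =ᵐ[volume.restrict Ω] v ∘ φ

/-! ### Operators and their eigenvalues

A (possibly unbounded) operator `E` on a Hilbert space is given by its graph:
`E u f` says that `u ∈ dom E` and `E u = f`. -/

section Operators

variable {H : Type*} [NormedAddCommGroup H] [InnerProductSpace ℂ H]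

/-- `(E + 1)⁻¹` is an everywhere defined compact operator. -/
def HasCompactResolvent (E : H → H → Prop) : Prop :=
  ∃ R : H →L[ℂ] H, IsCompactOperator R ∧ ∀ u f : H, R f = u ↔ E u (f - u)

/-- `eig E n` is the `(n+1)`-st eigenvalue of `E` when the eigenvalues are listed in
non-decreasing order and repeated according to multiplicity: the least `t` such that the
eigenspaces of eigenvalues `≤ t` together have dimension at least `n + 1`. -/
def eig (E : H → H → Prop) (n : ℕ) : ℝ :=
  sInf {t : ℝ | ((n + 1 : ℕ) : Cardinal) ≤
    Module.rank ℂ (Submodule.span ℂ {u : H | ∃ μ : ℝ, μ ≤ t ∧ E u ((μ : ℂ) • u)})}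

/-- `ψ` is an orthonormal sequence of eigenvectors of `E` corresponding to the sequence of
eigenvalues `eig E`. -/
def IsEigenSeq (E : H → H → Prop) (ψ : ℕ → H) : Prop :=
  Orthonormal ℂ ψ ∧ ∀ n, E (ψ n) ((eig E n : ℂ) • ψ n)

/-- The bound `λ_n ≥ C₁ n^{1/α}`, `n = 1, 2, …`, for the non-zero eigenvalues (`0` is
an eigenvalue in the Neumann case). -/
def EigGrowth (E : H → H → Prop) (α C₁ : ℝ) : Prop :=
  ∀ n, eig E n ≠ 0 → C₁ * ((n : ℝ) + 1) ^ (1 / α) ≤ eig E n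

end Operators

/-- The operator on `L²(μ)` associated with the form `∫_U ∑ B_{ij} ∂_i u ∂_j v̄ dx` whose domain
consists of the elements of `L²(μ)` satisfying `D`: `u` is in the form domain, and
`Q(u, v) = ⟨f, v⟩` for all `v` in the form domain. -/
def formOp {N : ℕ} (U : Set (Eu N)) (μ : Measure (Eu N)) (B : Eu N → Mat N)
    (D : (Eu N → ℂ) → Prop) (u f : Lp ℂ 2 μ) : Prop :=
  D u ∧ ∃ Gu, HasWeakGrad U u Gu ∧
    ∀ (v : Lp ℂ 2 μ) (Gv : Eu N → EuclideanSpace ℂ (Fin N)), D v → HasWeakGrad U v Gv →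
      ∫ x in U, ∑ i, ∑ j, (B x i j : ℂ) * Gu x i * conj (Gv x j) =
        ∫ x, f x * conj (v x) ∂μ

/-! ### The quantities attached to a transformation -/

/-- The Jacobian matrix `∇φ`. -/
def jac {N : ℕ} (φ : Eu N → Eu N) (x : Eu N) : Mat N :=
  Matrix.of fun i j => fderiv ℝ φ x (EuclideanSpace.single j 1) i

/-- `g = |det ∇φ|`. -/
def gdet {N : ℕ} (φ : Eu N → Eu N) (x : Eu N) : ℝ := |(jac φ x).det|

/-- The measure `g dx` on `Ω`. -/
def gmeas {N : ℕ} (Ω : Set (Eu N)) (φ : Eu N → Eu N) : Measure (Eu N) :=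
  (volume.restrict Ω).withDensity fun x => ENNReal.ofReal (gdet φ x)

/-- `a = (∇φ)⁻¹ A(φ) (∇φ)⁻ᵗ`. -/
def coeff {N : ℕ} (A : Eu N → Mat N) (φ : Eu N → Eu N) (x : Eu N) : Mat N :=
  (jac φ x)⁻¹ * A (φ x) * ((jac φ x)⁻¹).transpose

/-- The operator `L` on `L²(φ(Ω))`, formally `-∑ ∂_i (A_{ij} ∂_j u)`, with boundary
conditions `b`. -/
def opL {N : ℕ} (b : BC) (A : Eu N → Mat N) (Ω : Set (Eu N)) (φ : Eu N → Eu N) :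
    Lp ℂ 2 (volume.restrict (φ '' Ω)) → Lp ℂ 2 (volume.restrict (φ '' Ω)) → Prop :=
  formOp (φ '' Ω) (volume.restrict (φ '' Ω)) A (MemW b (φ '' Ω))

/-- The pulled back operator `H` on `L²(Ω, g dx)`, with form `∫_Ω a ∇u · ∇ū g dx` on `C_φ[𝒲]`
(for `φ` and its inverse Lipschitz, `g`, `1/g`, `a` and `a⁻¹` are bounded and this form is
already closed). -/
def opH {N : ℕ} (b : BC) (A : Eu N → Mat N) (Ω : Set (Eu N)) (φ : Eu N → Eu N) :
    Lp ℂ 2 (gmeas Ω φ) → Lp ℂ 2 (gmeas Ω φ) → Prop :=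
  formOp Ω (gmeas Ω φ) (fun x => gdet φ x • coeff A φ x) (MemPullback b Ω φ)

/-- The operator `T^*ST` on `L²(Ω, g dx)`, with form `∫_Ω ã ∇u · ∇ū g̃ dx` on `C_φ[𝒲]`
(again already closed). -/
def opTST {N : ℕ} (b : BC) (A : Eu N → Mat N) (Ω : Set (Eu N)) (φ φ' : Eu N → Eu N) :
    Lp ℂ 2 (gmeas Ω φ) → Lp ℂ 2 (gmeas Ω φ) → Prop :=
  formOp Ω (gmeas Ω φ) (fun x => gdet φ' x • coeff A φ' x) (MemPullback b Ω φ)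

/-- `w = g^{1/2} g̃^{-1/2}`. -/
def wfun {N : ℕ} (φ φ' : Eu N → Eu N) (x : Eu N) : ℝ :=
  √(gdet φ x) / √(gdet φ' x)

/-- The operator `w⁻¹ H̃ w` on `L²(Ω, g dx)`: `w u ∈ dom H̃` and `H̃ (w u) = w f`. -/
def opConj {N : ℕ} (b : BC) (A : Eu N → Mat N) (Ω : Set (Eu N)) (φ φ' : Eu N → Eu N)
    (u f : Lp ℂ 2 (gmeas Ω φ)) : Prop :=
  ∃ u' f' : Lp ℂ 2 (gmeas Ω φ'),
    u' =ᵐ[volume.restrict Ω] (fun x => (wfun φ φ' x : ℂ) * u x) ∧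
    f' =ᵐ[volume.restrict Ω] (fun x => (wfun φ φ' x : ℂ) * f x) ∧
    opH b A Ω φ' u' f'

/-- `S = w⁻² a^{-1/2} ã a^{-1/2}`. -/
def Smat {N : ℕ} (A : Eu N → Mat N) (φ φ' : Eu N → Eu N) (x : Eu N) : Mat N :=
  (wfun φ φ' x ^ 2)⁻¹ •
    ((CFC.sqrt (coeff A φ x))⁻¹ * coeff A φ' x * (CFC.sqrt (coeff A φ x))⁻¹)

/-- The `L^q` norm of a matrix valued function; matrices carry the operator norm associated
with the Euclidean norm. -/
def matNorm {N : ℕ} (q : ℝ≥0∞) (μ : Measure (Eu N)) (M : Eu N → Mat N) : ℝ≥0∞ :=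
  eLpNorm (fun x => ‖Matrix.toEuclideanCLM (𝕜 := ℝ) (M x)‖) q μ

/-- `δ_q^{(1)}(φ, φ̃)`. -/
def delta1 {N : ℕ} (Ω : Set (Eu N)) (q : ℝ≥0∞) (φ φ' : Eu N → Eu N) : ℝ≥0∞ :=
  eLpNorm (fun x => wfun φ φ' x - 1) q (gmeas Ω φ) +
    eLpNorm (fun x => (wfun φ φ' x)⁻¹ - 1) q (gmeas Ω φ)

/-- `δ_q^{(2)}(φ, φ̃)`. -/
def delta2 {N : ℕ} (A : Eu N → Mat N) (Ω : Set (Eu N)) (q : ℝ≥0∞) (φ φ' : Eu N → Eu N) :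
    ℝ≥0∞ :=
  matNorm q (gmeas Ω φ) (fun x =>
      (CFC.sqrt (Smat A φ φ' x) - (CFC.sqrt (Smat A φ φ' x))⁻¹) * CFC.sqrt (coeff A φ x)) +
    matNorm q (gmeas Ω φ) (fun x => (Smat A φ φ' x - 1) * CFC.sqrt (coeff A φ x))

/-- The measure of vicinity `δ_q(φ, φ̃)`. -/
def delta {N : ℕ} (A : Eu N → Mat N) (Ω : Set (Eu N)) (q : ℝ≥0∞) (φ φ' : Eu N → Eu N) :
    ℝ≥0∞ :=
  delta1 Ω q φ φ' + delta2 A Ω q φ φ'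

/-! ### Property (P) -/

/-- `q₀ / (q₀ - 2) = 1 / (1 - 2 / q₀)` for `q₀ ∈ ]2, ∞]`; it equals `1` for `q₀ = ∞`. -/
def qratio (q₀ : ℝ≥0∞) : ℝ≥0∞ := (1 - 2 / q₀)⁻¹

/-- Property (P1), for the sequence of eigenfunctions `ψ`. -/
def PropP1 {N : ℕ} {μ : Measure (Eu N)} (E : Lp ℂ 2 μ → Lp ℂ 2 μ → Prop) (ψ : ℕ → Lp ℂ 2 μ)
    (q₀ : ℝ≥0∞) (γ C₂ : ℝ) : Prop :=
  ∀ n, eig E n ≠ 0 → eLpNorm (ψ n) q₀ μ ≤ ENNReal.ofReal (C₂ * eig E n ^ γ)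

/-- Property (P2), for the sequence of eigenfunctions `ψ`. -/
def PropP2 {N : ℕ} (U : Set (Eu N)) {μ : Measure (Eu N)} (E : Lp ℂ 2 μ → Lp ℂ 2 μ → Prop)
    (ψ : ℕ → Lp ℂ 2 μ) (q₀ : ℝ≥0∞) (γ C₂ : ℝ) : Prop :=
  ∀ n, ∃ G, HasWeakGrad U (ψ n) G ∧
    eLpNorm G q₀ μ ≤ ENNReal.ofReal (C₂ * eig E n ^ (1 / 2 + γ))

end

end SpectralStability

/-! The argument uses eigenfunction expansions and a Hoffman–Wielandt inequality, with no resolvent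
identities. Let `E`, `E'` be two of the operators, with eigenvalues λ_i, λ'_m and eigenfunctions
ψ_i, ψ'_m. Both systems are complete, so p_im = |⟨ψ'_m, ψ_i⟩|² is doubly stochastic. For decreasing
f the sorted pairing maximises the cross term, whence ∑ (f(λ_n) - f(λ'_n))² ≤ ∑∑ (f(λ_i) - f(λ'_m))²
p_im (`hoffmanWielandt`). Here f(x) = (x + 1)^(-k) for x > 0. The kernels compared have equal
dimension, so f may be set to 0 at the eigenvalue 0 without changing the left side; this matters
because (P1) says nothing about the kernel.

Up to unitary equivalence `L` is `H` and the operator of φ̃ is `w⁻¹ H̃ w`; both are compared with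
`T^*ST`.

`H` against `T^*ST`: the Hilbert space is the same and the forms have coefficients B = ga and B' =
g̃ã. The product (λ_i - λ'_m)⟨ψ'_m, ψ_i⟩ is, up to sign, the form of E = B' - B evaluated at the two
gradients. Bernoulli's inequality bounds f(λ_i) - f(λ'_m) by (λ_i - λ'_m) times decaying factors.
For one index fixed, the sum over the other, weighted by inverse eigenvalues, is bounded by Bessel's
inequality for the energy form (`FormCoeff.bessel_rel`). This leaves the energy of a gradient for E
B⁻¹ E or E B'⁻¹ E. These equal g MᵀM, where M runs over the two matrices in δ (`BiLip.ae_vicinity`),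
and Hölder with (P2) concludes.

`w⁻¹ H̃ w` against `T^*ST`: the form is the same and the inner products differ. Evaluating the form
at wψ_i and ψ'_m in two ways gives λ_i⟨ψ'_m, w⁻¹ψ_i⟩ = λ'_m⟨ψ'_m, wψ_i⟩
(`BiLip.conj_eigen_identity`). Hence (λ_i - λ'_m)⟨ψ'_m, ψ_i⟩ is a combination of matrix elements of
w - 1 and w⁻¹ - 1, and Parseval, Hölder and (P1) conclude.

In both cases a sum of (λ + 1)^(-(2k-3-2γ)) over the non-zero eigenvalues remains. It converges by
the growth hypothesis once 2k - 3 - 2γ > α.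

The rest is the analysis behind the operators: bi-Lipschitz maps preserve the Sobolev spaces
(`BiLip.memW_comp`), so C_φ[𝒲] is the same space on Ω for φ and φ̃, and the area formula makes `L`
and `H` unitarily equivalent. -/

namespace SpectralStability

noncomputable section

/-! ### Eigenvalues and eigenvectors of non-negative symmetric relations. -/

section Spectral

variable {H : Type*} [NormedAddCommGroup H] [InnerProductSpace ℂ H]

/-- The relation `E` is symmetric, non-negative and single valued at `0`. -/
structure IsNonnegSymm (E : H → H → Prop) : Prop where
  symm : ∀ u f v h, E u f → E v h → inner ℂ f v = inner ℂ u h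
  nonneg : ∀ u f, E u f → 0 ≤ (inner ℂ u f).re
  eq_zero : ∀ f, E 0 f → f = 0

variable {E : H → H → Prop}

lemma IsNonnegSymm.eigenvalue_nonneg (hE : IsNonnegSymm E) {u : H} {μ : ℝ}
    (h : E u ((μ : ℂ) • u)) (hu : u ≠ 0) : 0 ≤ μ := by
  have h1 := hE.nonneg _ _ h
  rw [inner_smul_right, inner_self_eq_norm_sq_to_K] at h1
  have h2 : (0 : ℝ) < ‖u‖ ^ 2 := by positivity
  have h3 : ((μ : ℂ) * ((‖u‖ : ℝ) : ℂ) ^ 2).re = μ * ‖u‖ ^ 2 := by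
    rw [← Complex.ofReal_pow, ← Complex.ofReal_mul, Complex.ofReal_re]
  have h4 : 0 ≤ μ * ‖u‖ ^ 2 := by rw [← h3]; exact h1
  exact nonneg_of_mul_nonneg_left h4 h2

lemma IsNonnegSymm.eigSet_nonneg (hE : IsNonnegSymm E) (n : ℕ) {t : ℝ}
    (ht : ((n + 1 : ℕ) : Cardinal) ≤
      Module.rank ℂ (Submodule.span ℂ {u : H | ∃ μ : ℝ, μ ≤ t ∧ E u ((μ : ℂ) • u)})) :
    0 ≤ t := by
  by_contra hlt
  have hz : {u : H | ∃ μ : ℝ, μ ≤ t ∧ E u ((μ : ℂ) • u)} ⊆ {0} := by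
    rintro u ⟨μ, hμ, hu⟩
    by_contra hne
    have := hE.eigenvalue_nonneg hu hne
    linarith
  have hb : Submodule.span ℂ {u : H | ∃ μ : ℝ, μ ≤ t ∧ E u ((μ : ℂ) • u)} = ⊥ := by
    rw [eq_bot_iff, ← Submodule.span_zero_singleton ℂ]
    exact Submodule.span_mono hz
  rw [hb, rank_bot] at ht
  have h0 := le_antisymm ht zero_le
  exact Nat.succ_ne_zero n (by exact_mod_cast h0)

/-- Together with `IsEigenSeq.eigSet_nonempty` this makes the `sInf` in `eig` a true infimum, rather
than the default value 0 for an empty or unbounded set. -/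
lemma IsNonnegSymm.bddBelow (hE : IsNonnegSymm E) (n : ℕ) :
    BddBelow {t : ℝ | ((n + 1 : ℕ) : Cardinal) ≤
      Module.rank ℂ (Submodule.span ℂ {u : H | ∃ μ : ℝ, μ ≤ t ∧ E u ((μ : ℂ) • u)})} :=
  ⟨0, fun _ ht => hE.eigSet_nonneg n ht⟩

lemma IsNonnegSymm.eig_nonneg (hE : IsNonnegSymm E) (n : ℕ) : 0 ≤ eig E n :=
  Real.sInf_nonneg fun _ ht => hE.eigSet_nonneg n ht

/-- The source of all upper bounds for `eig E n`: n + 1 independent eigenvectors with eigenvalues at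
most t suffice. -/
lemma mem_eigSet_of_linearIndependent {n : ℕ} {t : ℝ} {v : Fin (n + 1) → H}
    (hv : LinearIndependent ℂ v) (h : ∀ i, ∃ μ : ℝ, μ ≤ t ∧ E (v i) ((μ : ℂ) • v i)) :
    ((n + 1 : ℕ) : Cardinal) ≤
      Module.rank ℂ (Submodule.span ℂ {u : H | ∃ μ : ℝ, μ ≤ t ∧ E u ((μ : ℂ) • u)}) := by
  have h1 : Module.rank ℂ (Submodule.span ℂ (range v)) ≤
      Module.rank ℂ (Submodule.span ℂ {u : H | ∃ μ : ℝ, μ ≤ t ∧ E u ((μ : ℂ) • u)}) :=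
    Submodule.rank_mono (Submodule.span_mono (by rintro _ ⟨i, rfl⟩; exact h i))
  refine le_trans ?_ h1
  rw [rank_span hv]
  have h2 := Cardinal.mk_range_eq_of_injective hv.injective
  simp only [Cardinal.mk_fin, Cardinal.lift_natCast] at h2
  exact Cardinal.lift_injective.{0} (by simpa using h2.symm) |>.le

lemma IsNonnegSymm.eig_le_of_linearIndependent (hE : IsNonnegSymm E) {n : ℕ} {t : ℝ}
    {v : Fin (n + 1) → H} (hv : LinearIndependent ℂ v)
    (h : ∀ i, ∃ μ : ℝ, μ ≤ t ∧ E (v i) ((μ : ℂ) • v i)) : eig E n ≤ t :=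
  csInf_le (hE.bddBelow n) (mem_eigSet_of_linearIndependent hv h)

lemma IsEigenSeq.eigSet_nonempty {ψ : ℕ → H} (hψ : IsEigenSeq E ψ) (n : ℕ) :
    {t : ℝ | ((n + 1 : ℕ) : Cardinal) ≤
      Module.rank ℂ (Submodule.span ℂ {u : H | ∃ μ : ℝ, μ ≤ t ∧ E u ((μ : ℂ) • u)})}.Nonempty := by
  refine ⟨∑ i : Fin (n + 1), |eig E i|, mem_eigSet_of_linearIndependent
    (v := fun i : Fin (n + 1) => ψ i) ?_ fun i => ⟨eig E i, ?_, hψ.2 i⟩⟩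
  · exact hψ.1.linearIndependent.comp _ Fin.val_injective
  · exact (le_abs_self _).trans (Finset.single_le_sum (f := fun i : Fin (n + 1) => |eig E i|)
      (fun _ _ => abs_nonneg _) (Finset.mem_univ i))

lemma IsEigenSeq.eig_mono (hE : IsNonnegSymm E) {ψ : ℕ → H} (hψ : IsEigenSeq E ψ) :
    Monotone (eig E) := by
  refine monotone_nat_of_le_succ fun n => ?_
  refine csInf_le_csInf (hE.bddBelow n) (hψ.eigSet_nonempty (n + 1)) fun t ht => ?_
  have h1 : ((n + 1 + 1 : ℕ) : Cardinal) ≤ _ := ht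
  have h2 : ((n + 1 : ℕ) : Cardinal) ≤ ((n + 1 + 1 : ℕ) : Cardinal) :=
    Nat.cast_le.2 (Nat.le_succ _)
  exact h2.trans h1

/-- Expresses the vanishing of eigenvalues through the size of the kernel, which can be transported
between operators on different spaces. -/
lemma IsEigenSeq.eig_eq_zero_iff (hE : IsNonnegSymm E) {ψ : ℕ → H} (hψ : IsEigenSeq E ψ) (n : ℕ) :
    eig E n = 0 ↔ ∃ v : Fin (n + 1) → H, LinearIndependent ℂ v ∧ ∀ i, E (v i) 0 := by
  constructor
  · intro h
    refine ⟨fun i => ψ i, hψ.1.linearIndependent.comp _ Fin.val_injective, fun i => ?_⟩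
    have h1 : eig E i = 0 :=
      le_antisymm (h ▸ hψ.eig_mono hE (Nat.lt_succ_iff.1 i.2)) (hE.eig_nonneg _)
    simpa [h1] using hψ.2 i
  · rintro ⟨v, hv, h0⟩
    refine le_antisymm (hE.eig_le_of_linearIndependent hv fun i => ⟨0, le_rfl, ?_⟩)
      (hE.eig_nonneg _)
    simpa using h0 i

/-- If the kernel of `E` embeds linearly into that of `E'`, the number of vanishing eigenvalues
of `E` does not exceed that of `E'`. -/
lemma IsEigenSeq.eig_eq_zero_of_ker {H' : Type*} [NormedAddCommGroup H'] [InnerProductSpace ℂ H']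
    {E' : H' → H' → Prop} (hE : IsNonnegSymm E) (hE' : IsNonnegSymm E')
    {ψ : ℕ → H} (hψ : IsEigenSeq E ψ) {ψ' : ℕ → H'} (hψ' : IsEigenSeq E' ψ')
    (J : H →ₗ[ℂ] H') (hJ : Function.Injective J) (hk : ∀ u, E u 0 → E' (J u) 0)
    {n : ℕ} (h : eig E n = 0) : eig E' n = 0 := by
  obtain ⟨v, hv, h0⟩ := (hψ.eig_eq_zero_iff hE n).1 h
  exact (hψ'.eig_eq_zero_iff hE' n).2 ⟨fun i => J (v i),
    hv.map' J (LinearMap.ker_eq_bot.2 hJ), fun i => hk _ (h0 i)⟩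

lemma IsNonnegSymm.resolvent_symm (hE : IsNonnegSymm E) {R : H →L[ℂ] H}
    (hR : ∀ u f : H, R f = u ↔ E u (f - u)) : (R : H →ₗ[ℂ] H).IsSymmetric := by
  intro f h
  have h3 := hE.symm _ _ _ _ ((hR _ f).1 rfl) ((hR _ h).1 rfl)
  rw [inner_sub_left, inner_sub_right] at h3
  exact (sub_left_injective h3).symm

variable [CompleteSpace H]

/-- The growth bound is silent at vanishing eigenvalues, so compactness has to exclude that all of
them vanish: the eigenspace of the resolvent at 1 would then be infinite dimensional. After the
first positive eigenvalue, monotonicity makes the growth bound apply. -/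
lemma IsEigenSeq.tendsto_eig (hE : IsNonnegSymm E) (hc : HasCompactResolvent E)
    {ψ : ℕ → H} (hψ : IsEigenSeq E ψ) {α C : ℝ} (hα : 0 < α) (hC : 0 < C)
    (hg : EigGrowth E α C) : Filter.Tendsto (eig E) Filter.atTop Filter.atTop := by
  obtain ⟨R, hRc, hR⟩ := hc
  have h0 : ∃ n, eig E n ≠ 0 := by
    by_contra! h0
    have hfin := ContinuousLinearMap.finite_dimensional_eigenspace hRc 1 one_ne_zero
    have hmem : ∀ n, ψ n ∈ Module.End.eigenspace (R : H →ₗ[ℂ] H) 1 := fun n => by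
      rw [Module.End.mem_eigenspace_iff, one_smul]
      refine (hR _ _).2 ?_
      have := hψ.2 n
      rw [h0 n] at this
      simpa using this
    have hli : LinearIndependent ℂ
        (fun n => (⟨ψ n, hmem n⟩ : Module.End.eigenspace (R : H →ₗ[ℂ] H) 1)) := by
      refine LinearIndependent.of_comp (Submodule.subtype _) ?_
      exact hψ.1.linearIndependent
    exact not_finite_iff_infinite.2 (inferInstance : Infinite ℕ) hli.finite
  obtain ⟨n₀, hn₀⟩ := h0
  have hpos := lt_of_le_of_ne (hE.eig_nonneg n₀) (Ne.symm hn₀)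
  have h1 : Filter.Tendsto (fun n : ℕ => C * ((n : ℝ) + 1) ^ (1 / α)) Filter.atTop
      Filter.atTop :=
    ((tendsto_rpow_atTop (by positivity)).comp (Filter.tendsto_atTop_add_const_right _ _
      tendsto_natCast_atTop_atTop)).const_mul_atTop hC
  refine Filter.tendsto_atTop_mono' _ ?_ h1
  filter_upwards [Filter.eventually_ge_atTop n₀] with n hn
  exact hg n (hpos.trans_le (hψ.eig_mono hE hn)).ne'

/-- The eigenvectors of an operator with compact resolvent form a complete system. -/
lemma IsEigenSeq.orthogonal_eq_bot (hE : IsNonnegSymm E) (hc : HasCompactResolvent E)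
    {ψ : ℕ → H} (hψ : IsEigenSeq E ψ)
    (hlim : Filter.Tendsto (eig E) Filter.atTop Filter.atTop) :
    (Submodule.span ℂ (range ψ))ᗮ = ⊥ := by
  obtain ⟨R, hRc, hR⟩ := hc
  have hRs := hE.resolvent_symm hR
  have hRψ : ∀ n, R (((eig E n : ℂ) + 1) • ψ n) = ψ n := fun n => by
    refine (hR _ _).2 ?_
    rw [add_smul, one_smul, add_sub_cancel_right]
    exact hψ.2 n
  have hmem : ∀ x, x ∈ (Submodule.span ℂ (range ψ))ᗮ ↔ ∀ n, inner ℂ (ψ n) x = 0 := fun x => by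
    rw [Submodule.mem_orthogonal]
    constructor
    · exact fun h n => h _ (Submodule.subset_span ⟨n, rfl⟩)
    · intro h u hu
      induction hu using Submodule.span_induction with
      | mem u hu => obtain ⟨n, rfl⟩ := hu; exact h n
      | zero => simp
      | add a b _ _ ha hb => rw [inner_add_left, ha, hb, add_zero]
      | smul c a _ ha => rw [inner_smul_left, ha, mul_zero]
  have hV : ∀ x ∈ (Submodule.span ℂ (range ψ))ᗮ, R x ∈ (Submodule.span ℂ (range ψ))ᗮ := by
    intro x hx
    rw [hmem] at hx ⊢
    intro n
    have h1 : inner ℂ (ψ n) (R x) = inner ℂ (R (ψ n)) x := (hRs _ _).symm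
    have h2 := hx n
    have h3 : ((eig E n : ℂ) + 1) ≠ 0 := by
      have := hE.eig_nonneg n
      exact_mod_cast (by linarith : eig E n + 1 ≠ 0)
    rw [← hRψ n, map_smul, inner_smul_left, mul_eq_zero] at h2
    rw [h1]
    exact h2.resolve_left (by simpa using h3)
  set V := (Submodule.span ℂ (range ψ))ᗮ with hVdef
  let S : V →L[ℂ] V := R.restrict hV
  have hSc : IsCompactOperator S := hRc.restrict' hV
  have hSs : (S : V →ₗ[ℂ] V).IsSymmetric := hRs.restrict_invariant hV
  -- A compact symmetric operator whose only eigenvalue is 0 vanishes. The restriction of the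
  -- resolvent to the orthogonal complement has no other eigenvalue, since its eigenvectors would be
  -- missing from the count defining `eig`.
  have hS0 : S = 0 := by
    rw [← ContinuousLinearMap.eq_zero_of_forall_hasEigenvalue_eq_zero hSc hSs]
    intro κ hκ
    by_contra hne
    obtain ⟨y, hy⟩ := hκ.exists_hasEigenvector
    have hyR : R (y : H) = κ • (y : H) := congrArg Subtype.val hy.apply_eq_smul
    have hconj : conj κ = κ := hSs.conj_eigenvalue_eq_self hκ
    have hre : ((κ.re : ℝ) : ℂ) = κ := Complex.conj_eq_iff_re.1 hconj
    have hy0 : (y : H) ≠ 0 := fun h => hy.2 (Subtype.ext h)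
    have hEy : E y (((κ.re⁻¹ - 1 : ℝ) : ℂ) • (y : H)) := by
      have h1 := (hR (y : H) (κ⁻¹ • (y : H))).1 (by rw [map_smul, hyR, smul_smul,
        inv_mul_cancel₀ hne, one_smul])
      rw [← hre] at h1
      rw [Complex.ofReal_sub, sub_smul, Complex.ofReal_inv, Complex.ofReal_one, one_smul]
      exact h1
    classical
    -- With `n₀` the first index whose eigenvalue exceeds t = κ⁻¹ - 1, the vectors ψ_0, …, ψ_{n₀-1}
    -- and y are n₀ + 1 independent eigenvectors with eigenvalues at most t. This forces eig E n₀ ≤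
    -- t, a contradiction.
    have hex : ∃ n, κ.re⁻¹ - 1 < eig E n := (hlim.eventually_gt_atTop _).exists
    have hspec := Nat.find_spec hex
    have hmin := fun m => Nat.find_min (m := m) hex
    set n₀ := Nat.find hex
    have hli : LinearIndependent ℂ (Fin.snoc (fun i : Fin n₀ => ψ i) (y : H) : Fin (n₀ + 1) → H) := by
      refine linearIndependent_finSnoc.2
        ⟨hψ.1.linearIndependent.comp _ Fin.val_injective, fun hmemy => ?_⟩
      have h1 : (y : H) ∈ Submodule.span ℂ (range ψ) :=
        Submodule.span_mono (by rintro _ ⟨i, rfl⟩; exact ⟨i, rfl⟩) hmemy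
      exact hy0 (inner_self_eq_zero.1 ((Submodule.mem_orthogonal _ _).1 y.2 _ h1))
    refine absurd (hE.eig_le_of_linearIndependent (t := κ.re⁻¹ - 1) hli fun i => ?_)
      (not_le.2 hspec)
    refine Fin.lastCases ?_ (fun j => ?_) i
    · exact ⟨κ.re⁻¹ - 1, le_rfl, by simpa using hEy⟩
    · exact ⟨eig E j, not_lt.1 (hmin j j.2), by simpa using hψ.2 j⟩
  rw [eq_bot_iff]
  intro x hx
  have h1 : R x = 0 := by
    have := congrArg Subtype.val (DFunLike.congr_fun hS0 ⟨x, hx⟩)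
    simpa [S] using this
  have h2 := (hR 0 x).1 h1
  rw [sub_zero] at h2
  exact hE.eq_zero x h2

/-- Parseval's identity in `ℝ≥0∞`, where double sums may be exchanged freely. It makes |⟨ψ'_m,
ψ_i⟩|² doubly stochastic. -/
lemma tsum_enorm_inner_sq {ψ : ℕ → H} (hψ : Orthonormal ℂ ψ)
    (h : (Submodule.span ℂ (range ψ))ᗮ = ⊥) (x : H) :
    ∑' n, ‖inner ℂ (ψ n) x‖ₑ ^ 2 = ‖x‖ₑ ^ 2 := by
  have h1 := (HilbertBasis.mkOfOrthogonalEqBot hψ h).hasSum_inner_mul_inner x x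
  simp only [HilbertBasis.coe_mkOfOrthogonalEqBot] at h1
  have h2 : ∀ n, inner ℂ x (ψ n) * inner ℂ (ψ n) x = ((‖inner ℂ (ψ n) x‖ ^ 2 : ℝ) : ℂ) := fun n => by
    rw [← inner_conj_symm x, RCLike.conj_mul]; norm_cast
  simp only [h2, inner_self_eq_norm_sq_to_K] at h1
  have h3 : HasSum (fun n => ‖inner ℂ (ψ n) x‖ ^ 2) (‖x‖ ^ 2) :=
    Complex.hasSum_ofReal.1 (by simpa using h1)
  have h4 := ENNReal.ofReal_tsum_of_nonneg (fun n => by positivity) h3.summable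
  rw [h3.tsum_eq] at h4
  simpa [ENNReal.ofReal_pow] using h4.symm

end Spectral

/-! ### Invariance under unitary equivalence. -/

section Transport

variable {H H' : Type} [NormedAddCommGroup H] [InnerProductSpace ℂ H]
  [NormedAddCommGroup H'] [InnerProductSpace ℂ H'] {E : H → H → Prop} {E' : H' → H' → Prop}

lemma eig_eq_of_equiv (U : H ≃ₗᵢ[ℂ] H') (h : ∀ u f, E u f ↔ E' (U u) (U f)) : eig E = eig E' := by
  funext n
  unfold eig
  congr 1
  ext t
  simp only [mem_ofPred_eq]
  have h1 : {u : H' | ∃ μ : ℝ, μ ≤ t ∧ E' u ((μ : ℂ) • u)} =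
      U.toLinearEquiv '' {u : H | ∃ μ : ℝ, μ ≤ t ∧ E u ((μ : ℂ) • u)} := by
    ext u
    constructor
    · rintro ⟨μ, hμ, hu⟩
      exact ⟨U.symm u, ⟨μ, hμ, by rw [h, map_smul]; simpa using hu⟩, by simp⟩
    · rintro ⟨v, ⟨μ, hμ, hv⟩, rfl⟩
      exact ⟨μ, hμ, by rw [h, map_smul] at hv; simpa using hv⟩
  have h2 := U.toLinearEquiv.rank_map_eq
    (Submodule.span ℂ {u : H | ∃ μ : ℝ, μ ≤ t ∧ E u ((μ : ℂ) • u)})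
  rw [h1, ← h2, Submodule.map_span]
  rfl

lemma HasCompactResolvent.of_equiv (U : H ≃ₗᵢ[ℂ] H') (h : ∀ u f, E u f ↔ E' (U u) (U f))
    (hc : HasCompactResolvent E) : HasCompactResolvent E' := by
  obtain ⟨R, hRc, hR⟩ := hc
  refine ⟨(U : H →L[ℂ] H') ∘L R ∘L (U.symm : H' →L[ℂ] H), ?_, fun u f => ?_⟩
  · exact (hRc.comp_clm (U.symm : H' →L[ℂ] H)).clm_comp (U : H →L[ℂ] H')
  · have h1 := hR (U.symm u) (U.symm f)
    rw [h] at h1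
    simp only [map_sub, LinearIsometryEquiv.apply_symm_apply] at h1
    rw [← h1]
    simp [LinearIsometryEquiv.eq_symm_apply]

end Transport

/-! ### A Hoffman–Wielandt inequality for infinite doubly stochastic matrices. -/

section HoffmanWielandt

open Filter Topology

/-- Telescoping. The truncated subtraction of `ℝ≥0∞` is exact because `a` decreases, and the
remainder `a N` tends to 0. -/
lemma tsum_ite_le_sub {a : ℕ → ℝ≥0∞} (ha : Antitone a) (h0 : Tendsto a atTop (𝓝 0)) (i : ℕ) :
    ∑' r, (if i ≤ r then a r - a (r + 1) else 0) = a i := by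
  have h1 : ∀ N, i ≤ N → (∑ r ∈ Finset.range N, if i ≤ r then a r - a (r + 1) else 0) + a N =
      a i := by
    intro N hN
    induction N, hN using Nat.le_induction with
    | base =>
      rw [Finset.sum_eq_zero, zero_add]
      intro r hr
      rw [if_neg (by simpa using hr)]
    | succ N hN ih =>
      rw [Finset.sum_range_succ, if_pos hN, add_assoc, tsub_add_cancel_of_le (ha N.le_succ), ih]
  have h2 := (ENNReal.summable (f := fun r => if i ≤ r then a r - a (r + 1) else 0)).hasSum.tendsto_sum_nat
  have h3 := (h2.add h0).congr' (f₂ := fun _ => a i) (by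
    filter_upwards [eventually_ge_atTop i] with N hN using h1 N hN)
  rw [add_zero] at h3
  exact tendsto_nhds_unique h3 tendsto_const_nhds

/-- Summation by parts: domination of partial sums is preserved by non-increasing weights. -/
lemma tsum_mul_le_of_sum_le {a b c : ℕ → ℝ≥0∞} (ha : Antitone a) (h0 : Tendsto a atTop (𝓝 0))
    (h : ∀ r, ∑ i ∈ Finset.range (r + 1), c i ≤ ∑ i ∈ Finset.range (r + 1), b i) :
    ∑' i, a i * c i ≤ ∑' i, a i * b i := by
  have key : ∀ c : ℕ → ℝ≥0∞, ∑' i, a i * c i =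
      ∑' r, (a r - a (r + 1)) * ∑ i ∈ Finset.range (r + 1), c i := fun c => by
    calc ∑' i, a i * c i = ∑' i, ∑' r, (if i ≤ r then a r - a (r + 1) else 0) * c i := by
          simp_rw [ENNReal.tsum_mul_right, tsum_ite_le_sub ha h0]
      _ = ∑' r, ∑' i, (if i ≤ r then a r - a (r + 1) else 0) * c i := ENNReal.tsum_comm
      _ = _ := by
          refine tsum_congr fun r => ?_
          rw [tsum_eq_sum (s := Finset.range (r + 1)), Finset.mul_sum]
          · refine Finset.sum_congr rfl fun i hi => ?_
            rw [if_pos (Nat.lt_succ_iff.1 (Finset.mem_range.1 hi))]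
          · intro i hi
            rw [if_neg (by simpa [Nat.lt_succ_iff] using hi), zero_mul]
  rw [key, key]
  exact ENNReal.tsum_le_tsum fun r => mul_le_mul_right (h r) _

/-- Two summations by parts, one in each index, reduce the claim to indicator sequences. There it
says that the block of `p` with s + 1 columns and r + 1 rows has total mass at most min(s + 1, r +
1), which follows from the row and column sums. -/
lemma tsum_tsum_mul_le {a b : ℕ → ℝ≥0∞} (ha : Antitone a) (ha0 : Tendsto a atTop (𝓝 0))
    (hb : Antitone b) (hb0 : Tendsto b atTop (𝓝 0)) {p : ℕ → ℕ → ℝ≥0∞}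
    (hr : ∀ i, ∑' m, p i m ≤ 1) (hc : ∀ m, ∑' i, p i m ≤ 1) :
    ∑' i, ∑' m, a i * b m * p i m ≤ ∑' n, a n * b n := by
  simp_rw [mul_assoc, ENNReal.tsum_mul_left]
  refine tsum_mul_le_of_sum_le ha ha0 fun r => ?_
  have h1 : ∑ i ∈ Finset.range (r + 1), ∑' m, b m * p i m =
      ∑' m, b m * ∑ i ∈ Finset.range (r + 1), p i m := by
    rw [← Summable.tsum_finsetSum (fun _ _ => ENNReal.summable)]
    simp_rw [Finset.mul_sum]
  have h2 : ∑ i ∈ Finset.range (r + 1), b i = ∑' m, b m * if m ∈ Finset.range (r + 1) then 1 else 0 := by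
    rw [tsum_eq_sum (s := Finset.range (r + 1))]
    · exact Finset.sum_congr rfl fun i hi => by rw [if_pos hi, mul_one]
    · intro i hi; rw [if_neg hi, mul_zero]
  rw [h1, h2]
  refine tsum_mul_le_of_sum_le hb hb0 fun s => ?_
  have h3 : ∑ m ∈ Finset.range (s + 1), (if m ∈ Finset.range (r + 1) then (1 : ℝ≥0∞) else 0) =
      ((min (s + 1) (r + 1) : ℕ) : ℝ≥0∞) := by
    rw [← Finset.sum_filter, Finset.sum_const, nsmul_one]
    congr 1
    rw [← Finset.card_range (min (s + 1) (r + 1))]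
    congr 1
    ext m
    simp
  rw [h3, Nat.mono_cast.map_min]
  refine le_min ?_ ?_
  · calc _ ≤ ∑ m ∈ Finset.range (s + 1), (1 : ℝ≥0∞) :=
        Finset.sum_le_sum fun m _ => (ENNReal.sum_le_tsum _).trans (hc m)
      _ = _ := by simp
  · rw [Finset.sum_comm]
    calc _ ≤ ∑ m ∈ Finset.range (r + 1), (1 : ℝ≥0∞) :=
        Finset.sum_le_sum fun m _ => (ENNReal.sum_le_tsum _).trans (hr m)
      _ = _ := by simp

lemma tsum_eq_tsum_shift {f : ℕ → ℝ≥0∞} {d : ℕ} (h : ∀ n < d, f n = 0) :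
    ∑' n, f n = ∑' n, f (n + d) := by
  have h1 := Summable.sum_add_tsum_nat_add' (k := d) (f := f) ENNReal.summable
  rw [← h1, Finset.sum_eq_zero fun n hn => h n (Finset.mem_range.1 hn), zero_add]

lemma ofReal_sub_sq_add {x y : ℝ} (hx : 0 ≤ x) (hy : 0 ≤ y) :
    ENNReal.ofReal ((x - y) ^ 2) + 2 * ENNReal.ofReal (x * y) =
      ENNReal.ofReal (x ^ 2) + ENNReal.ofReal (y ^ 2) := by
  have hxy : 0 ≤ x * y := mul_nonneg hx hy
  rw [two_mul, ← ENNReal.ofReal_add hxy hxy, ← ENNReal.ofReal_add (sq_nonneg x) (sq_nonneg y),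
    ← ENNReal.ofReal_add (sq_nonneg (x - y)) (add_nonneg hxy hxy)]
  congr 1
  ring

/-- A Hoffman–Wielandt type inequality for two sequences which vanish up to an index `d` and
decrease to zero afterwards. -/
theorem hoffmanWielandt {a b : ℕ → ℝ} {d : ℕ} (ha : ∀ n, 0 ≤ a n) (hb : ∀ n, 0 ≤ b n)
    (had : ∀ n < d, a n = 0) (hbd : ∀ n < d, b n = 0)
    (ham : Antitone fun n => a (n + d)) (hbm : Antitone fun n => b (n + d))
    (ha0 : Tendsto a atTop (𝓝 0)) (hb0 : Tendsto b atTop (𝓝 0))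
    (has : ∑' n, ENNReal.ofReal (a n ^ 2) ≠ ⊤) (hbs : ∑' n, ENNReal.ofReal (b n ^ 2) ≠ ⊤)
    {p : ℕ → ℕ → ℝ≥0∞} (hr : ∀ i, ∑' m, p i m = 1) (hc : ∀ m, ∑' i, p i m = 1) :
    ∑' n, ENNReal.ofReal ((a n - b n) ^ 2) ≤
      ∑' i, ∑' m, ENNReal.ofReal ((a i - b m) ^ 2) * p i m := by
  -- The square is expanded with the cross term moved to the side of the differences, so that no
  -- subtraction in `ℝ≥0∞` occurs. By double stochasticity the sums of squares on the right of `hX`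
  -- and `hZ` agree, and only the cross terms remain to be compared.
  have hX : ∑' n, ENNReal.ofReal ((a n - b n) ^ 2) + 2 * ∑' n, ENNReal.ofReal (a n * b n) =
      ∑' n, ENNReal.ofReal (a n ^ 2) + ∑' n, ENNReal.ofReal (b n ^ 2) := by
    rw [← ENNReal.tsum_mul_left, ← ENNReal.tsum_add, ← ENNReal.tsum_add]
    exact tsum_congr fun n => ofReal_sub_sq_add (ha n) (hb n)
  have hZ : ∑' i, ∑' m, ENNReal.ofReal ((a i - b m) ^ 2) * p i m +
      2 * ∑' i, ∑' m, ENNReal.ofReal (a i * b m) * p i m =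
      ∑' n, ENNReal.ofReal (a n ^ 2) + ∑' n, ENNReal.ofReal (b n ^ 2) := by
    have h1 : ∑' n, ENNReal.ofReal (a n ^ 2) = ∑' i, ∑' m, ENNReal.ofReal (a i ^ 2) * p i m := by
      simp_rw [ENNReal.tsum_mul_left, hr, mul_one]
    have h2 : ∑' n, ENNReal.ofReal (b n ^ 2) = ∑' i, ∑' m, ENNReal.ofReal (b m ^ 2) * p i m := by
      rw [ENNReal.tsum_comm]
      simp_rw [ENNReal.tsum_mul_left, hc, mul_one]
    rw [h1, h2, ← ENNReal.tsum_mul_left, ← ENNReal.tsum_add, ← ENNReal.tsum_add]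
    refine tsum_congr fun i => ?_
    rw [← ENNReal.tsum_mul_left, ← ENNReal.tsum_add, ← ENNReal.tsum_add]
    refine tsum_congr fun m => ?_
    rw [← mul_assoc, ← add_mul, ofReal_sub_sq_add (ha i) (hb m), add_mul]
  have hW : ∑' i, ∑' m, ENNReal.ofReal (a i * b m) * p i m ≤ ∑' n, ENNReal.ofReal (a n * b n) := by
    -- The common leading zeros add nothing to the cross terms. Removing them leaves decreasing
    -- sequences and a doubly substochastic matrix.
    rw [tsum_eq_tsum_shift (d := d) (f := fun i => ∑' m, ENNReal.ofReal (a i * b m) * p i m)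
      (fun n hn => by simp [had n hn]),
      tsum_eq_tsum_shift (d := d) (f := fun n => ENNReal.ofReal (a n * b n))
      (fun n hn => by simp [had n hn])]
    have h1 : ∀ i, ∑' m, ENNReal.ofReal (a (i + d) * b m) * p (i + d) m =
        ∑' m, ENNReal.ofReal (a (i + d)) * ENNReal.ofReal (b (m + d)) * p (i + d) (m + d) := by
      intro i
      rw [tsum_eq_tsum_shift (d := d) (f := fun m => ENNReal.ofReal (a (i + d) * b m) * p (i + d) m)
        (fun n hn => by simp [hbd n hn])]
      simp_rw [ENNReal.ofReal_mul (ha _)]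
    simp_rw [h1, ENNReal.ofReal_mul (ha _)]
    refine tsum_tsum_mul_le (a := fun n => ENNReal.ofReal (a (n + d)))
      (b := fun n => ENNReal.ofReal (b (n + d))) (p := fun i m => p (i + d) (m + d))
      (fun m n h => ENNReal.ofReal_le_ofReal (ham h)) ?_
      (fun m n h => ENNReal.ofReal_le_ofReal (hbm h)) ?_ ?_ ?_
    · simpa using ENNReal.tendsto_ofReal ((tendsto_add_atTop_iff_nat d).2 ha0)
    · simpa using ENNReal.tendsto_ofReal ((tendsto_add_atTop_iff_nat d).2 hb0)
    · exact fun i => (ENNReal.tsum_comp_le_tsum_of_injective (add_left_injective d)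
        (fun m => p (i + d) m)).trans (hr _).le
    · exact fun m => (ENNReal.tsum_comp_le_tsum_of_injective (add_left_injective d)
        (fun i => p i (m + d))).trans (hc _).le
  -- Finiteness of the cross term is what permits its cancellation in `ℝ≥0∞`; it is dominated by the
  -- sums of squares.
  have hY : 2 * ∑' n, ENNReal.ofReal (a n * b n) ≠ ⊤ := by
    refine ne_top_of_le_ne_top (ENNReal.add_ne_top.2 ⟨has, hbs⟩) (hX ▸ le_add_self)
  refine ENNReal.le_of_add_le_add_right hY ?_
  rw [hX, ← hZ]
  gcongr

end HoffmanWielandt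

/-! ### Differences of inverse powers. -/

section ScalarBounds

/-- Bernoulli's inequality for ((x + 1)/(y + 1))^k. Unlike the mean value bound it keeps a factor (y
+ 1)⁻¹ in the larger variable, which later supplies the weight in Bessel's inequality. -/
lemma inv_pow_sub_sq_le_of_le {x y : ℝ} (hx : 0 ≤ x) (hxy : x ≤ y) (k : ℕ) :
    (((x + 1) ^ k)⁻¹ - ((y + 1) ^ k)⁻¹) ^ 2 ≤
      (k : ℝ) ^ 2 * ((((x + 1) ^ k)⁻¹) ^ 2 * ((y + 1)⁻¹) ^ 2) * (x - y) ^ 2 := by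
  have hX : 0 < x + 1 := by linarith
  have hY : 0 < y + 1 := by linarith
  have h0 : ((y + 1) ^ k)⁻¹ ≤ ((x + 1) ^ k)⁻¹ := by gcongr
  have h1 : ((x + 1) ^ k)⁻¹ - ((y + 1) ^ k)⁻¹ ≤ k * (((x + 1) ^ k)⁻¹ * (y + 1)⁻¹) * (y - x) := by
    have h2 : 1 - k * ((y - x) * (y + 1)⁻¹) ≤ ((x + 1) * (y + 1)⁻¹) ^ k := by
      have h3 := one_add_mul_le_pow (a := -((y - x) * (y + 1)⁻¹)) (by
        have : (y - x) * (y + 1)⁻¹ ≤ 1 := by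
          rw [← div_eq_mul_inv, div_le_one hY]; linarith
        linarith) k
      have h4 : 1 + -((y - x) * (y + 1)⁻¹) = (x + 1) * (y + 1)⁻¹ := by field_simp; ring
      rw [h4] at h3
      linarith
    have h5 : ((y + 1) ^ k)⁻¹ = ((x + 1) ^ k)⁻¹ * ((x + 1) * (y + 1)⁻¹) ^ k := by
      rw [mul_pow, inv_pow]; field_simp
    rw [h5]
    have h6 : (0 : ℝ) ≤ ((x + 1) ^ k)⁻¹ := by positivity
    nlinarith [mul_le_mul_of_nonneg_left h2 h6]
  calc _ ≤ (k * (((x + 1) ^ k)⁻¹ * (y + 1)⁻¹) * (y - x)) ^ 2 := by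
        gcongr
    _ = _ := by ring

lemma inv_pow_sub_sq_le {x y : ℝ} (hx : 0 ≤ x) (hy : 0 ≤ y) (k : ℕ) :
    (((x + 1) ^ k)⁻¹ - ((y + 1) ^ k)⁻¹) ^ 2 ≤
      (k : ℝ) ^ 2 * ((((x + 1) ^ k)⁻¹) ^ 2 * ((y + 1)⁻¹) ^ 2 +
        (((y + 1) ^ k)⁻¹) ^ 2 * ((x + 1)⁻¹) ^ 2) * (x - y) ^ 2 := by
  rcases le_total x y with h | h
  · refine (inv_pow_sub_sq_le_of_le hx h k).trans ?_
    gcongr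
    exact le_add_of_nonneg_right (by positivity)
  · have := inv_pow_sub_sq_le_of_le hy h k
    rw [← neg_sub, neg_sq, ← neg_sub y x, neg_sq]
    refine this.trans ?_
    gcongr
    exact le_add_of_nonneg_left (by positivity)

end ScalarBounds

/-! ### Abstract comparison of two eigenvalue sequences. -/

section EigenvalueComparison

open Filter Topology

/-- The sum over the non-zero eigenvalues is controlled by this constant. -/
def growthSum (α C e : ℝ) : ℝ≥0∞ :=
  ∑' n : ℕ, ENNReal.ofReal ((C * ((n : ℝ) + 1) ^ (1 / α)) ^ (-e))

/-- The terms are a constant times (n + 1)^(-e/α), a convergent series as e/α > 1. -/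
lemma growthSum_ne_top {α C e : ℝ} (hC : 0 < C) (he : α < e) (hα : 0 < α) :
    growthSum α C e ≠ ⊤ := by
  have h1 : Summable fun n : ℕ => C ^ (-e) * ((n + 1 : ℕ) : ℝ) ^ (-(e / α)) :=
    ((summable_nat_add_iff 1).2 (Real.summable_nat_rpow.2 (by
      rw [neg_lt_neg_iff, lt_div_iff₀ hα]; linarith))).mul_left _
  have h2 : ∀ n : ℕ, (C * ((n : ℝ) + 1) ^ (1 / α)) ^ (-e) =
      C ^ (-e) * ((n + 1 : ℕ) : ℝ) ^ (-(e / α)) := fun n => by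
    have h3 : (0 : ℝ) ≤ (n : ℝ) + 1 := by positivity
    rw [Real.mul_rpow hC.le (Real.rpow_nonneg h3 _), ← Real.rpow_mul h3]
    push_cast
    congr 2
    ring
  unfold growthSum
  simp_rw [h2]
  rw [← ENNReal.ofReal_tsum_of_nonneg (fun n => by positivity) h1]
  exact ENNReal.ofReal_ne_top

/-- `(x + 1)^{-e}` off zero, and `0` at zero. -/
def offZeroWeight (e x : ℝ) : ℝ≥0∞ := if x = 0 then 0 else ENNReal.ofReal ((x + 1) ^ (-e))

lemma tsum_offZeroWeight_le {α C e : ℝ} (hC : 0 < C) (he : 0 ≤ e) {ev : ℕ → ℝ}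
    (hg : ∀ n, ev n ≠ 0 → C * ((n : ℝ) + 1) ^ (1 / α) ≤ ev n) :
    ∑' n, offZeroWeight e (ev n) ≤ growthSum α C e := by
  refine ENNReal.tsum_le_tsum fun n => ?_
  unfold offZeroWeight
  split_ifs with h
  · exact zero_le
  · refine ENNReal.ofReal_le_ofReal
      (Real.rpow_le_rpow_of_nonpos (by positivity) ?_ (by linarith))
    linarith [hg n h]

/-- `(x + 1)^{-k}` off zero, and `0` at zero. -/
def offZeroDecay (k : ℕ) (x : ℝ) : ℝ := if x = 0 then 0 else ((x + 1) ^ k)⁻¹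

lemma offZeroDecay_nonneg (k : ℕ) {x : ℝ} (hx : 0 ≤ x) : 0 ≤ offZeroDecay k x := by
  unfold offZeroDecay; split_ifs <;> positivity

lemma ofReal_offZeroDecay_sq_le {k : ℕ} {e x : ℝ} (hx : 0 ≤ x) (he : e ≤ 2 * k) :
    ENNReal.ofReal (offZeroDecay k x ^ 2) ≤ offZeroWeight e x := by
  unfold offZeroDecay offZeroWeight
  split_ifs with h
  · simp
  · refine ENNReal.ofReal_le_ofReal ?_
    rw [inv_pow, ← pow_mul, ← Real.rpow_natCast, ← Real.rpow_neg (by positivity)]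
    refine Real.rpow_le_rpow_of_exponent_le (by linarith) ?_
    push_cast
    linarith

lemma exists_zero_index {ev : ℕ → ℝ} (h0 : ∀ n, 0 ≤ ev n) (hm : Monotone ev)
    (ht : Tendsto ev atTop atTop) : ∃ d, ∀ n, ev n = 0 ↔ n < d := by
  classical
  have hex : ∃ n, 0 < ev n := (ht.eventually_gt_atTop 0).exists
  refine ⟨Nat.find hex, fun n => ⟨fun h => ?_, fun h => ?_⟩⟩
  · by_contra hn
    exact absurd ((Nat.find_spec hex).trans_le (hm (not_lt.1 hn))) (by simp [h])
  · exact le_antisymm (not_lt.1 (Nat.find_min hex h)) (h0 n)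

/-- Comparison of two sequences of eigenvalues with doubly stochastic weights `p`. -/
theorem tsum_eigenvalue_comparison {ev ev' : ℕ → ℝ} (h0 : ∀ n, 0 ≤ ev n) (h0' : ∀ n, 0 ≤ ev' n)
    (hm : Monotone ev) (hm' : Monotone ev') (ht : Tendsto ev atTop atTop)
    (ht' : Tendsto ev' atTop atTop) (hz : ∀ n, ev n = 0 ↔ ev' n = 0)
    {α C e : ℝ} {k : ℕ} (hα : 0 < α) (hC : 0 < C) (he : α < e) (hek : e ≤ 2 * k)
    (hg : ∀ n, ev n ≠ 0 → C * ((n : ℝ) + 1) ^ (1 / α) ≤ ev n)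
    (hg' : ∀ n, ev' n ≠ 0 → C * ((n : ℝ) + 1) ^ (1 / α) ≤ ev' n)
    {p : ℕ → ℕ → ℝ≥0∞} (hr : ∀ i, ∑' m, p i m = 1) (hc : ∀ m, ∑' i, p i m = 1)
    {U V : ℕ → ℕ → ℝ≥0∞} {Q : ℝ≥0∞}
    (hUV : ∀ i m, ENNReal.ofReal ((offZeroDecay k (ev i) - offZeroDecay k (ev' m)) ^ 2) * p i m ≤
      U i m + V i m)
    (hU : ∀ i, ∑' m, U i m ≤ Q * offZeroWeight e (ev i))
    (hV : ∀ m, ∑' i, V i m ≤ Q * offZeroWeight e (ev' m)) :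
    ∑' n, ENNReal.ofReal ((((ev n + 1) ^ k)⁻¹ - ((ev' n + 1) ^ k)⁻¹) ^ 2) ≤
      2 * Q * growthSum α C e := by
  obtain ⟨d, hd⟩ := exists_zero_index h0 hm ht
  have hd' : ∀ n, ev' n = 0 ↔ n < d := fun n => (hz n).symm.trans (hd n)
  have hk : k ≠ 0 := by
    rintro rfl
    simp only [Nat.cast_zero, mul_zero] at hek
    linarith
  have anti : ∀ ev : ℕ → ℝ, (∀ n, 0 ≤ ev n) → Monotone ev → (∀ n, ev n = 0 ↔ n < d) →
      Antitone fun n => offZeroDecay k (ev (n + d)) := by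
    intro ev h0 hm hd m n hmn
    have h1 : ∀ n, ev (n + d) ≠ 0 := fun n h => absurd ((hd _).1 h) (by omega)
    simp only [offZeroDecay, h1, if_false]
    have h2 := hm (show m + d ≤ n + d by omega)
    have h3 := h0 (m + d)
    gcongr
  have lim : ∀ ev : ℕ → ℝ, (∀ n, 0 ≤ ev n) → Tendsto ev atTop atTop →
      Tendsto (fun n => offZeroDecay k (ev n)) atTop (𝓝 0) := by
    intro ev h0 ht
    refine squeeze_zero (fun n => offZeroDecay_nonneg k (h0 n))
      (g := fun n => ((ev n + 1) ^ k)⁻¹) (fun n => ?_) ?_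
    · unfold offZeroDecay
      split_ifs
      · have := h0 n; positivity
      · exact le_rfl
    · exact tendsto_inv_atTop_zero.comp ((tendsto_pow_atTop hk).comp
        (tendsto_atTop_add_const_right _ _ ht))
  have fin : ∀ ev : ℕ → ℝ, (∀ n, 0 ≤ ev n) →
      (∀ n, ev n ≠ 0 → C * ((n : ℝ) + 1) ^ (1 / α) ≤ ev n) →
      ∑' n, ENNReal.ofReal (offZeroDecay k (ev n) ^ 2) ≠ ⊤ := by
    intro ev h0 hg
    refine ne_top_of_le_ne_top (growthSum_ne_top hC he hα)
      (le_trans (ENNReal.tsum_le_tsum fun n => ?_)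
        (tsum_offZeroWeight_le hC (hα.trans he).le hg))
    exact ofReal_offZeroDecay_sq_le (h0 n) hek
  -- Both sequences vanish at the same indices, where the two terms cancel. Setting the decay
  -- function to 0 there costs nothing and spares the kernels, on which there is no bound.
  have heq : ∀ n, ENNReal.ofReal ((((ev n + 1) ^ k)⁻¹ - ((ev' n + 1) ^ k)⁻¹) ^ 2) =
      ENNReal.ofReal ((offZeroDecay k (ev n) - offZeroDecay k (ev' n)) ^ 2) := fun n => by
    unfold offZeroDecay
    by_cases h : ev n = 0
    · simp [h, (hz n).1 h]
    · simp [h, (hz n).not.1 h]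
  simp_rw [heq]
  calc _ ≤ ∑' i, ∑' m,
        ENNReal.ofReal ((offZeroDecay k (ev i) - offZeroDecay k (ev' m)) ^ 2) * p i m :=
        hoffmanWielandt (d := d) (fun n => offZeroDecay_nonneg k (h0 n))
          (fun n => offZeroDecay_nonneg k (h0' n))
          (fun n hn => by simp [offZeroDecay, (hd n).2 hn])
          (fun n hn => by simp [offZeroDecay, (hd' n).2 hn])
          (anti ev h0 hm hd) (anti ev' h0' hm' hd') (lim ev h0 ht) (lim ev' h0' ht')
          (fin ev h0 hg) (fin ev' h0' hg') hr hc
    _ ≤ ∑' i, ∑' m, (U i m + V i m) :=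
        ENNReal.tsum_le_tsum fun i => ENNReal.tsum_le_tsum fun m => hUV i m
    _ = ∑' i, ∑' m, U i m + ∑' m, ∑' i, V i m := by
        simp_rw [ENNReal.tsum_add]
        rw [ENNReal.tsum_comm (f := V)]
    _ ≤ ∑' i, Q * offZeroWeight e (ev i) + ∑' m, Q * offZeroWeight e (ev' m) :=
        add_le_add (ENNReal.tsum_le_tsum hU) (ENNReal.tsum_le_tsum hV)
    _ ≤ Q * growthSum α C e + Q * growthSum α C e := by
        rw [ENNReal.tsum_mul_left, ENNReal.tsum_mul_left]
        gcongr
        · exact tsum_offZeroWeight_le hC (hα.trans he).le hg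
        · exact tsum_offZeroWeight_le hC (hα.trans he).le hg'
    _ = _ := by ring

/-- Two operators with the same form domain: `D i m` is the square of the difference of the
forms evaluated at the eigenvectors. -/
theorem tsum_eigenvalue_comparison_form {ev ev' : ℕ → ℝ} (h0 : ∀ n, 0 ≤ ev n)
    (h0' : ∀ n, 0 ≤ ev' n)
    (hm : Monotone ev) (hm' : Monotone ev') (ht : Tendsto ev atTop atTop)
    (ht' : Tendsto ev' atTop atTop) (hz : ∀ n, ev n = 0 ↔ ev' n = 0)
    {α C γ : ℝ} {k : ℕ} (hα : 0 < α) (hC : 0 < C) (hγ : 0 < γ) (he : α < 2 * k - 3 - 2 * γ)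
    (hg : ∀ n, ev n ≠ 0 → C * ((n : ℝ) + 1) ^ (1 / α) ≤ ev n)
    (hg' : ∀ n, ev' n ≠ 0 → C * ((n : ℝ) + 1) ^ (1 / α) ≤ ev' n)
    {p : ℕ → ℕ → ℝ≥0∞} (hr : ∀ i, ∑' m, p i m = 1) (hc : ∀ m, ∑' i, p i m = 1)
    {D : ℕ → ℕ → ℝ≥0∞} (hD : ∀ i m, ENNReal.ofReal ((ev i - ev' m) ^ 2) * p i m = D i m)
    (hDz : ∀ i m, ev i = 0 → D i m = 0) (hDz' : ∀ i m, ev' m = 0 → D i m = 0)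
    {B : ℝ≥0∞}
    (hB : ∀ i, ev i ≠ 0 → ∑' m, (if ev' m = 0 then 0 else ENNReal.ofReal (ev' m)⁻¹) * D i m ≤
      B * ENNReal.ofReal (ev i ^ (1 + 2 * γ)))
    (hB' : ∀ m, ev' m ≠ 0 → ∑' i, (if ev i = 0 then 0 else ENNReal.ofReal (ev i)⁻¹) * D i m ≤
      B * ENNReal.ofReal (ev' m ^ (1 + 2 * γ))) :
    ∑' n, ENNReal.ofReal ((((ev n + 1) ^ k)⁻¹ - ((ev' n + 1) ^ k)⁻¹) ^ 2) ≤
      2 * (ENNReal.ofReal ((k : ℝ) ^ 2) * B) * growthSum α C (2 * k - 3 - 2 * γ) := by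
  -- The left side is at most (x + 1)^(-(2k-1-2γ)). The weaker exponent 2k - 3 - 2γ is kept so that
  -- both comparisons use the same `growthSum`.
  have hweight : ∀ x : ℝ, 0 < x → ENNReal.ofReal (((((x + 1) ^ k)⁻¹) ^ 2)) *
      ENNReal.ofReal (x ^ (1 + 2 * γ)) ≤ offZeroWeight (2 * k - 3 - 2 * γ) x := by
    intro x hx
    rw [offZeroWeight, if_neg hx.ne', ← ENNReal.ofReal_mul (by positivity)]
    refine ENNReal.ofReal_le_ofReal ?_
    calc _ ≤ (x + 1) ^ (-(2 * k : ℝ)) * (x + 1) ^ (1 + 2 * γ) := by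
          have h1 : ((((x + 1) ^ k)⁻¹) ^ 2) = (x + 1) ^ (-(2 * k : ℝ)) := by
            rw [inv_pow, ← pow_mul, ← Real.rpow_natCast, ← Real.rpow_neg (by positivity)]
            push_cast
            congr 1
            ring
          rw [h1]
          gcongr
          linarith
      _ = (x + 1) ^ (-(2 * k : ℝ) + (1 + 2 * γ)) := (Real.rpow_add (by positivity) _ _).symm
      _ ≤ _ := Real.rpow_le_rpow_of_exponent_le (by linarith) (by linarith)
  have hpos : ∀ i, ev i ≠ 0 → 0 < ev i := fun i h => lt_of_le_of_ne (h0 i) (Ne.symm h)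
  have hpos' : ∀ i, ev' i ≠ 0 → 0 < ev' i := fun i h => lt_of_le_of_ne (h0' i) (Ne.symm h)
  refine tsum_eigenvalue_comparison h0 h0' hm hm' ht ht' hz hα hC he (by linarith) hg hg' hr hc
    (U := fun i m => if ev i = 0 then 0 else
      ENNReal.ofReal ((k : ℝ) ^ 2) * ENNReal.ofReal ((((ev i + 1) ^ k)⁻¹) ^ 2) *
      ((if ev' m = 0 then 0 else ENNReal.ofReal (ev' m)⁻¹) * D i m))
    (V := fun i m => if ev' m = 0 then 0 else
      ENNReal.ofReal ((k : ℝ) ^ 2) * ENNReal.ofReal ((((ev' m + 1) ^ k)⁻¹) ^ 2) *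
      ((if ev i = 0 then 0 else ENNReal.ofReal (ev i)⁻¹) * D i m))
    (fun i m => ?_) (fun i => ?_) (fun m => ?_)
  · by_cases h : ev i = 0
    · by_cases h' : ev' m = 0
      · simp [h, h', offZeroDecay]
      -- When exactly one of the eigenvalues is 0 the form difference vanishes, so the two
      -- eigenvectors are orthogonal and the term disappears.
      · have h1 := (hD i m).trans (hDz i m h)
        rw [mul_eq_zero] at h1
        have h2 : p i m = 0 := h1.resolve_left (by
          rw [h, ENNReal.ofReal_eq_zero, not_le]
          have := hpos' m h'
          nlinarith)
        simp [h2]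
    · by_cases h' : ev' m = 0
      · have h1 := (hD i m).trans (hDz' i m h')
        rw [mul_eq_zero] at h1
        have h2 : p i m = 0 := h1.resolve_left (by
          rw [h', ENNReal.ofReal_eq_zero, not_le]
          have := hpos i h
          nlinarith)
        simp [h2]
      · have hx := hpos i h
        have hy := hpos' m h'
        simp only [h, h', if_false, offZeroDecay]
        -- This trades the factor left by Bernoulli's inequality for the weight 1/λ occurring in
        -- Bessel's inequality for the energy form.
        have hinv : ∀ y : ℝ, 0 < y → ((y + 1)⁻¹) ^ 2 ≤ y⁻¹ := fun y hy => by
          rw [inv_pow]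
          gcongr
          nlinarith
        rw [← mul_assoc, ← mul_assoc, ← add_mul, ← hD, ← mul_assoc]
        refine mul_le_mul_left ?_ _
        rw [← ENNReal.ofReal_mul (by positivity), ← ENNReal.ofReal_mul (by positivity),
          ← ENNReal.ofReal_mul (by positivity), ← ENNReal.ofReal_mul (by positivity),
          ← ENNReal.ofReal_add (by positivity) (by positivity), ← ENNReal.ofReal_mul (by positivity)]
        refine ENNReal.ofReal_le_ofReal ((inv_pow_sub_sq_le hx.le hy.le k).trans ?_)
        refine mul_le_mul_of_nonneg_right ?_ (sq_nonneg _)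
        rw [mul_add, ← mul_assoc, ← mul_assoc]
        gcongr
        · exact hinv _ hy
        · exact hinv _ hx
  · by_cases h : ev i = 0
    · simp [h]
    · simp only [h, if_false]
      rw [ENNReal.tsum_mul_left]
      calc _ ≤ ENNReal.ofReal ((k : ℝ) ^ 2) * ENNReal.ofReal ((((ev i + 1) ^ k)⁻¹) ^ 2) *
            (B * ENNReal.ofReal (ev i ^ (1 + 2 * γ))) := mul_le_mul_right (hB i h) _
        _ = ENNReal.ofReal ((k : ℝ) ^ 2) * B * (ENNReal.ofReal ((((ev i + 1) ^ k)⁻¹) ^ 2) *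
            ENNReal.ofReal (ev i ^ (1 + 2 * γ))) := by ring
        _ ≤ _ := mul_le_mul_right (hweight _ (hpos i h)) _
  · by_cases h : ev' m = 0
    · simp [h]
    · simp only [h, if_false]
      rw [ENNReal.tsum_mul_left]
      calc _ ≤ ENNReal.ofReal ((k : ℝ) ^ 2) * ENNReal.ofReal ((((ev' m + 1) ^ k)⁻¹) ^ 2) *
            (B * ENNReal.ofReal (ev' m ^ (1 + 2 * γ))) := mul_le_mul_right (hB' m h) _
        _ = ENNReal.ofReal ((k : ℝ) ^ 2) * B * (ENNReal.ofReal ((((ev' m + 1) ^ k)⁻¹) ^ 2) *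
            ENNReal.ofReal (ev' m ^ (1 + 2 * γ))) := by ring
        _ ≤ _ := mul_le_mul_right (hweight _ (hpos' m h)) _

/-- Two operators with the same form and different inner products: `R` and `T` are the squares of
the matrix coefficients of the multiplication operators comparing the inner products. -/
theorem tsum_eigenvalue_comparison_weight {ev ev' : ℕ → ℝ} (h0 : ∀ n, 0 ≤ ev n)
    (h0' : ∀ n, 0 ≤ ev' n)
    (hm : Monotone ev) (hm' : Monotone ev') (ht : Tendsto ev atTop atTop)
    (ht' : Tendsto ev' atTop atTop) (hz : ∀ n, ev n = 0 ↔ ev' n = 0)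
    {α C γ : ℝ} {k : ℕ} (hα : 0 < α) (hC : 0 < C) (hγ : 0 < γ) (he : α < 2 * k - 3 - 2 * γ)
    (hg : ∀ n, ev n ≠ 0 → C * ((n : ℝ) + 1) ^ (1 / α) ≤ ev n)
    (hg' : ∀ n, ev' n ≠ 0 → C * ((n : ℝ) + 1) ^ (1 / α) ≤ ev' n)
    {p : ℕ → ℕ → ℝ≥0∞} (hr : ∀ i, ∑' m, p i m = 1) (hc : ∀ m, ∑' i, p i m = 1)
    {R T : ℕ → ℕ → ℝ≥0∞}
    (hRT : ∀ i m, ENNReal.ofReal ((ev i - ev' m) ^ 2) * p i m ≤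
      2 * (ENNReal.ofReal (ev i ^ 2) * R i m + ENNReal.ofReal (ev' m ^ 2) * T i m))
    {B : ℝ≥0∞}
    (hB : ∀ i, ev i ≠ 0 → ∑' m, (R i m + T i m) ≤ B * ENNReal.ofReal (ev i ^ (2 * γ)))
    (hB' : ∀ m, ev' m ≠ 0 → ∑' i, (R i m + T i m) ≤ B * ENNReal.ofReal (ev' m ^ (2 * γ))) :
    ∑' n, ENNReal.ofReal ((((ev n + 1) ^ k)⁻¹ - ((ev' n + 1) ^ k)⁻¹) ^ 2) ≤
      2 * (2 * ENNReal.ofReal ((k : ℝ) ^ 2) * B) * growthSum α C (2 * k - 3 - 2 * γ) := by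
  have hk : 2 ≤ k := by
    have : (3 : ℝ) < 2 * k := by linarith
    have : 3 < 2 * k := by exact_mod_cast this
    omega
  have hk1 : (1 : ℝ) ≤ (k : ℝ) ^ 2 := by
    have : (1 : ℝ) ≤ k := by exact_mod_cast (by omega : 1 ≤ k)
    nlinarith
  -- the weight `(x + 1)^{2 - 2k}`
  let W : ℝ → ℝ := fun x => ((((x + 1) ^ (k - 1))⁻¹) ^ 2)
  -- The bound `hRT` carries λ², so two powers of (λ + 1) are spent and the decay falls from 2k to
  -- 2k - 2.
  have hWx : ∀ x : ℝ, 0 ≤ x → (((x + 1) ^ k)⁻¹) ^ 2 * (x + 1) ^ 2 = W x := fun x hx => by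
    have h1 : (x + 1) ^ k = (x + 1) ^ (k - 1) * (x + 1) := by
      rw [← pow_succ]; congr 1; omega
    simp only [W]
    have : 0 < x + 1 := by linarith
    rw [h1]
    field_simp
  have hW0 : ∀ x, 0 ≤ W x := fun x => sq_nonneg _
  have hW1 : ∀ x, 0 ≤ x → (((x + 1) ^ k)⁻¹) ^ 2 ≤ W x := fun x hx => by
    rw [← hWx x hx]
    exact le_mul_of_one_le_right (sq_nonneg _) (by nlinarith)
  have hW2 : ∀ x, 0 ≤ x → (((x + 1) ^ k)⁻¹) ^ 2 * x ^ 2 ≤ W x := fun x hx => by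
    rw [← hWx x hx]
    gcongr
    linarith
  have hweight : ∀ x : ℝ, 0 < x → ENNReal.ofReal (W x) *
      ENNReal.ofReal (x ^ (2 * γ)) ≤ offZeroWeight (2 * k - 3 - 2 * γ) x := by
    intro x hx
    rw [offZeroWeight, if_neg hx.ne', ← ENNReal.ofReal_mul (by positivity)]
    refine ENNReal.ofReal_le_ofReal ?_
    calc _ ≤ (x + 1) ^ (-(2 * k - 2 : ℝ)) * (x + 1) ^ (2 * γ) := by
          have h1 : W x = (x + 1) ^ (-(2 * k - 2 : ℝ)) := by
            simp only [W]
            rw [inv_pow, ← pow_mul, ← Real.rpow_natCast, ← Real.rpow_neg (by positivity)]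
            rw [Nat.cast_mul, Nat.cast_sub (by omega)]
            push_cast
            congr 1
            ring
          rw [h1]
          gcongr
          linarith
      _ = (x + 1) ^ (-(2 * k - 2 : ℝ) + 2 * γ) := (Real.rpow_add (by positivity) _ _).symm
      _ ≤ _ := Real.rpow_le_rpow_of_exponent_le (by linarith) (by linarith)
  have hpos : ∀ i, ev i ≠ 0 → 0 < ev i := fun i h => lt_of_le_of_ne (h0 i) (Ne.symm h)
  have hpos' : ∀ i, ev' i ≠ 0 → 0 < ev' i := fun i h => lt_of_le_of_ne (h0' i) (Ne.symm h)
  have hfrac : ∀ x : ℝ, 0 ≤ x → x ^ 2 * ((x + 1)⁻¹) ^ 2 ≤ 1 := fun x hx => by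
    rw [← mul_pow]
    refine pow_le_one₀ (by positivity) ?_
    rw [← div_eq_mul_inv, div_le_one (by linarith)]
    linarith
  have hfrac1 : ∀ x : ℝ, 0 ≤ x → ((x + 1)⁻¹) ^ 2 ≤ 1 := fun x hx =>
    pow_le_one₀ (by positivity) (inv_le_one_of_one_le₀ (by linarith))
  refine tsum_eigenvalue_comparison h0 h0' hm hm' ht ht' hz hα hC he (by linarith) hg hg' hr hc
    (U := fun i m => if ev i = 0 then 0 else
      2 * ENNReal.ofReal ((k : ℝ) ^ 2) * ENNReal.ofReal (W (ev i)) * (R i m + T i m))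
    (V := fun i m => if ev' m = 0 then 0 else
      2 * ENNReal.ofReal ((k : ℝ) ^ 2) * ENNReal.ofReal (W (ev' m)) * (R i m + T i m))
    (fun i m => ?_) (fun i => ?_) (fun m => ?_)
  -- If one eigenvalue is 0, then `hRT` contains the square of the other one on both sides;
  -- cancelling it bounds `p` by `R` or `T` directly, and the decay function at the non-zero
  -- eigenvalue supplies the weight.
  · have hzero : ∀ x : ℝ, 0 < x → ∀ P Y : ℝ≥0∞,
        ENNReal.ofReal (x ^ 2) * P ≤ 2 * (ENNReal.ofReal (x ^ 2) * Y) → P ≤ 2 * Y := by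
      intro x hx P Y h
      rw [mul_left_comm] at h
      refine (ENNReal.mul_le_mul_iff_right ?_ ENNReal.ofReal_ne_top).1 h
      simpa using hx.ne'
    have hone : ∀ x : ℝ, 0 < x → ENNReal.ofReal ((((x + 1) ^ k)⁻¹) ^ 2) ≤
        ENNReal.ofReal ((k : ℝ) ^ 2) * ENNReal.ofReal (W x) := fun x hx => by
      rw [← ENNReal.ofReal_mul (by positivity)]
      refine ENNReal.ofReal_le_ofReal ((hW1 x hx.le).trans ?_)
      exact le_mul_of_one_le_left (hW0 x) hk1
    by_cases h : ev i = 0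
    · by_cases h' : ev' m = 0
      · simp [h, h', offZeroDecay]
      · have h1 := hRT i m
        simp only [h, zero_sub, neg_sq] at h1
        have h2 := hzero _ (hpos' m h') _ _ (by simpa using h1)
        simp only [h, h', if_true, if_false, offZeroDecay, zero_sub, neg_sq, zero_add]
        calc _ ≤ (ENNReal.ofReal ((k : ℝ) ^ 2) * ENNReal.ofReal (W (ev' m))) * (2 * T i m) :=
              mul_le_mul' (hone _ (hpos' m h')) h2
          _ = 2 * ENNReal.ofReal ((k : ℝ) ^ 2) * ENNReal.ofReal (W (ev' m)) * T i m := by ring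
          _ ≤ _ := mul_le_mul_right le_add_self _
    · by_cases h' : ev' m = 0
      · have h1 := hRT i m
        simp only [h', sub_zero] at h1
        have h2 := hzero _ (hpos i h) _ _ (by simpa using h1)
        simp only [h, h', if_true, if_false, offZeroDecay, sub_zero, add_zero]
        calc _ ≤ (ENNReal.ofReal ((k : ℝ) ^ 2) * ENNReal.ofReal (W (ev i))) * (2 * R i m) :=
              mul_le_mul' (hone _ (hpos i h)) h2
          _ = 2 * ENNReal.ofReal ((k : ℝ) ^ 2) * ENNReal.ofReal (W (ev i)) * R i m := by ring
          _ ≤ _ := mul_le_mul_right le_self_add _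
      · have hx := hpos i h
        have hy := hpos' m h'
        simp only [h, h', if_false, offZeroDecay]
        set x := ev i
        set y := ev' m
        set G : ℝ := (((x + 1) ^ k)⁻¹) ^ 2 * ((y + 1)⁻¹) ^ 2 +
          (((y + 1) ^ k)⁻¹) ^ 2 * ((x + 1)⁻¹) ^ 2 with hG
        have hG0 : 0 ≤ G := by positivity
        have hGx : G * x ^ 2 ≤ W x + W y := by
          have e1 : (((x + 1) ^ k)⁻¹) ^ 2 * x ^ 2 * ((y + 1)⁻¹) ^ 2 ≤ W x :=
            (mul_le_of_le_one_right (by positivity) (hfrac1 y hy.le)).trans (hW2 x hx.le)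
          have e2 : (((y + 1) ^ k)⁻¹) ^ 2 * (x ^ 2 * ((x + 1)⁻¹) ^ 2) ≤ W y :=
            (mul_le_of_le_one_right (by positivity) (hfrac x hx.le)).trans (hW1 y hy.le)
          calc _ = _ := by rw [hG]; ring
            _ ≤ _ := add_le_add e1 e2
        have hGy : G * y ^ 2 ≤ W x + W y := by
          have e1 : (((y + 1) ^ k)⁻¹) ^ 2 * y ^ 2 * ((x + 1)⁻¹) ^ 2 ≤ W y :=
            (mul_le_of_le_one_right (by positivity) (hfrac1 x hx.le)).trans (hW2 y hy.le)
          have e2 : (((x + 1) ^ k)⁻¹) ^ 2 * (y ^ 2 * ((y + 1)⁻¹) ^ 2) ≤ W x :=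
            (mul_le_of_le_one_right (by positivity) (hfrac y hy.le)).trans (hW1 x hx.le)
          calc _ = _ := by rw [hG]; ring
            _ ≤ _ := add_le_add e2 e1
        calc _ ≤ ENNReal.ofReal ((k : ℝ) ^ 2 * G * (x - y) ^ 2) * p i m :=
              mul_le_mul_left (ENNReal.ofReal_le_ofReal (inv_pow_sub_sq_le hx.le hy.le k)) _
          _ = ENNReal.ofReal ((k : ℝ) ^ 2 * G) * (ENNReal.ofReal ((x - y) ^ 2) * p i m) := by
              rw [ENNReal.ofReal_mul (by positivity), mul_assoc]
          _ ≤ ENNReal.ofReal ((k : ℝ) ^ 2 * G) *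
              (2 * (ENNReal.ofReal (x ^ 2) * R i m + ENNReal.ofReal (y ^ 2) * T i m)) :=
              mul_le_mul_right (hRT i m) _
          _ = 2 * ENNReal.ofReal ((k : ℝ) ^ 2) *
              (ENNReal.ofReal (G * x ^ 2) * R i m + ENNReal.ofReal (G * y ^ 2) * T i m) := by
              rw [ENNReal.ofReal_mul (by positivity), ENNReal.ofReal_mul hG0,
                ENNReal.ofReal_mul hG0]
              ring
          _ ≤ 2 * ENNReal.ofReal ((k : ℝ) ^ 2) *
              (ENNReal.ofReal (W x + W y) * R i m + ENNReal.ofReal (W x + W y) * T i m) := by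
              gcongr
          _ = _ := by
              rw [ENNReal.ofReal_add (hW0 _) (hW0 _)]
              ring
  · by_cases h : ev i = 0
    · simp [h]
    · simp only [h, if_false]
      rw [ENNReal.tsum_mul_left]
      calc _ ≤ 2 * ENNReal.ofReal ((k : ℝ) ^ 2) * ENNReal.ofReal (W (ev i)) *
            (B * ENNReal.ofReal (ev i ^ (2 * γ))) := mul_le_mul_right (hB i h) _
        _ = 2 * ENNReal.ofReal ((k : ℝ) ^ 2) * B * (ENNReal.ofReal (W (ev i)) *
            ENNReal.ofReal (ev i ^ (2 * γ))) := by ring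
        _ ≤ _ := mul_le_mul_right (hweight _ (hpos i h)) _
  · by_cases h : ev' m = 0
    · simp [h]
    · simp only [h, if_false]
      rw [ENNReal.tsum_mul_left]
      calc _ ≤ 2 * ENNReal.ofReal ((k : ℝ) ^ 2) * ENNReal.ofReal (W (ev' m)) *
            (B * ENNReal.ofReal (ev' m ^ (2 * γ))) := mul_le_mul_right (hB' m h) _
        _ = 2 * ENNReal.ofReal ((k : ℝ) ^ 2) * B * (ENNReal.ofReal (W (ev' m)) *
            ENNReal.ofReal (ev' m ^ (2 * γ))) := by ring
        _ ≤ _ := mul_le_mul_right (hweight _ (hpos' m h)) _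

end EigenvalueComparison

/-! ### Mollification in L². -/

section Mollification

open Filter Topology ContinuousLinearMap

lemma eLpNorm_two_sq {α F : Type*} [MeasurableSpace α] [NormedAddCommGroup F] (μ : Measure α)
    (f : α → F) : eLpNorm f 2 μ ^ 2 = ∫⁻ x, ‖f x‖ₑ ^ 2 ∂μ := by
  have h := eLpNorm_nnreal_pow_eq_lintegral (μ := μ) (f := f) (p := 2) (by norm_num)
  simpa using h

variable {N : ℕ} {F : Type*} [NormedAddCommGroup F] [NormedSpace ℝ F]

/-- Mollification with the normalised bump function `ρ`. -/
def mollify (ρ : ContDiffBump (0 : Eu N)) (f : Eu N → F) : Eu N → F :=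
  convolution (ρ.normed volume) f (lsmul ℝ ℝ) volume

lemma mollify_apply (ρ : ContDiffBump (0 : Eu N)) (f : Eu N → F) (x : Eu N) :
    mollify ρ f x = ∫ t, ρ.normed volume t • f (x - t) := rfl

lemma mollify_congr (ρ : ContDiffBump (0 : Eu N)) {f g : Eu N → F} (h : f =ᵐ[volume] g) :
    mollify ρ f = mollify ρ g := by
  funext x
  refine integral_congr_ae ?_
  have h1 := (quasiMeasurePreserving_sub_left volume x).ae_eq_comp h
  filter_upwards [h1] with t ht
  simp only [Function.comp_apply] at ht
  simp [ht]

lemma lintegral_normed (ρ : ContDiffBump (0 : Eu N)) :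
    ∫⁻ t, ENNReal.ofReal (ρ.normed volume t) = 1 := by
  rw [← ofReal_integral_eq_lintegral_ofReal (ρ.integrable_normed)
    (ae_of_all _ fun t => ρ.nonneg_normed t), ρ.integral_normed, ENNReal.ofReal_one]

/-- Mollification averages translates over the probability measure `P` with density ρ. Pointwise,
the L¹ norm for `P` is at most the L² norm; Tonelli and translation invariance then give the
contraction. -/
lemma eLpNorm_mollify_le_of_stronglyMeasurable (ρ : ContDiffBump (0 : Eu N)) {f : Eu N → F}
    (hf : StronglyMeasurable f) :
    eLpNorm (mollify ρ f) 2 volume ≤ eLpNorm f 2 volume := by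
  have hρm : Measurable fun t => ENNReal.ofReal (ρ.normed volume t) :=
    ρ.continuous_normed.measurable.ennreal_ofReal
  set P : Measure (Eu N) := volume.withDensity fun t => ENNReal.ofReal (ρ.normed volume t) with hP
  have hprob : IsProbabilityMeasure P := ⟨by
    rw [hP, withDensity_apply _ MeasurableSet.univ, Measure.restrict_univ, lintegral_normed]⟩
  have hpt : ∀ x, ‖mollify ρ f x‖ₑ ^ 2 ≤ ∫⁻ t, ‖f (x - t)‖ₑ ^ 2 ∂P := fun x => by
    have hfx : StronglyMeasurable fun t => f (x - t) :=
      hf.comp_measurable (measurable_const.sub measurable_id)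
    have h1 : ‖mollify ρ f x‖ₑ ≤ eLpNorm (fun t => f (x - t)) 1 P := by
      rw [eLpNorm_one_eq_lintegral_enorm, hP,
        lintegral_withDensity_eq_lintegral_mul _ hρm hfx.enorm]
      refine (enorm_integral_le_lintegral_enorm _).trans (lintegral_mono fun t => ?_)
      rw [lsmul_apply, enorm_smul, Real.enorm_eq_ofReal (ρ.nonneg_normed t)]
      rfl
    have h2 := h1.trans (eLpNorm_le_eLpNorm_of_exponent_le (p := 1) (q := 2) (by norm_num)
      hfx.aestronglyMeasurable)
    rw [← eLpNorm_two_sq]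
    gcongr
  have h3 : eLpNorm (mollify ρ f) 2 volume ^ 2 ≤ eLpNorm f 2 volume ^ 2 := by
    rw [eLpNorm_two_sq, eLpNorm_two_sq]
    calc _ ≤ ∫⁻ x, ∫⁻ t, ‖f (x - t)‖ₑ ^ 2 ∂P := lintegral_mono hpt
      _ = ∫⁻ t, ∫⁻ x, ‖f (x - t)‖ₑ ^ 2 ∂volume ∂P := by
          refine lintegral_lintegral_swap ?_
          have : StronglyMeasurable fun z : Eu N × Eu N => f (z.1 - z.2) :=
            hf.comp_measurable (measurable_fst.sub measurable_snd)
          exact (this.enorm.pow_const 2).aemeasurable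
      _ = ∫⁻ t, ∫⁻ x, ‖f x‖ₑ ^ 2 ∂volume ∂P := by
          refine lintegral_congr fun t => ?_
          exact lintegral_sub_right_eq_self (fun x => ‖f x‖ₑ ^ 2) t
      _ = _ := by simp
  exact (ENNReal.pow_le_pow_left_iff two_ne_zero).1 h3

lemma eLpNorm_mollify_le (ρ : ContDiffBump (0 : Eu N)) {f : Eu N → F}
    (hf : AEStronglyMeasurable f volume) :
    eLpNorm (mollify ρ f) 2 volume ≤ eLpNorm f 2 volume := by
  rw [mollify_congr ρ hf.ae_eq_mk, eLpNorm_congr_ae hf.ae_eq_mk]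
  exact eLpNorm_mollify_le_of_stronglyMeasurable ρ hf.stronglyMeasurable_mk

variable [CompleteSpace F]

/-- For a small radius the difference is uniformly small by uniform continuity and lives on the
fixed compact set `K`, so its L² norm is at most η times the square root of the measure of `K`. -/
lemma exists_eLpNorm_mollify_sub_le_of_continuous {f : Eu N → F} (hf : Continuous f)
    (hs : HasCompactSupport f) {ε : ℝ≥0∞} (hε : ε ≠ 0) :
    ∃ δ > 0, ∀ ρ : ContDiffBump (0 : Eu N), ρ.rOut < δ →
      eLpNorm (fun x => mollify ρ f x - f x) 2 volume ≤ ε := by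
  set K := Metric.cthickening 1 (tsupport f) with hK
  have hKc : IsCompact K := hs.isCompact.cthickening
  obtain ⟨η, hη, hηε⟩ : ∃ η : ℝ, 0 < η ∧
      volume K ^ (2 : ℝ≥0∞).toReal⁻¹ * ENNReal.ofReal η ≤ ε := by
    have hfin : volume K ^ (2 : ℝ≥0∞).toReal⁻¹ ≠ ⊤ :=
      ENNReal.rpow_ne_top_of_nonneg (by simp) hKc.measure_lt_top.ne
    have hlim : Tendsto (fun η : ℝ => volume K ^ (2 : ℝ≥0∞).toReal⁻¹ * ENNReal.ofReal η)
        (𝓝[>] 0) (𝓝 0) := by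
      have h1 : Tendsto (fun η : ℝ => ENNReal.ofReal η) (𝓝[>] 0) (𝓝 0) := by
        simpa using (ENNReal.continuous_ofReal.tendsto 0).mono_left nhdsWithin_le_nhds
      simpa using ENNReal.Tendsto.const_mul h1 (Or.inr hfin)
    have h2 := hlim.eventually (ge_mem_nhds (pos_iff_ne_zero.2 hε))
    obtain ⟨η, h3, h4⟩ := (h2.and self_mem_nhdsWithin).exists
    exact ⟨η, h4, h3⟩
  obtain ⟨δ, hδ, hδf⟩ := Metric.uniformContinuous_iff.1
    (hs.uniformContinuous_of_continuous hf) η hη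
  refine ⟨min δ 1, lt_min hδ one_pos, fun ρ hρ => ?_⟩
  have hb : ∀ x, ‖mollify ρ f x - f x‖ ≤ η := fun x => by
    rw [← dist_eq_norm]
    refine ρ.dist_normed_convolution_le hf.aestronglyMeasurable fun y hy => (hδf ?_).le
    exact (Metric.mem_ball.1 hy).trans (hρ.trans_le (min_le_left _ _))
  have hz : ∀ x, x ∉ K → mollify ρ f x - f x = 0 := fun x hx => by
    have h1 : ∀ y, dist y x ≤ 1 → f y = 0 := fun y hy => by
      by_contra hne
      refine hx (Metric.mem_cthickening_of_dist_le x y 1 _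
        (subset_tsupport _ hne) (by rwa [dist_comm]))
    have h2 : mollify ρ f x = 0 := by
      rw [mollify_apply]
      refine integral_eq_zero_of_ae (ae_of_all _ fun t => ?_)
      by_cases ht : t ∈ Metric.ball (0 : Eu N) 1
      · simp only [Pi.zero_apply]
        rw [h1, smul_zero]
        simpa [dist_eq_norm] using (mem_ball_zero_iff.1 ht).le
      · have : ρ.normed volume t = 0 := by
          have h3 : t ∉ Function.support (ρ.normed volume) := by
            rw [ρ.support_normed_eq]
            exact fun h => ht (Metric.ball_subset_ball (hρ.le.trans (min_le_right _ _)) h)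
          simpa using h3
        simp [this]
    rw [h2, h1 x (by simp), sub_zero]
  have hind : (fun x => mollify ρ f x - f x) = K.indicator fun x => mollify ρ f x - f x := by
    funext x
    by_cases hx : x ∈ K
    · rw [indicator_of_mem hx]
    · rw [indicator_of_notMem hx, hz x hx]
  rw [hind, eLpNorm_indicator_eq_eLpNorm_restrict hKc.measurableSet]
  refine (eLpNorm_le_of_ae_bound (C := η) (ae_of_all _ hb)).trans ?_
  rwa [Measure.restrict_apply_univ]

/-- Mollifications converge in `L²`. -/
lemma exists_eLpNorm_mollify_sub_le {f : Eu N → F} (hf : MemLp f 2 volume) {ε : ℝ≥0∞}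
    (hε : ε ≠ 0) :
    ∃ δ > 0, ∀ ρ : ContDiffBump (0 : Eu N), ρ.rOut < δ →
      eLpNorm (fun x => mollify ρ f x - f x) 2 volume ≤ ε := by
  have hε3 : ε / 3 ≠ 0 := (ENNReal.div_pos hε (by norm_num)).ne'
  -- Density of continuous compactly supported functions, the contraction property and the
  -- continuous case each contribute ε/3.
  obtain ⟨g, hgs, hfg, hgc, hg⟩ := hf.exists_hasCompactSupport_eLpNorm_sub_le (by norm_num) hε3
  obtain ⟨δ, hδ, hδg⟩ := exists_eLpNorm_mollify_sub_le_of_continuous hgc hgs hε3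
  refine ⟨δ, hδ, fun ρ hρ => ?_⟩
  have hint : ∀ h : Eu N → F, MemLp h 2 volume → ∀ x,
      Integrable (fun t => ρ.normed volume t • h (x - t)) := fun h hh x => by
    have := (hh.locallyIntegrable (by norm_num))
    exact (ρ.hasCompactSupport_normed.convolutionExists_left (lsmul ℝ ℝ) ρ.continuous_normed this x)
  have hsub : ∀ x, mollify ρ (f - g) x = mollify ρ f x - mollify ρ g x := fun x => by
    simp only [mollify_apply, Pi.sub_apply, smul_sub]
    exact integral_sub (hint f hf x) (hint g hg x)
  have hmeas : ∀ h : Eu N → F, MemLp h 2 volume → AEStronglyMeasurable (mollify ρ h) volume :=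
    fun h hh => (ρ.hasCompactSupport_normed.continuous_convolution_left (lsmul ℝ ℝ)
      ρ.continuous_normed (hh.locallyIntegrable (by norm_num))).aestronglyMeasurable
  have heq : (fun x => mollify ρ f x - f x) =
      (mollify ρ (f - g) + fun x => mollify ρ g x - g x) - (f - g) := by
    funext x
    simp only [Pi.add_apply, Pi.sub_apply, hsub]
    abel
  rw [heq]
  have hA := eLpNorm_mollify_le ρ (hf.sub hg).1
  calc _ ≤ eLpNorm (mollify ρ (f - g) + fun x => mollify ρ g x - g x) 2 volume +
        eLpNorm (f - g) 2 volume :=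
        eLpNorm_sub_le ((hmeas _ (hf.sub hg)).add ((hmeas _ hg).sub hg.1)) (hf.sub hg).1
          (by norm_num)
    _ ≤ eLpNorm (mollify ρ (f - g)) 2 volume + eLpNorm (fun x => mollify ρ g x - g x) 2 volume +
        eLpNorm (f - g) 2 volume := by
        gcongr
        exact eLpNorm_add_le (hmeas _ (hf.sub hg)) ((hmeas _ hg).sub hg.1) (by norm_num)
    _ ≤ ε / 3 + ε / 3 + ε / 3 := by
        gcongr
        · exact hA.trans hfg
        · exact hδg ρ hρ
    _ = ε := ENNReal.add_thirds ε

end Mollification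

/-! ### Weak gradients: uniqueness and the product rule with a cut-off. -/

section WeakGradients

open Filter Topology

variable {N : ℕ} {U : Set (Eu N)}

lemma grad_apply (ζ : Eu N → ℂ) (x : Eu N) (i : Fin N) :
    grad ζ x i = fderiv ℝ ζ x (EuclideanSpace.single i 1) := rfl

lemma locallyIntegrableOn_congr {F : Type*} [NormedAddCommGroup F] {f g : Eu N → F}
    (h : f =ᵐ[volume.restrict U] g) (hf : LocallyIntegrableOn f U volume) :
    LocallyIntegrableOn g U volume := by
  intro x hx
  obtain ⟨t, ht, hft⟩ := hf x hx
  refine ⟨t ∩ U, inter_mem ht self_mem_nhdsWithin, ?_⟩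
  refine (hft.mono_set inter_subset_left).congr ?_
  exact ae_restrict_of_ae_restrict_of_subset inter_subset_right h

lemma locallyIntegrableOn_of_memLp {F : Type*} [NormedAddCommGroup F] {f : Eu N → F}
    (hf : MemLp f 2 (volume.restrict U)) : LocallyIntegrableOn f U volume :=
  locallyIntegrableOn_of_locallyIntegrable_restrict (hf.locallyIntegrable (by norm_num))

lemma HasWeakGrad.congr {u u' : Eu N → ℂ} {G G' : Eu N → EuclideanSpace ℂ (Fin N)}
    (h : HasWeakGrad U u G) (hu : u =ᵐ[volume.restrict U] u')
    (hG : G =ᵐ[volume.restrict U] G') : HasWeakGrad U u' G' := by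
  refine ⟨locallyIntegrableOn_congr hu h.1, locallyIntegrableOn_congr hG h.2.1,
    fun ζ hζ i => ?_⟩
  have h1 : ∫ x in U, u x * grad ζ x i = ∫ x in U, u' x * grad ζ x i :=
    integral_congr_ae (by filter_upwards [hu] with x hx using by rw [hx])
  have h2 : ∫ x in U, G x i * ζ x = ∫ x in U, G' x i * ζ x :=
    integral_congr_ae (by filter_upwards [hG] with x hx using by rw [hx])
  rw [← h1, ← h2]
  exact h.2.2 ζ hζ i

lemma IsTest.of_real {g : Eu N → ℝ} (hg : ContDiff ℝ ∞ g) (hc : HasCompactSupport g)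
    (hs : tsupport g ⊆ U) : IsTest U fun x => (g x : ℂ) := by
  have h1 : Function.support (fun x => (g x : ℂ)) = Function.support g := by
    ext x; simp
  have h2 : tsupport (fun x => (g x : ℂ)) = tsupport g := by rw [tsupport, h1, tsupport]
  refine ⟨Complex.ofRealCLM.contDiff.comp hg, ?_, h2 ▸ hs⟩
  rw [HasCompactSupport, h2]
  exact hc

/-- The fundamental lemma of the calculus of variations; real-valued test functions, viewed as
complex ones, already suffice. -/
lemma ae_eq_zero_of_integral_test (hU : IsOpen U) {f : Eu N → ℂ}
    (hf : LocallyIntegrableOn f U volume)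
    (h : ∀ ζ, IsTest U ζ → ∫ x in U, f x * ζ x = 0) : f =ᵐ[volume.restrict U] 0 := by
  have h1 := hU.ae_eq_zero_of_integral_contDiff_smul_eq_zero (μ := volume) hf
    (fun g hg hc hs => by
      have h2 := h _ (IsTest.of_real hg hc hs)
      rw [setIntegral_eq_integral_of_forall_compl_eq_zero] at h2
      · rw [← h2]
        refine integral_congr_ae (ae_of_all _ fun x => ?_)
        simp [mul_comm]
      · intro x hx
        have : g x = 0 := image_eq_zero_of_notMem_tsupport fun h => hx (hs h)
        simp [this])
  exact (ae_restrict_iff' hU.measurableSet).2 h1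

lemma integrable_mul_test {f : Eu N → ℂ} (hf : LocallyIntegrableOn f U volume) {ζ : Eu N → ℂ}
    (hc : Continuous ζ) (hs : HasCompactSupport ζ) (hsU : tsupport ζ ⊆ U) :
    IntegrableOn (fun x => f x * ζ x) U volume := by
  have h1 : IntegrableOn (fun x => f x * ζ x) (tsupport ζ) volume :=
    (hf.integrableOn_compact_subset hsU hs).mul_continuousOn hc.continuousOn hs
  have h2 : Integrable (fun x => f x * ζ x) volume := by
    refine h1.integrable_of_forall_notMem_eq_zero fun x hx => ?_
    rw [image_eq_zero_of_notMem_tsupport hx, mul_zero]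
  exact h2.integrableOn

lemma LocallyIntegrableOn.euclidean_apply {G : Eu N → EuclideanSpace ℂ (Fin N)}
    (hG : LocallyIntegrableOn G U volume) (i : Fin N) :
    LocallyIntegrableOn (fun x => G x i) U volume := by
  intro x hx
  obtain ⟨t, ht, hGt⟩ := hG x hx
  exact ⟨t, ht, (EuclideanSpace.proj (𝕜 := ℂ) i).integrable_comp hGt⟩

/-- Weak gradients are unique. -/
lemma HasWeakGrad.ae_eq (hU : IsOpen U) {u : Eu N → ℂ} {G G' : Eu N → EuclideanSpace ℂ (Fin N)}
    (h : HasWeakGrad U u G) (h' : HasWeakGrad U u G') : G =ᵐ[volume.restrict U] G' := by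
  have h1 : ∀ i, (fun x => G x i - G' x i) =ᵐ[volume.restrict U] 0 := fun i => by
    refine ae_eq_zero_of_integral_test hU
      ((LocallyIntegrableOn.euclidean_apply h.2.1 i).sub
        (LocallyIntegrableOn.euclidean_apply h'.2.1 i)) fun ζ hζ => ?_
    simp_rw [sub_mul]
    rw [integral_sub, ← neg_eq_iff_eq_neg.2 (h.2.2 ζ hζ i), ← neg_eq_iff_eq_neg.2 (h'.2.2 ζ hζ i),
      sub_self]
    · exact integrable_mul_test (LocallyIntegrableOn.euclidean_apply h.2.1 i)
        hζ.1.continuous hζ.2.1 hζ.2.2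
    · exact integrable_mul_test (LocallyIntegrableOn.euclidean_apply h'.2.1 i)
        hζ.1.continuous hζ.2.1 hζ.2.2
  filter_upwards [ae_all_iff.2 h1] with x hx
  ext i
  exact sub_eq_zero.1 (hx i)

/-- A smooth cut-off function. -/
lemma exists_cutoff {K : Set (Eu N)} (hK : IsCompact K) (hU : IsOpen U) (hKU : K ⊆ U) :
    ∃ χ : Eu N → ℝ, ContDiff ℝ ∞ χ ∧ HasCompactSupport χ ∧ tsupport χ ⊆ U ∧
      ∀ x ∈ K, ∀ᶠ y in 𝓝 x, χ y = 1 := by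
  obtain ⟨L, hL, hKL, hLU⟩ := exists_compact_between hK hU hKU
  obtain ⟨f, hf1, hf0, -⟩ := exists_contMDiffMap_one_nhds_of_subset_interior (n := ⊤)
    (modelWithCornersSelf ℝ (Eu N)) hK.isClosed hKL
  have hsupp : tsupport f ⊆ L := by
    refine closure_minimal (fun x hx => ?_) hL.isClosed
    by_contra h
    exact hx (hf0 x h)
  refine ⟨f, f.contMDiff.contDiff, hL.of_isClosed_subset (isClosed_tsupport _) hsupp,
    hsupp.trans hLU, fun x hx => ?_⟩
  exact hf1.filter_mono (nhds_le_nhdsSet hx)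

lemma fderiv_real_smul {χ : Eu N → ℝ} {ζ : Eu N → ℂ} {x : Eu N} (hχ : DifferentiableAt ℝ χ x)
    (hζ : DifferentiableAt ℝ ζ x) (i : Fin N) :
    grad (fun y => (χ y : ℂ) * ζ y) x i =
      (χ x : ℂ) * grad ζ x i + (fderiv ℝ χ x (EuclideanSpace.single i 1) : ℂ) * ζ x := by
  have h1 : (fun y => (χ y : ℂ) * ζ y) = fun y => χ y • ζ y := by
    funext y; rw [Complex.real_smul]
  rw [grad_apply, grad_apply, h1, fderiv_fun_smul hχ hζ]
  simp

lemma IsTest.continuous_grad {ζ : Eu N → ℂ} (h : IsTest U ζ) : Continuous (grad ζ) := by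
  have h1 : Continuous (fderiv ℝ ζ) := h.1.continuous_fderiv (by simp)
  refine (PiLp.continuous_toLp 2 _).comp (continuous_pi fun i => ?_)
  exact h1.clm_apply continuous_const

lemma grad_eq_zero_of_notMem_tsupport {ζ : Eu N → ℂ} {x : Eu N} (hx : x ∉ tsupport ζ) :
    grad ζ x = 0 := by
  ext i
  rw [grad_apply]
  have : fderiv ℝ ζ x = 0 := by
    by_contra h
    exact hx (support_fderiv_subset ℝ h)
  simp [this]

lemma IsTest.hasCompactSupport_grad {ζ : Eu N → ℂ} (h : IsTest U ζ) :
    HasCompactSupport (grad ζ) :=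
  h.2.1.mono' fun _ hx => by
    by_contra hn
    exact hx (grad_eq_zero_of_notMem_tsupport hn)

/-- Product rule for weak gradients with a smooth cut-off factor. -/
lemma HasWeakGrad.real_smul (hU : IsOpen U) {u : Eu N → ℂ}
    {G : Eu N → EuclideanSpace ℂ (Fin N)} (h : HasWeakGrad U u G) {χ : Eu N → ℝ}
    (hχ : ContDiff ℝ ∞ χ) :
    HasWeakGrad U (fun x => (χ x : ℂ) * u x)
      (fun x => (χ x : ℂ) • G x + u x • grad (fun y => (χ y : ℂ)) x) := by
  have hχc : Continuous fun x => (χ x : ℂ) := Complex.continuous_ofReal.comp hχ.continuous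
  have hχC : ContDiff ℝ ∞ fun x => (χ x : ℂ) := Complex.ofRealCLM.contDiff.comp hχ
  have hgc : Continuous (grad fun y => (χ y : ℂ)) := by
    have h1 : Continuous (fderiv ℝ fun y => (χ y : ℂ)) := hχC.continuous_fderiv (by simp)
    refine (PiLp.continuous_toLp 2 _).comp (continuous_pi fun i => ?_)
    exact h1.clm_apply continuous_const
  have e1 : LocallyIntegrableOn (fun x => (χ x : ℂ) * u x) U volume :=
    h.1.continuousOn_smul hU.isLocallyClosed hχc.continuousOn
  have e2 : LocallyIntegrableOn (fun x => (χ x : ℂ) • G x) U volume :=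
    h.2.1.continuousOn_smul hU.isLocallyClosed hχc.continuousOn
  have e3 : LocallyIntegrableOn (fun x => u x • grad (fun y => (χ y : ℂ)) x) U volume :=
    h.1.smul_continuousOn hU.isLocallyClosed hgc.continuousOn
  refine ⟨e1, e2.add e3, fun ζ hζ i => ?_⟩
  have hζ' : IsTest U fun x => (χ x : ℂ) * ζ x := by
    refine ⟨hχC.mul hζ.1, hζ.2.1.mul_left, (closure_mono ?_).trans hζ.2.2⟩
    exact Function.support_mul_subset_right _ _
  have h1 := h.2.2 _ hζ' i
  have h2 : ∀ x, grad (fun y => (χ y : ℂ)) x i =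
      (fderiv ℝ χ x (EuclideanSpace.single i 1) : ℂ) := fun x => by
    have h3 : HasFDerivAt (fun y => (χ y : ℂ)) (Complex.ofRealCLM.comp (fderiv ℝ χ x)) x :=
      Complex.ofRealCLM.hasFDerivAt.comp x (hχ.differentiable (by simp) x).hasFDerivAt
    rw [grad_apply, h3.fderiv]
    rfl
  have h3 : ∀ x, grad (fun y => (χ y : ℂ) * ζ y) x i =
      (χ x : ℂ) * grad ζ x i + grad (fun y => (χ y : ℂ)) x i * ζ x := fun x => by
    rw [h2]
    exact fderiv_real_smul (hχ.differentiable (by simp) x) (hζ.1.differentiable (by simp) x) i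
  have hgs : HasCompactSupport fun x => grad ζ x i :=
    hζ.hasCompactSupport_grad.comp_left (g := fun v : EuclideanSpace ℂ (Fin N) => v i) rfl
  have hgsU : tsupport (fun x => grad ζ x i) ⊆ U := by
    refine (closure_minimal (fun x hx => ?_) (isClosed_tsupport ζ)).trans hζ.2.2
    by_contra hn
    exact hx (by simp [grad_eq_zero_of_notMem_tsupport hn])
  have i1 : IntegrableOn (fun x => (χ x : ℂ) * u x * grad ζ x i) U volume :=
    integrable_mul_test e1 ((EuclideanSpace.proj (𝕜 := ℂ) i).continuous.comp hζ.continuous_grad)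
      hgs hgsU
  have i2 : IntegrableOn (fun x => (u x • grad (fun y => (χ y : ℂ)) x) i * ζ x) U volume :=
    integrable_mul_test (LocallyIntegrableOn.euclidean_apply e3 i) hζ.1.continuous hζ.2.1 hζ.2.2
  have i3 : IntegrableOn (fun x => ((χ x : ℂ) • G x) i * ζ x) U volume :=
    integrable_mul_test (LocallyIntegrableOn.euclidean_apply e2 i) hζ.1.continuous hζ.2.1 hζ.2.2
  have h4 : ∫ x in U, u x * grad (fun y => (χ y : ℂ) * ζ y) x i =
      (∫ x in U, (χ x : ℂ) * u x * grad ζ x i) +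
        ∫ x in U, (u x • grad (fun y => (χ y : ℂ)) x) i * ζ x := by
    rw [← integral_add i1 i2]
    refine integral_congr_ae (ae_of_all _ fun x => ?_)
    simp only [h3, PiLp.smul_apply, smul_eq_mul]
    ring
  have h5 : ∫ x in U, ((χ x : ℂ) • G x + u x • grad (fun y => (χ y : ℂ)) x) i * ζ x =
      (∫ x in U, G x i * ((χ x : ℂ) * ζ x)) +
        ∫ x in U, (u x • grad (fun y => (χ y : ℂ)) x) i * ζ x := by
    have h6 : ∫ x in U, G x i * ((χ x : ℂ) * ζ x) = ∫ x in U, ((χ x : ℂ) • G x) i * ζ x := by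
      refine integral_congr_ae (ae_of_all _ fun x => ?_)
      simp only [PiLp.smul_apply, smul_eq_mul]
      ring
    rw [h6, ← integral_add i3 i2]
    refine integral_congr_ae (ae_of_all _ fun x => ?_)
    simp only [PiLp.add_apply, add_mul]
  rw [h4] at h1
  linear_combination h1 + h5

end WeakGradients

/-! ### Approximation of compactly supported Sobolev functions by test functions. -/

section Approximation

open Filter Topology

variable {N : ℕ} {U : Set (Eu N)}

/-- The definition of the weak gradient is tested with y ↦ χ(y) ρ(x - y). The cut-off χ is needed
because ρ(x - ·) need not be supported in `U`; it equals 1 near `K`, outside which `u` and `G`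
vanish, so it does not alter the integrals. -/
lemma grad_mollify {K : Set (Eu N)} (hU : IsOpen U) (hK : IsCompact K) (hKU : K ⊆ U)
    {u : Eu N → ℂ} {G : Eu N → EuclideanSpace ℂ (Fin N)} (hu : MemLp u 2 volume)
    (hG : MemLp G 2 volume) (h : HasWeakGrad U u G) (hu0 : ∀ x ∉ K, u x = 0)
    (hG0 : ∀ x ∉ K, G x = 0) (ρ : ContDiffBump (0 : Eu N)) (x : Eu N) :
    grad (mollify ρ u) x = mollify ρ G x := by
  obtain ⟨χ, hχ, hχc, hχU, hχ1⟩ := exists_cutoff hK hU hKU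
  have hu' := hu.locallyIntegrable (by norm_num)
  have hG' := hG.locallyIntegrable (by norm_num)
  have hρ : ContDiff ℝ ∞ (ρ.normed volume) := ρ.contDiff_normed
  ext i
  set e : Eu N := EuclideanSpace.single i 1 with he
  have h1 : grad (mollify ρ u) x i = ∫ y, ((fderiv ℝ (ρ.normed volume) (x - y) e : ℝ) : ℂ) * u y := by
    have hd := ρ.hasCompactSupport_normed.hasFDerivAt_convolution_left
      (ContinuousLinearMap.lsmul ℝ ℝ) (μ := volume) (hρ.of_le (by simp)) hu' x
    rw [grad_apply, mollify, hd.fderiv, convolution_eq_swap]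
    have hce : Integrable (fun t => (ContinuousLinearMap.precompL (Eu N)
        (ContinuousLinearMap.lsmul ℝ ℝ) (fderiv ℝ (ρ.normed volume) (x - t))) (u t)) volume := by
      have := ((ρ.hasCompactSupport_normed (μ := volume)).fderiv (𝕜 := ℝ)).convolutionExists_left
        (ContinuousLinearMap.precompL (Eu N) (ContinuousLinearMap.lsmul ℝ ℝ))
        (hρ.continuous_fderiv (by simp)) hu' x
      exact this.integrable_swap
    rw [ContinuousLinearMap.integral_apply hce]
    refine integral_congr_ae (ae_of_all _ fun t => ?_)
    beta_reduce
    rw [ContinuousLinearMap.precompL_apply, ContinuousLinearMap.lsmul_apply, Complex.real_smul]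
  have h2 : mollify ρ G x i = ∫ y, ((ρ.normed volume (x - y) : ℝ) : ℂ) * G y i := by
    rw [mollify, convolution_eq_swap]
    have hce : Integrable (fun t => (ContinuousLinearMap.lsmul ℝ ℝ (ρ.normed volume (x - t)))
        (G t)) volume :=
      (ρ.hasCompactSupport_normed.convolutionExists_left
        (ContinuousLinearMap.lsmul ℝ ℝ) hρ.continuous hG' x).integrable_swap
    have h3 := (EuclideanSpace.proj (𝕜 := ℂ) i).integral_comp_comm hce
    refine h3.symm.trans (integral_congr_ae (ae_of_all _ fun t => ?_))
    simp
  have hρx : ContDiff ℝ ∞ fun y => ρ.normed volume (x - y) :=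
    hρ.comp (contDiff_const.sub contDiff_id)
  have htest : IsTest U fun y => ((χ y * ρ.normed volume (x - y) : ℝ) : ℂ) := by
    refine IsTest.of_real (hχ.mul hρx) hχc.mul_right ((closure_mono ?_).trans hχU)
    exact Function.support_mul_subset_left _ _
  have h3 := h.2.2 _ htest i
  have h4 : ∫ y in U, u y * grad (fun y => ((χ y * ρ.normed volume (x - y) : ℝ) : ℂ)) y i =
      -∫ y, ((fderiv ℝ (ρ.normed volume) (x - y) e : ℝ) : ℂ) * u y := by
    rw [setIntegral_eq_integral_of_forall_compl_eq_zero
      (fun y hy => by rw [hu0 y (fun h => hy (hKU h)), zero_mul]), ← integral_neg]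
    refine integral_congr_ae (ae_of_all _ fun y => ?_)
    by_cases hy : y ∈ K
    · have h5 : (fun y => ((χ y * ρ.normed volume (x - y) : ℝ) : ℂ)) =ᶠ[𝓝 y]
          fun y => ((ρ.normed volume (x - y) : ℝ) : ℂ) := by
        filter_upwards [hχ1 y hy] with z hz using by rw [hz, one_mul]
      have h6 : HasFDerivAt (fun y => ((ρ.normed volume (x - y) : ℝ) : ℂ))
          (Complex.ofRealCLM.comp ((fderiv ℝ (ρ.normed volume) (x - y)).comp
            (-(ContinuousLinearMap.id ℝ (Eu N))))) y := by
        refine Complex.ofRealCLM.hasFDerivAt.comp y ?_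
        refine ((hρ.differentiable (by simp) (x - y)).hasFDerivAt).comp y ?_
        exact (hasFDerivAt_id y).const_sub x
      simp only [grad_apply]
      rw [h5.fderiv_eq, h6.fderiv]
      simp
      ring
    · simp [hu0 y hy]
  have h5 : ∫ y in U, G y i * ((χ y * ρ.normed volume (x - y) : ℝ) : ℂ) =
      ∫ y, ((ρ.normed volume (x - y) : ℝ) : ℂ) * G y i := by
    rw [setIntegral_eq_integral_of_forall_compl_eq_zero
      (fun y hy => by rw [hG0 y (fun h => hy (hKU h))]; simp)]
    refine integral_congr_ae (ae_of_all _ fun y => ?_)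
    by_cases hy : y ∈ K
    · simp only [(hχ1 y hy).self_of_nhds, one_mul, mul_comm]
    · simp [hG0 y hy]
  rw [h4, h5, neg_inj] at h3
  rw [h1, h2, h3]

/-- A compactly supported element of `W^{1,2}` is a limit of test functions. -/
lemma exists_test_approx {K : Set (Eu N)} (hU : IsOpen U) (hK : IsCompact K) (hKU : K ⊆ U)
    {u : Eu N → ℂ} {G : Eu N → EuclideanSpace ℂ (Fin N)} (hu : MemLp u 2 (volume.restrict U))
    (hG : MemLp G 2 (volume.restrict U)) (h : HasWeakGrad U u G) (hu0 : ∀ x ∉ K, u x = 0)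
    (hG0 : ∀ x ∉ K, G x = 0) {ε : ℝ≥0∞} (hε : ε ≠ 0) :
    ∃ ζ, IsTest U ζ ∧ eLpNorm (fun x => u x - ζ x) 2 (volume.restrict U) ≤ ε ∧
      eLpNorm (fun x => G x - grad ζ x) 2 (volume.restrict U) ≤ ε := by
  have hglob : ∀ {F : Type} [NormedAddCommGroup F] (f : Eu N → F), (∀ x ∉ K, f x = 0) →
      MemLp f 2 (volume.restrict U) → MemLp f 2 volume := by
    intro F _ f hf hfL
    have h1 : U.indicator f = f := indicator_eq_self.2 fun x hx => by
      by_contra hn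
      exact hx (hf x fun h => hn (hKU h))
    rw [← h1]
    exact (memLp_indicator_iff_restrict hU.measurableSet).2 hfL
  have hu' := hglob u hu0 hu
  have hG' := hglob G hG0 hG
  obtain ⟨δ₁, hδ₁, h1⟩ := exists_eLpNorm_mollify_sub_le hu' hε
  obtain ⟨δ₂, hδ₂, h2⟩ := exists_eLpNorm_mollify_sub_le hG' hε
  -- The first two radii control the L² errors of `u` and `G`; the third keeps the support of the
  -- mollified function inside `U`.
  obtain ⟨δ₃, hδ₃, h3⟩ := hK.exists_cthickening_subset_open hU hKU
  set r := min δ₁ (min δ₂ δ₃) with hr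
  have hr0 : 0 < r := lt_min hδ₁ (lt_min hδ₂ hδ₃)
  let ρ : ContDiffBump (0 : Eu N) := ⟨r / 4, r / 2, by positivity, by linarith⟩
  have hρ1 : ρ.rOut < δ₁ := (half_lt_self hr0).trans_le (min_le_left _ _)
  have hρ2 : ρ.rOut < δ₂ := (half_lt_self hr0).trans_le ((min_le_right _ _).trans (min_le_left _ _))
  have hρ3 : ρ.rOut < δ₃ :=
    (half_lt_self hr0).trans_le ((min_le_right _ _).trans (min_le_right _ _))
  have hsupp : Function.support (mollify ρ u) ⊆ Metric.cthickening δ₃ K := by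
    refine (support_convolution_subset _).trans ?_
    rintro x ⟨a, ha, b, hb, rfl⟩
    have hbK : b ∈ K := by
      by_contra hn
      exact hb (hu0 b hn)
    refine Metric.mem_cthickening_of_dist_le _ b _ _ hbK ?_
    rw [ρ.support_normed_eq] at ha
    have : ‖a‖ < ρ.rOut := mem_ball_zero_iff.1 ha
    simpa [dist_eq_norm] using (this.trans hρ3).le
  have htsupp : tsupport (mollify ρ u) ⊆ Metric.cthickening δ₃ K :=
    closure_minimal hsupp Metric.isClosed_cthickening
  refine ⟨mollify ρ u, ⟨?_, ?_, htsupp.trans h3⟩, ?_, ?_⟩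
  · exact ρ.hasCompactSupport_normed.contDiff_convolution_left _ ρ.contDiff_normed
      (hu'.locallyIntegrable (by norm_num))
  · exact hK.cthickening.of_isClosed_subset (isClosed_tsupport _) htsupp
  · refine (eLpNorm_mono_measure _ Measure.restrict_le_self).trans ?_
    have h4 := eLpNorm_sub_comm u (mollify ρ u) 2 volume
    exact (le_of_eq h4).trans (h1 ρ hρ1)
  · refine (eLpNorm_mono_measure _ Measure.restrict_le_self).trans ?_
    simp_rw [grad_mollify hU hK hKU hu' hG' h hu0 hG0 ρ]
    have h4 := eLpNorm_sub_comm G (mollify ρ G) 2 volume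
    exact (le_of_eq h4).trans (h2 ρ hρ2)

end Approximation

/-! ### Lipschitz functions and test functions as Sobolev functions. -/

section Lipschitz

open Filter Topology

variable {N : ℕ}

lemma norm_le_sum_norm_apply (v : EuclideanSpace ℂ (Fin N)) : ‖v‖ ≤ ∑ i, ‖v i‖ := by
  rw [EuclideanSpace.norm_eq]
  refine Real.sqrt_le_iff.2 ⟨Finset.sum_nonneg fun _ _ => norm_nonneg _, ?_⟩
  exact Finset.sum_sq_le_sq_sum_of_nonneg fun _ _ => norm_nonneg _

/-- Integration by parts for line derivatives, which by Rademacher's theorem coincide almost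
everywhere with the values of the Fréchet derivative. -/
lemma integral_mul_fderiv_of_lipschitz {f g : Eu N → ℝ} {C D : ℝ≥0} (hf : LipschitzWith C f)
    (hg : LipschitzWith D g) (hc : HasCompactSupport g) (v : Eu N) :
    ∫ x, f x * fderiv ℝ g x v = -∫ x, fderiv ℝ f x v * g x := by
  have h1 := hf.integral_lineDeriv_mul_eq (μ := volume) hg hc v
  have h2 : ∫ x, lineDeriv ℝ f x v * g x = ∫ x, fderiv ℝ f x v * g x := by
    refine integral_congr_ae ?_
    filter_upwards [hf.ae_differentiableAt (μ := volume)] with x hx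
    rw [hx.lineDeriv_eq_fderiv]
  have h3 : ∫ x, lineDeriv ℝ g x (-v) * f x = -∫ x, f x * fderiv ℝ g x v := by
    rw [← integral_neg]
    refine integral_congr_ae ?_
    filter_upwards [hg.ae_differentiableAt (μ := volume)] with x hx
    rw [hx.lineDeriv_eq_fderiv, map_neg]
    ring
  rw [← h2, h1, h3, neg_neg]

lemma measurable_grad (f : Eu N → ℂ) : Measurable (grad f) := by
  refine (PiLp.continuous_toLp 2 _).measurable.comp (measurable_pi_lambda _ fun i => ?_)
  exact measurable_fderiv_apply_const ℝ f _

lemma norm_grad_apply_le {f : Eu N → ℂ} {C : ℝ≥0} (hf : LipschitzWith C f) (x : Eu N) (i : Fin N) :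
    ‖grad f x i‖ ≤ C := by
  rw [grad_apply]
  refine ((fderiv ℝ f x).le_opNorm _).trans ?_
  have := norm_fderiv_le_of_lipschitz ℝ hf (x₀ := x)
  simpa using this

/-- The complex product is split into four real ones, to each of which the real integration by parts
applies. -/
lemma integral_mul_grad_of_lipschitz {f ζ : Eu N → ℂ} {C D : ℝ≥0} (hf : LipschitzWith C f)
    (hζ : LipschitzWith D ζ) (hc : HasCompactSupport ζ) (i : Fin N) :
    ∫ x, f x * grad ζ x i = -∫ x, grad f x i * ζ x := by
  set e : Eu N := EuclideanSpace.single i 1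
  have hre : ∀ {C : ℝ≥0} {f : Eu N → ℂ}, LipschitzWith C f → LipschitzWith C fun x => (f x).re :=
    fun {C f} hf => LipschitzWith.of_dist_le_mul fun x y => by
      refine le_trans ?_ (hf.dist_le_mul x y)
      simpa [Complex.dist_eq, Real.dist_eq] using Complex.abs_re_le_norm (f x - f y)
  have him : ∀ {C : ℝ≥0} {f : Eu N → ℂ}, LipschitzWith C f → LipschitzWith C fun x => (f x).im :=
    fun {C f} hf => LipschitzWith.of_dist_le_mul fun x y => by
      refine le_trans ?_ (hf.dist_le_mul x y)
      simpa [Complex.dist_eq, Real.dist_eq] using Complex.abs_im_le_norm (f x - f y)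
  have hcre : HasCompactSupport fun x => (ζ x).re := hc.comp_left (g := Complex.re) rfl
  have hcim : HasCompactSupport fun x => (ζ x).im := hc.comp_left (g := Complex.im) rfl
  have hdr : ∀ {C : ℝ≥0} {f : Eu N → ℂ}, LipschitzWith C f → ∀ᵐ x, (grad f x i).re =
      fderiv ℝ (fun x => (f x).re) x e ∧ (grad f x i).im = fderiv ℝ (fun x => (f x).im) x e := by
    intro C f hf
    filter_upwards [hf.ae_differentiableAt (μ := volume)] with x hx
    have h1 : HasFDerivAt (fun x => (f x).re) (Complex.reCLM.comp (fderiv ℝ f x)) x :=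
      Complex.reCLM.hasFDerivAt.comp x hx.hasFDerivAt
    have h2 : HasFDerivAt (fun x => (f x).im) (Complex.imCLM.comp (fderiv ℝ f x)) x :=
      Complex.imCLM.hasFDerivAt.comp x hx.hasFDerivAt
    rw [h1.fderiv, h2.fderiv]
    exact ⟨rfl, rfl⟩
  -- integrability of all the products
  have hint : ∀ {C D : ℝ≥0} {f g : Eu N → ℝ}, LipschitzWith C f → LipschitzWith D g →
      HasCompactSupport g → Integrable (fun x => fderiv ℝ f x e * g x) ∧
        Integrable (fun x => f x * fderiv ℝ g x e) := by
    intro C D f g hf hg hgc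
    have hb : ∀ {C : ℝ≥0} {f : Eu N → ℝ}, LipschitzWith C f → ∀ x, ‖fderiv ℝ f x e‖ ≤ C := by
      intro C f hf x
      refine ((fderiv ℝ f x).le_opNorm _).trans ?_
      have := norm_fderiv_le_of_lipschitz ℝ hf (x₀ := x)
      simpa [e] using this
    refine ⟨(hg.continuous.integrable_of_hasCompactSupport hgc).bdd_mul
      (measurable_fderiv_apply_const ℝ f e).aestronglyMeasurable (ae_of_all _ (hb hf)), ?_⟩
    have h1 : IntegrableOn (fun x => fderiv ℝ g x e * f x) (tsupport g) volume :=
      (hf.continuous.continuousOn.integrableOn_compact hgc).bdd_mul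
        (measurable_fderiv_apply_const ℝ g e).aestronglyMeasurable (ae_of_all _ (hb hg))
    have h2 := h1.integrable_of_forall_notMem_eq_zero fun x hx => by
      have : fderiv ℝ g x = 0 := by
        by_contra h
        exact hx (support_fderiv_subset ℝ h)
      simp [this]
    simpa [mul_comm] using h2
  have hL : Integrable fun x => f x * grad ζ x i := by
    have h1 : IntegrableOn (fun x => grad ζ x i * f x) (tsupport ζ) volume :=
      (hf.continuous.continuousOn.integrableOn_compact hc).bdd_mul
        (((EuclideanSpace.proj (𝕜 := ℂ) i).continuous.measurable.comp
          (measurable_grad ζ)).aestronglyMeasurable) (ae_of_all _ fun x => norm_grad_apply_le hζ x i)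
    have h2 := h1.integrable_of_forall_notMem_eq_zero fun x hx => by
      simp [grad_eq_zero_of_notMem_tsupport hx]
    simpa [mul_comm] using h2
  have hR : Integrable fun x => grad f x i * ζ x :=
    (hζ.continuous.integrable_of_hasCompactSupport hc).bdd_mul
        (((EuclideanSpace.proj (𝕜 := ℂ) i).continuous.measurable.comp
          (measurable_grad f)).aestronglyMeasurable) (ae_of_all _ fun x => norm_grad_apply_le hf x i)
  have r1 := integral_mul_fderiv_of_lipschitz (hre hf) (hre hζ) hcre e
  have r2 := integral_mul_fderiv_of_lipschitz (him hf) (him hζ) hcim e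
  have r3 := integral_mul_fderiv_of_lipschitz (hre hf) (him hζ) hcim e
  have r4 := integral_mul_fderiv_of_lipschitz (him hf) (hre hζ) hcre e
  have i1 := hint (hre hf) (hre hζ) hcre
  have i2 := hint (him hf) (him hζ) hcim
  have i3 := hint (hre hf) (him hζ) hcim
  have i4 := hint (him hf) (hre hζ) hcre
  apply Complex.ext
  · have e1 := Complex.reCLM.integral_comp_comm hL
    have e2 := Complex.reCLM.integral_comp_comm hR
    simp only [Complex.reCLM_apply] at e1 e2
    rw [Complex.neg_re, ← e1, ← e2]
    have e3 : ∫ x, (f x * grad ζ x i).re = ∫ x, ((f x).re * fderiv ℝ (fun x => (ζ x).re) x e -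
        (f x).im * fderiv ℝ (fun x => (ζ x).im) x e) := integral_congr_ae (by
      filter_upwards [hdr hζ] with x hx
      rw [Complex.mul_re, hx.1, hx.2])
    have e4 : ∫ x, (grad f x i * ζ x).re = ∫ x, (fderiv ℝ (fun x => (f x).re) x e * (ζ x).re -
        fderiv ℝ (fun x => (f x).im) x e * (ζ x).im) := integral_congr_ae (by
      filter_upwards [hdr hf] with x hx
      rw [Complex.mul_re, hx.1, hx.2])
    rw [e3, e4, integral_sub i1.2 i2.2, integral_sub i1.1 i2.1, r1, r2]
    ring
  · have e1 := Complex.imCLM.integral_comp_comm hL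
    have e2 := Complex.imCLM.integral_comp_comm hR
    simp only [Complex.imCLM_apply] at e1 e2
    rw [Complex.neg_im, ← e1, ← e2]
    have e3 : ∫ x, (f x * grad ζ x i).im = ∫ x, ((f x).re * fderiv ℝ (fun x => (ζ x).im) x e +
        (f x).im * fderiv ℝ (fun x => (ζ x).re) x e) := integral_congr_ae (by
      filter_upwards [hdr hζ] with x hx
      rw [Complex.mul_im, hx.1, hx.2])
    have e4 : ∫ x, (grad f x i * ζ x).im = ∫ x, (fderiv ℝ (fun x => (f x).re) x e * (ζ x).im +
        fderiv ℝ (fun x => (f x).im) x e * (ζ x).re) := integral_congr_ae (by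
      filter_upwards [hdr hf] with x hx
      rw [Complex.mul_im, hx.1, hx.2])
    rw [e3, e4, integral_add i3.2 i4.2, integral_add i3.1 i4.1, r3, r4]
    ring

lemma IsTest.exists_lipschitz {U : Set (Eu N)} {ζ : Eu N → ℂ} (h : IsTest U ζ) :
    ∃ C, LipschitzWith C ζ :=
  h.1.lipschitzWith_of_hasCompactSupport h.2.1 (by simp)

/-- The classical gradient of a Lipschitz function is its weak gradient. -/
lemma hasWeakGrad_of_lipschitz {U : Set (Eu N)} {f : Eu N → ℂ}
    {C : ℝ≥0} (hf : LipschitzWith C f) : HasWeakGrad U f (grad f) := by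
  have hm : AEStronglyMeasurable (grad f) volume := (measurable_grad f).aestronglyMeasurable
  have hli : LocallyIntegrable (grad f) volume := by
    have hb : MemLp (grad f) ⊤ volume := by
      refine memLp_top_of_bound hm (∑ i : Fin N, (C : ℝ)) (ae_of_all _ fun x => ?_)
      exact (norm_le_sum_norm_apply _).trans
        (Finset.sum_le_sum fun i _ => norm_grad_apply_le hf x i)
    exact hb.locallyIntegrable le_top
  refine ⟨hf.continuous.locallyIntegrable.locallyIntegrableOn _, hli.locallyIntegrableOn _,
    fun ζ hζ i => ?_⟩
  obtain ⟨D, hD⟩ := hζ.exists_lipschitz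
  rw [setIntegral_eq_integral_of_forall_compl_eq_zero,
    setIntegral_eq_integral_of_forall_compl_eq_zero]
  · exact integral_mul_grad_of_lipschitz hf hD hζ.2.1 i
  · intro x hx
    rw [image_eq_zero_of_notMem_tsupport fun h => hx (hζ.2.2 h), mul_zero]
  · intro x hx
    simp [grad_eq_zero_of_notMem_tsupport fun h => hx (hζ.2.2 h)]

lemma IsTest.hasWeakGrad {U : Set (Eu N)} {ζ : Eu N → ℂ} (h : IsTest U ζ) :
    HasWeakGrad U ζ (grad ζ) := by
  obtain ⟨C, hC⟩ := h.exists_lipschitz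
  exact hasWeakGrad_of_lipschitz hC

lemma IsTest.memLp {U : Set (Eu N)} {ζ : Eu N → ℂ} (h : IsTest U ζ) (p : ℝ≥0∞)
    (μ : Measure (Eu N)) [IsFiniteMeasureOnCompacts μ] : MemLp ζ p μ :=
  h.1.continuous.memLp_of_hasCompactSupport h.2.1

lemma IsTest.memLp_grad {U : Set (Eu N)} {ζ : Eu N → ℂ} (h : IsTest U ζ) (p : ℝ≥0∞)
    (μ : Measure (Eu N)) [IsFiniteMeasureOnCompacts μ] : MemLp (grad ζ) p μ :=
  h.continuous_grad.memLp_of_hasCompactSupport h.hasCompactSupport_grad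

lemma IsTest.memW {U : Set (Eu N)} {ζ : Eu N → ℂ} (h : IsTest U ζ) (b : BC) : MemW b U ζ := by
  cases b with
  | dirichlet =>
    refine ⟨h.memLp 2 _, grad ζ, h.hasWeakGrad, h.memLp_grad 2 _, fun ε hε => ⟨ζ, h, ?_, ?_⟩⟩
    · simpa using hε
    · simpa using hε
  | neumann => exact ⟨h.memLp 2 _, grad ζ, h.hasWeakGrad, h.memLp_grad 2 _⟩

end Lipschitz

/-! ### Invariance of Sobolev spaces under bi-Lipschitz maps. -/

section BiLipschitz

open Filter Topology

variable {N : ℕ} {Ω V : Set (Eu N)} {T S : Eu N → Eu N}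

/-- `T : Ω → V` is a bi-Lipschitz homeomorphism of open sets, with inverse `S`. -/
structure BiLip (Ω V : Set (Eu N)) (T S : Eu N → Eu N) : Prop where
  isOpen : IsOpen Ω
  isOpen' : IsOpen V
  mapsTo : MapsTo T Ω V
  mapsTo' : MapsTo S V Ω
  left_inv : ∀ x ∈ Ω, S (T x) = x
  right_inv : ∀ y ∈ V, T (S y) = y
  lipschitz : ∃ K : ℝ≥0, LipschitzOnWith K T Ω
  lipschitz' : ∃ K : ℝ≥0, LipschitzOnWith K S V

lemma BiLip.swap (h : BiLip Ω V T S) : BiLip V Ω S T :=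
  ⟨h.isOpen', h.isOpen, h.mapsTo', h.mapsTo, h.right_inv, h.left_inv, h.lipschitz', h.lipschitz⟩

lemma IsTransformation.exists_biLip (hΩ : IsOpen Ω) (h : IsTransformation Ω T) :
    ∃ S, BiLip Ω (T '' Ω) T S := by
  obtain ⟨⟨hV, -, -⟩, K, hK⟩ := h
  have hinj : InjOn T Ω := fun x hx y hy hxy => by
    have := (hK x hx y hy).2
    rw [hxy, dist_self, mul_zero] at this
    exact dist_le_zero.1 this
  have hbij : BijOn T Ω (T '' Ω) := hinj.bijOn_image
  -- The constant in `IsTransformation` is an arbitrary real number, so it is replaced by its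
  -- non-negative part.
  have hle : ∀ a b : Eu N, K * dist a b ≤ (K.toNNReal : ℝ) * dist a b := fun a b =>
    mul_le_mul_of_nonneg_right (Real.le_coe_toNNReal K) dist_nonneg
  cases isEmpty_or_nonempty Ω with
  | inl he =>
    have : Ω = ∅ := isEmpty_coe_sort.1 he
    subst this
    refine ⟨id, ?_⟩
    rw [image_empty]
    exact ⟨isOpen_empty, isOpen_empty, by simp, by simp, by simp, by simp, ⟨0, by simp⟩, ⟨0, by simp⟩⟩
  | inr hne =>
    have hinv := hbij.invOn_invFunOn
    refine ⟨Function.invFunOn T Ω, hΩ, hV, mapsTo_image T Ω, hbij.surjOn.mapsTo_invFunOn,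
      fun x hx => hinv.1 hx, fun y hy => hinv.2 hy, ⟨K.toNNReal, ?_⟩, ⟨K.toNNReal, ?_⟩⟩
    · exact LipschitzOnWith.of_dist_le_mul fun x hx y hy => (hK x hx y hy).1.trans (hle _ _)
    · refine LipschitzOnWith.of_dist_le_mul fun x hx y hy => ?_
      have h1 := (hK _ (hbij.surjOn.mapsTo_invFunOn hx) _ (hbij.surjOn.mapsTo_invFunOn hy)).2
      rw [hinv.2 hx, hinv.2 hy] at h1
      exact h1.trans (hle _ _)

/-- Lebesgue measure is a multiple of N-dimensional Hausdorff measure, for which the Lipschitz bound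
is immediate. -/
lemma volume_image_le_of_lipschitzOn {K : ℝ≥0} {s : Set (Eu N)} (h : LipschitzOnWith K T s) :
    volume (T '' s) ≤ (K : ℝ≥0∞) ^ N * volume s := by
  have h1 := h.hausdorffMeasure_image_le (d := N) (by positivity)
  rw [← EuclideanSpace.euclideanHausdorffMeasure_eq_volume, Measure.euclideanHausdorffMeasure_def]
  simp only [Measure.smul_apply, ENNReal.smul_def, smul_eq_mul]
  rw [mul_left_comm]
  gcongr
  simpa using h1

lemma BiLip.continuousOn (h : BiLip Ω V T S) : ContinuousOn T Ω :=
  h.lipschitz.choose_spec.continuousOn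

lemma BiLip.aemeasurable (h : BiLip Ω V T S) : AEMeasurable T (volume.restrict Ω) :=
  h.continuousOn.aemeasurable h.isOpen.measurableSet

/-- Within Ω, the preimage of a set under `T` lies in its image under the Lipschitz map `S`. This
bounds composition with `T` in L² without any Jacobian. -/
lemma BiLip.exists_map_le (h : BiLip Ω V T S) :
    ∃ C : ℝ≥0∞, C ≠ ⊤ ∧ (volume.restrict Ω).map T ≤ C • volume.restrict V := by
  obtain ⟨K, hK⟩ := h.lipschitz'
  refine ⟨(K : ℝ≥0∞) ^ N, by finiteness, Measure.le_iff.2 fun s hs => ?_⟩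
  rw [Measure.map_apply_of_aemeasurable h.aemeasurable hs, Measure.smul_apply,
    Measure.restrict_apply' h.isOpen.measurableSet, Measure.restrict_apply hs, smul_eq_mul]
  refine le_trans (measure_mono ?_) (volume_image_le_of_lipschitzOn (hK.mono inter_subset_right))
  rintro x ⟨hx, hxΩ⟩
  exact ⟨T x, ⟨hx, h.mapsTo hxΩ⟩, h.left_inv x hxΩ⟩

lemma BiLip.map_absolutelyContinuous (h : BiLip Ω V T S) :
    (volume.restrict Ω).map T ≪ volume.restrict V := by
  obtain ⟨C, hC, hle⟩ := h.exists_map_le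
  exact (Measure.absolutelyContinuous_of_le hle).trans Measure.smul_absolutelyContinuous

lemma BiLip.ae_comp (h : BiLip Ω V T S) {p : Eu N → Prop} (hp : ∀ᵐ y ∂volume.restrict V, p y) :
    ∀ᵐ x ∂volume.restrict Ω, p (T x) :=
  ae_of_ae_map h.aemeasurable (h.map_absolutelyContinuous hp)

lemma BiLip.aestronglyMeasurable_comp (h : BiLip Ω V T S) {F : Type*} [NormedAddCommGroup F]
    {f : Eu N → F} (hf : AEStronglyMeasurable f (volume.restrict V)) :
    AEStronglyMeasurable (fun x => f (T x)) (volume.restrict Ω) :=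
  (hf.mono_ac h.map_absolutelyContinuous).comp_aemeasurable h.aemeasurable

lemma BiLip.exists_eLpNorm_comp_le (h : BiLip Ω V T S) (F : Type*) [NormedAddCommGroup F] :
    ∃ C : ℝ≥0∞, C ≠ ⊤ ∧ ∀ f : Eu N → F, AEStronglyMeasurable f (volume.restrict V) →
      eLpNorm (fun x => f (T x)) 2 (volume.restrict Ω) ≤ C * eLpNorm f 2 (volume.restrict V) := by
  obtain ⟨C, hC, hle⟩ := h.exists_map_le
  refine ⟨C ^ (1 / 2 : ℝ), ENNReal.rpow_ne_top_of_nonneg (by norm_num) hC, fun f hf => ?_⟩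
  have h1 := eLpNorm_map_measure (p := 2) (hf.mono_ac h.map_absolutelyContinuous) h.aemeasurable
  refine (le_of_eq h1.symm).trans ((eLpNorm_mono_measure f hle).trans ?_)
  rw [eLpNorm_smul_measure_of_ne_top (by norm_num)]
  simp

lemma BiLip.ae_differentiableAt (h : BiLip Ω V T S) :
    ∀ᵐ x ∂volume.restrict Ω, DifferentiableAt ℝ T x := by
  obtain ⟨K, hK⟩ := h.lipschitz
  rw [ae_restrict_iff' h.isOpen.measurableSet]
  filter_upwards [hK.ae_differentiableWithinAt_of_mem (μ := volume)] with x hx hxΩ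
  exact (hx hxΩ).differentiableAt (h.isOpen.mem_nhds hxΩ)

lemma measurable_jac (T : Eu N → Eu N) (i j : Fin N) : Measurable fun x => jac T x i j :=
  (EuclideanSpace.proj (𝕜 := ℝ) i).continuous.measurable.comp
    (measurable_fderiv_apply_const ℝ T (EuclideanSpace.single j 1))

lemma abs_jac_le {K : ℝ≥0} (hΩ : IsOpen Ω) (hK : LipschitzOnWith K T Ω) {x : Eu N} (hx : x ∈ Ω)
    (i j : Fin N) : |jac T x i j| ≤ K := by
  have h1 : ‖fderiv ℝ T x‖ ≤ K := norm_fderiv_le_of_lipschitzOn ℝ (hΩ.mem_nhds hx) hK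
  have h2 : ‖fderiv ℝ T x (EuclideanSpace.single j 1)‖ ≤ K := by
    refine ((fderiv ℝ T x).le_opNorm _).trans ?_
    simpa using h1
  exact (PiLp.norm_apply_le (fderiv ℝ T x (EuclideanSpace.single j 1)) i).trans h2

/-- The gradient of `v ∘ T`, if `G` is the gradient of `v`. -/
def pullGrad (T : Eu N → Eu N) (G : Eu N → EuclideanSpace ℂ (Fin N)) (x : Eu N) :
    EuclideanSpace ℂ (Fin N) :=
  WithLp.toLp 2 fun i => ∑ j, (jac T x j i : ℂ) * G (T x) j

lemma pullGrad_apply (T : Eu N → Eu N) (G : Eu N → EuclideanSpace ℂ (Fin N)) (x : Eu N)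
    (i : Fin N) : pullGrad T G x i = ∑ j, (jac T x j i : ℂ) * G (T x) j := rfl

lemma pullGrad_sub (T : Eu N → Eu N) (G G' : Eu N → EuclideanSpace ℂ (Fin N)) (x : Eu N) :
    pullGrad T (fun y => G y - G' y) x = pullGrad T G x - pullGrad T G' x := by
  ext i
  simp only [pullGrad_apply, PiLp.sub_apply, mul_sub, Finset.sum_sub_distrib]

lemma norm_pullGrad_le {K : ℝ≥0} (hΩ : IsOpen Ω) (hK : LipschitzOnWith K T Ω) {x : Eu N}
    (hx : x ∈ Ω) (G : Eu N → EuclideanSpace ℂ (Fin N)) :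
    ‖pullGrad T G x‖ ≤ (N * (N * K) : ℝ) * ‖G (T x)‖ := by
  refine (norm_le_sum_norm_apply _).trans ?_
  calc ∑ i, ‖pullGrad T G x i‖ ≤ ∑ i : Fin N, ∑ j : Fin N, (K : ℝ) * ‖G (T x)‖ := by
        refine Finset.sum_le_sum fun i _ => ?_
        rw [pullGrad_apply]
        refine (norm_sum_le _ _).trans (Finset.sum_le_sum fun j _ => ?_)
        rw [norm_mul, Complex.norm_real]
        exact mul_le_mul (abs_jac_le hΩ hK hx j i) (PiLp.norm_apply_le (G (T x)) j)
          (norm_nonneg _) K.2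
    _ = _ := by simp [mul_assoc]

lemma BiLip.aestronglyMeasurable_pullGrad (h : BiLip Ω V T S)
    {G : Eu N → EuclideanSpace ℂ (Fin N)} (hG : AEStronglyMeasurable G (volume.restrict V)) :
    AEStronglyMeasurable (pullGrad T G) (volume.restrict Ω) := by
  refine (PiLp.continuous_toLp 2 _).comp_aestronglyMeasurable
    (aemeasurable_pi_iff.2 fun i => AEStronglyMeasurable.aemeasurable ?_).aestronglyMeasurable
  refine Finset.aestronglyMeasurable_fun_sum _ fun j _ => AEStronglyMeasurable.mul ?_ ?_
  · exact (Complex.measurable_ofReal.comp (measurable_jac T j i)).aestronglyMeasurable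
  · exact (EuclideanSpace.proj (𝕜 := ℂ) j).continuous.comp_aestronglyMeasurable
      (h.aestronglyMeasurable_comp hG)

lemma BiLip.exists_eLpNorm_pullGrad_le (h : BiLip Ω V T S) :
    ∃ C : ℝ≥0∞, C ≠ ⊤ ∧ ∀ G : Eu N → EuclideanSpace ℂ (Fin N),
      AEStronglyMeasurable G (volume.restrict V) →
      eLpNorm (pullGrad T G) 2 (volume.restrict Ω) ≤ C * eLpNorm G 2 (volume.restrict V) := by
  obtain ⟨C, hC, hle⟩ := h.exists_eLpNorm_comp_le (EuclideanSpace ℂ (Fin N))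
  obtain ⟨K, hK⟩ := h.lipschitz
  refine ⟨ENNReal.ofReal (N * (N * K) : ℝ) * C, by finiteness, fun G hG => ?_⟩
  rw [mul_assoc]
  refine le_trans (eLpNorm_le_mul_eLpNorm_of_ae_le_mul (g := fun x => G (T x)) ?_ 2)
    (mul_le_mul_right (hle G hG) _)
  filter_upwards [ae_restrict_mem h.isOpen.measurableSet] with x hx
  exact norm_pullGrad_le h.isOpen hK hx G

lemma BiLip.memLp_comp (h : BiLip Ω V T S) {F : Type*} [NormedAddCommGroup F]
    {f : Eu N → F} (hf : MemLp f 2 (volume.restrict V)) :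
    MemLp (fun x => f (T x)) 2 (volume.restrict Ω) := by
  obtain ⟨C, hC, hle⟩ := h.exists_eLpNorm_comp_le F
  exact ⟨h.aestronglyMeasurable_comp hf.1,
    (hle f hf.1).trans_lt (ENNReal.mul_lt_top hC.lt_top hf.2)⟩

lemma BiLip.memLp_pullGrad (h : BiLip Ω V T S) {G : Eu N → EuclideanSpace ℂ (Fin N)}
    (hG : MemLp G 2 (volume.restrict V)) : MemLp (pullGrad T G) 2 (volume.restrict Ω) := by
  obtain ⟨C, hC, hle⟩ := h.exists_eLpNorm_pullGrad_le
  exact ⟨h.aestronglyMeasurable_pullGrad hG.1,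
    (hle G hG.1).trans_lt (ENNReal.mul_lt_top hC.lt_top hG.2)⟩

lemma grad_comp_eq_pullGrad {ξ : Eu N → ℂ} {x : Eu N} (hξ : DifferentiableAt ℝ ξ (T x))
    (hT : DifferentiableAt ℝ T x) : grad (fun x => ξ (T x)) x = pullGrad T (grad ξ) x := by
  ext i
  have h1 : fderiv ℝ (fun x => ξ (T x)) x = (fderiv ℝ ξ (T x)).comp (fderiv ℝ T x) :=
    fderiv_comp x hξ hT
  rw [grad_apply, pullGrad_apply, h1, ContinuousLinearMap.comp_apply]
  have h2 : fderiv ℝ T x (EuclideanSpace.single i 1) =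
      ∑ j, jac T x j i • EuclideanSpace.single j (1 : ℝ) := by
    ext k
    simp [jac, Pi.single_apply]
  rw [h2, map_sum]
  refine Finset.sum_congr rfl fun j _ => ?_
  rw [map_smul, grad_apply, Complex.real_smul]

/-- A Lipschitz extension of `T` to the whole space makes the composition globally Lipschitz, so its
classical gradient is its weak gradient. Inside the open set Ω the extension agrees with `T` near
each point, and the ordinary chain rule holds wherever `T` is differentiable. -/
lemma BiLip.hasWeakGrad_test_comp (h : BiLip Ω V T S) {ξ : Eu N → ℂ} (hξ : IsTest V ξ) :
    HasWeakGrad Ω (fun x => ξ (T x)) (pullGrad T (grad ξ)) := by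
  obtain ⟨K, hK⟩ := h.lipschitz
  obtain ⟨C, hC⟩ := hξ.exists_lipschitz
  obtain ⟨T', hT', hTT'⟩ := hK.extend_finite_dimension
  have h1 := hasWeakGrad_of_lipschitz (U := Ω) (hC.comp hT')
  refine h1.congr ?_ ?_
  · filter_upwards [ae_restrict_mem h.isOpen.measurableSet] with x hx
    simp [hTT' hx]
  · filter_upwards [ae_restrict_mem h.isOpen.measurableSet, h.ae_differentiableAt] with x hx hd
    have h2 : ξ ∘ T' =ᶠ[𝓝 x] fun x => ξ (T x) := by
      filter_upwards [h.isOpen.mem_nhds hx] with y hy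
      simp [hTT' hy]
    have h3 : grad (ξ ∘ T') x = grad (fun x => ξ (T x)) x := by
      ext i
      rw [grad_apply, grad_apply, h2.fderiv_eq]
    rw [h3]
    exact grad_comp_eq_pullGrad (hξ.1.differentiable (by simp) _) hd

lemma enorm_integral_mul_le (μ : Measure (Eu N)) {f g : Eu N → ℂ} (hf : AEStronglyMeasurable f μ)
    (hg : AEStronglyMeasurable g μ) :
    ‖∫ x, f x * g x ∂μ‖ₑ ≤ eLpNorm f 2 μ * eLpNorm g 2 μ := by
  refine (enorm_integral_le_lintegral_enorm _).trans ?_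
  have h := eLpNorm_smul_le_mul_eLpNorm (p := 2) (q := 2) (r := 1) (μ := μ) hg hf
  rw [eLpNorm_one_eq_lintegral_enorm] at h
  simpa only [Pi.smul_apply', smul_eq_mul] using h

lemma eLpNorm_apply_le (μ : Measure (Eu N)) (G : Eu N → EuclideanSpace ℂ (Fin N)) (i : Fin N)
    (p : ℝ≥0∞) : eLpNorm (fun x => G x i) p μ ≤ eLpNorm G p μ :=
  eLpNorm_mono fun x => PiLp.norm_apply_le (G x) i

lemma memLp_cutoff_mul {χ : Eu N → ℝ} (hχ : ContDiff ℝ ∞ χ) (hc : HasCompactSupport χ)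
    {u : Eu N → ℂ} (hu : MemLp u 2 (volume.restrict V)) :
    MemLp (fun x => (χ x : ℂ) * u x) 2 (volume.restrict V) := by
  obtain ⟨C, hC⟩ := hc.exists_bound_of_continuous hχ.continuous
  refine hu.of_le_mul (c := C) ?_ (ae_of_all _ fun x => ?_)
  · exact (Complex.continuous_ofReal.comp hχ.continuous).aestronglyMeasurable.mul hu.1
  · rw [norm_mul, Complex.norm_real]
    exact mul_le_mul_of_nonneg_right (hC x) (norm_nonneg _)

lemma memLp_cutoff_grad {χ : Eu N → ℝ} (hχ : ContDiff ℝ ∞ χ) (hc : HasCompactSupport χ)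
    {u : Eu N → ℂ} {G : Eu N → EuclideanSpace ℂ (Fin N)} (hu : MemLp u 2 (volume.restrict V))
    (hG : MemLp G 2 (volume.restrict V)) :
    MemLp (fun x => (χ x : ℂ) • G x + u x • grad (fun y => (χ y : ℂ)) x) 2
      (volume.restrict V) := by
  have htest : IsTest univ fun y => (χ y : ℂ) := IsTest.of_real hχ hc (subset_univ _)
  refine MemLp.add ?_ ?_
  · obtain ⟨C, hC⟩ := hc.exists_bound_of_continuous hχ.continuous
    refine hG.of_le_mul (c := C) ?_ (ae_of_all _ fun x => ?_)
    · exact (Complex.continuous_ofReal.comp hχ.continuous).aestronglyMeasurable.smul hG.1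
    · rw [norm_smul, Complex.norm_real]
      exact mul_le_mul_of_nonneg_right (hC x) (norm_nonneg _)
  · obtain ⟨C, hC⟩ := htest.hasCompactSupport_grad.exists_bound_of_continuous htest.continuous_grad
    refine hu.of_le_mul (c := C) ?_ (ae_of_all _ fun x => ?_)
    · exact hu.1.smul htest.continuous_grad.aestronglyMeasurable
    · rw [norm_smul, mul_comm]
      exact mul_le_mul_of_nonneg_right (hC x) (norm_nonneg _)

/-- Chain rule for bi-Lipschitz changes of variables. -/
lemma BiLip.hasWeakGrad_comp (h : BiLip Ω V T S) {v : Eu N → ℂ}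
    {G : Eu N → EuclideanSpace ℂ (Fin N)} (hv : MemLp v 2 (volume.restrict V))
    (hG : MemLp G 2 (volume.restrict V)) (hw : HasWeakGrad V v G) :
    HasWeakGrad Ω (fun x => v (T x)) (pullGrad T G) := by
  refine ⟨locallyIntegrableOn_of_memLp (h.memLp_comp hv),
    locallyIntegrableOn_of_memLp (h.memLp_pullGrad hG), fun ζ hζ i => ?_⟩
  -- localisation near the support of `ζ`
  set K : Set (Eu N) := T '' tsupport ζ with hK
  have hKc : IsCompact K := hζ.2.1.isCompact.image_of_continuousOn (h.continuousOn.mono hζ.2.2)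
  have hKV : K ⊆ V := by
    rintro _ ⟨x, hx, rfl⟩
    exact h.mapsTo (hζ.2.2 hx)
  obtain ⟨χ, hχ, hχc, hχV, hχ1⟩ := exists_cutoff hKc h.isOpen' hKV
  set v₁ : Eu N → ℂ := fun x => (χ x : ℂ) * v x with hv₁
  set G₁ : Eu N → EuclideanSpace ℂ (Fin N) :=
    fun x => (χ x : ℂ) • G x + v x • grad (fun y => (χ y : ℂ)) x with hG₁
  have hw₁ : HasWeakGrad V v₁ G₁ := hw.real_smul h.isOpen' hχ
  have hvL : MemLp v₁ 2 (volume.restrict V) := memLp_cutoff_mul hχ hχc hv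
  have hGL : MemLp G₁ 2 (volume.restrict V) := memLp_cutoff_grad hχ hχc hv hG
  have hχ0 : ∀ x ∉ tsupport χ, χ x = 0 ∧ grad (fun y => (χ y : ℂ)) x = 0 := fun x hx => by
    refine ⟨image_eq_zero_of_notMem_tsupport hx, grad_eq_zero_of_notMem_tsupport fun h => hx ?_⟩
    exact closure_mono (fun y hy => by simpa using hy) h
  have hv₁K : ∀ x ∈ K, v₁ x = v x := fun x hx => by
    simp [hv₁, (hχ1 x hx).self_of_nhds]
  have hG₁K : ∀ x ∈ K, G₁ x = G x := fun x hx => by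
    have h1 : (fun y => (χ y : ℂ)) =ᶠ[𝓝 x] fun _ => 1 := by
      filter_upwards [hχ1 x hx] with y hy using by simp [hy]
    have h2 : grad (fun y => (χ y : ℂ)) x = 0 := by
      ext i
      rw [grad_apply, h1.fderiv_eq]
      simp
    simp [hG₁, (hχ1 x hx).self_of_nhds, h2]
  obtain ⟨C₁, hC₁, hle₁⟩ := h.exists_eLpNorm_comp_le ℂ
  obtain ⟨C₂, hC₂, hle₂⟩ := h.exists_eLpNorm_pullGrad_le
  set A := eLpNorm (fun x => grad ζ x i) 2 (volume.restrict Ω) with hA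
  set B := eLpNorm ζ 2 (volume.restrict Ω) with hB
  have hgi : MemLp (fun x => grad ζ x i) 2 (volume.restrict Ω) :=
    (EuclideanSpace.proj (𝕜 := ℂ) i).comp_memLp' (hζ.memLp_grad 2 _)
  have hζL : MemLp ζ 2 (volume.restrict Ω) := hζ.memLp 2 _
  -- replace `v`, `G` by their localisations
  have e1 : ∫ x in Ω, v (T x) * grad ζ x i = ∫ x in Ω, v₁ (T x) * grad ζ x i := by
    refine integral_congr_ae (ae_of_all _ fun x => ?_)
    by_cases hx : x ∈ tsupport ζ
    · simp only [hv₁K (T x) ⟨x, hx, rfl⟩]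
    · simp [grad_eq_zero_of_notMem_tsupport hx]
  have e2 : ∫ x in Ω, pullGrad T G x i * ζ x = ∫ x in Ω, pullGrad T G₁ x i * ζ x := by
    refine integral_congr_ae (ae_of_all _ fun x => ?_)
    by_cases hx : x ∈ tsupport ζ
    · simp only [pullGrad_apply, hG₁K (T x) ⟨x, hx, rfl⟩]
    · simp [image_eq_zero_of_notMem_tsupport hx]
  rw [e1, e2, ← add_eq_zero_iff_eq_neg, ← enorm_eq_zero]
  have hint : ∀ {f g : Eu N → ℂ}, MemLp f 2 (volume.restrict Ω) → MemLp g 2 (volume.restrict Ω) →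
      Integrable (fun x => f x * g x) (volume.restrict Ω) := fun hf hg => hf.integrable_mul hg
  have hproj : ∀ {H : Eu N → EuclideanSpace ℂ (Fin N)}, MemLp H 2 (volume.restrict Ω) →
      MemLp (fun x => H x i) 2 (volume.restrict Ω) := fun hH =>
    (EuclideanSpace.proj (𝕜 := ℂ) i).comp_memLp' hH
  -- For test functions ξ the identity is known. Both integrals depend continuously in L² on the
  -- function and its gradient, so the defect for `v₁` is at most a fixed multiple of ε.
  have key : ∀ ε : ℝ≥0∞, ε ≠ 0 →
      ‖(∫ x in Ω, v₁ (T x) * grad ζ x i) + ∫ x in Ω, pullGrad T G₁ x i * ζ x‖ₑ ≤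
        (C₁ * A + C₂ * B) * ε := by
    intro ε hε
    obtain ⟨ξ, hξ, hξ1, hξ2⟩ := exists_test_approx h.isOpen' hχc.isCompact hχV hvL hGL hw₁
      (fun x hx => by simp [hv₁, (hχ0 x hx).1])
      (fun x hx => by simp [hG₁, (hχ0 x hx).1, (hχ0 x hx).2]) hε
    have h1 := (h.hasWeakGrad_test_comp hξ).2.2 ζ hζ i
    have hξL := hξ.memLp 2 (volume.restrict V)
    have hgξL := hξ.memLp_grad 2 (volume.restrict V)
    have m1 : MemLp (fun x => v₁ x - ξ x) 2 (volume.restrict V) := hvL.sub hξL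
    have m2 : MemLp (fun x => G₁ x - grad ξ x) 2 (volume.restrict V) := hGL.sub hgξL
    have h2 : (∫ x in Ω, v₁ (T x) * grad ζ x i) + ∫ x in Ω, pullGrad T G₁ x i * ζ x =
        (∫ x in Ω, (v₁ (T x) - ξ (T x)) * grad ζ x i) +
          ∫ x in Ω, pullGrad T (fun y => G₁ y - grad ξ y) x i * ζ x := by
      simp_rw [pullGrad_sub, PiLp.sub_apply, sub_mul]
      rw [integral_sub (hint (h.memLp_comp hvL) hgi) (hint (h.memLp_comp hξL) hgi),
        integral_sub (hint (hproj (h.memLp_pullGrad hGL)) hζL)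
          (hint (hproj (h.memLp_pullGrad hgξL)) hζL), h1]
      ring
    rw [h2]
    refine (enorm_add_le _ _).trans ?_
    rw [add_mul]
    refine add_le_add ?_ ?_
    · refine (enorm_integral_mul_le _ (h.memLp_comp m1).1 hgi.1).trans ?_
      calc _ ≤ C₁ * ε * A := by
            gcongr
            exact (hle₁ _ m1.1).trans (by gcongr)
        _ = _ := by ring
    · refine (enorm_integral_mul_le _ (hproj (h.memLp_pullGrad m2)).1 hζL.1).trans ?_
      calc _ ≤ C₂ * ε * B := by
            gcongr
            exact (eLpNorm_apply_le _ _ _ _).trans ((hle₂ _ m2.1).trans (by gcongr))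
        _ = _ := by ring
  have hCfin : C₁ * A + C₂ * B ≠ ⊤ := by
    have := hgi.2.ne
    have := hζL.2.ne
    finiteness
  by_contra hne
  have h3 : Tendsto (fun ε : ℝ≥0∞ => (C₁ * A + C₂ * B) * ε) (𝓝[≠] 0) (𝓝 0) := by
    have := (ENNReal.continuous_const_mul hCfin).tendsto 0
    rw [mul_zero] at this
    exact this.mono_left nhdsWithin_le_nhds
  have hnb : (𝓝[≠] (0 : ℝ≥0∞)).NeBot := by infer_instance
  have h4 := ge_of_tendsto h3 (by filter_upwards [self_mem_nhdsWithin] with ε hε using key ε hε)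
  exact hne (le_antisymm h4 zero_le)

lemma MemW.exists_grad {b : BC} {u : Eu N → ℂ} (h : MemW b V u) :
    MemLp u 2 (volume.restrict V) ∧
      ∃ G, HasWeakGrad V u G ∧ MemLp G 2 (volume.restrict V) := by
  cases b with
  | dirichlet => exact ⟨h.1, h.2.choose, h.2.choose_spec.1, h.2.choose_spec.2.1⟩
  | neumann => exact h

lemma MemW.congr {b : BC} {u u' : Eu N → ℂ} (h : MemW b V u)
    (hu : u =ᵐ[volume.restrict V] u') : MemW b V u' := by
  cases b with
  | dirichlet =>
    obtain ⟨h1, G, h2, h3, h4⟩ := h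
    refine ⟨h1.ae_eq hu, G, h2.congr hu ae_eq_rfl, h3, fun ε hε => ?_⟩
    obtain ⟨ζ, hζ, a, b⟩ := h4 ε hε
    refine ⟨ζ, hζ, ?_, b⟩
    rwa [eLpNorm_congr_ae (g := fun x => u x - ζ x)]
    filter_upwards [hu] with x hx using by rw [hx]
  | neumann =>
    obtain ⟨h1, G, h2, h3⟩ := h
    exact ⟨h1.ae_eq hu, G, h2.congr hu ae_eq_rfl, h3⟩

/-- The Sobolev spaces are invariant under bi-Lipschitz changes of variables. -/
lemma BiLip.memW_comp (h : BiLip Ω V T S) {b : BC} {v : Eu N → ℂ} (hv : MemW b V v) :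
    MemW b Ω fun x => v (T x) := by
  cases b with
  | neumann =>
    obtain ⟨h1, G, h2, h3⟩ := hv
    exact ⟨h.memLp_comp h1, pullGrad T G, h.hasWeakGrad_comp h1 h3 h2, h.memLp_pullGrad h3⟩
  | dirichlet =>
    obtain ⟨h1, G, h2, h3, h4⟩ := hv
    refine ⟨h.memLp_comp h1, pullGrad T G, h.hasWeakGrad_comp h1 h3 h2, h.memLp_pullGrad h3,
      fun ε hε => ?_⟩
    obtain ⟨C₁, hC₁, hle₁⟩ := h.exists_eLpNorm_comp_le ℂ
    obtain ⟨C₂, hC₂, hle₂⟩ := h.exists_eLpNorm_pullGrad_le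
    -- The final error has two pieces: pulling back the approximation on `V` costs a factor `C₁` or
    -- `C₂`, and approximating the pulled-back test function, which is only Lipschitz, by a smooth
    -- one costs ε' again.
    obtain ⟨ε', hε', hb1, hb2, hb3⟩ : ∃ ε' : ℝ≥0∞, 0 < ε' ∧ C₁ * ε' < ε / 2 ∧ C₂ * ε' < ε / 2 ∧
        ε' < ε / 2 := by
      have hε2 : (0 : ℝ≥0∞) < ε / 2 := ENNReal.half_pos hε.ne'
      have t1 : Tendsto (fun x : ℝ≥0∞ => C₁ * x) (𝓝[≠] 0) (𝓝 0) := by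
        have := (ENNReal.continuous_const_mul hC₁).tendsto 0
        rw [mul_zero] at this
        exact this.mono_left nhdsWithin_le_nhds
      have t2 : Tendsto (fun x : ℝ≥0∞ => C₂ * x) (𝓝[≠] 0) (𝓝 0) := by
        have := (ENNReal.continuous_const_mul hC₂).tendsto 0
        rw [mul_zero] at this
        exact this.mono_left nhdsWithin_le_nhds
      have t3 : Tendsto (fun x : ℝ≥0∞ => x) (𝓝[≠] 0) (𝓝 0) := tendsto_id.mono_left nhdsWithin_le_nhds
      have hnb : (𝓝[≠] (0 : ℝ≥0∞)).NeBot := by infer_instance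
      obtain ⟨x, ⟨⟨x1, x2⟩, x3⟩, x4⟩ := (((t1.eventually (gt_mem_nhds hε2)).and
        (t2.eventually (gt_mem_nhds hε2))).and (t3.eventually (gt_mem_nhds hε2))).and
        self_mem_nhdsWithin |>.exists
      exact ⟨x, pos_iff_ne_zero.2 x4, x1, x2, x3⟩
    obtain ⟨ξ, hξ, hξ1, hξ2⟩ := h4 ε' hε'
    -- `ξ ∘ T`, extended by zero, has compact support in `Ω`
    set K : Set (Eu N) := S '' tsupport ξ with hK
    have hKc : IsCompact K :=
      hξ.2.1.isCompact.image_of_continuousOn (h.swap.continuousOn.mono hξ.2.2)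
    have hKΩ : K ⊆ Ω := by
      rintro _ ⟨y, hy, rfl⟩
      exact h.mapsTo' (hξ.2.2 hy)
    have hnot : ∀ x ∈ Ω, x ∉ K → T x ∉ tsupport ξ := fun x hx hxK hT =>
      hxK ⟨T x, hT, h.left_inv x hx⟩
    have hξL := hξ.memLp 2 (volume.restrict V)
    have hgξL := hξ.memLp_grad 2 (volume.restrict V)
    have q1 : (fun x => ξ (T x)) =ᵐ[volume.restrict Ω] Ω.indicator fun x => ξ (T x) := by
      filter_upwards [ae_restrict_mem h.isOpen.measurableSet] with x hx
      rw [indicator_of_mem hx]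
    have q2 : pullGrad T (grad ξ) =ᵐ[volume.restrict Ω] Ω.indicator (pullGrad T (grad ξ)) := by
      filter_upwards [ae_restrict_mem h.isOpen.measurableSet] with x hx
      rw [indicator_of_mem hx]
    obtain ⟨ζ, hζ, hζ1, hζ2⟩ := exists_test_approx h.isOpen hKc hKΩ
      ((h.memLp_comp hξL).ae_eq q1) ((h.memLp_pullGrad hgξL).ae_eq q2)
      ((h.hasWeakGrad_test_comp hξ).congr q1 q2)
      (fun x hx => by
        by_cases hxΩ : x ∈ Ω
        · rw [indicator_of_mem hxΩ, image_eq_zero_of_notMem_tsupport (hnot x hxΩ hx)]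
        · rw [indicator_of_notMem hxΩ])
      (fun x hx => by
        by_cases hxΩ : x ∈ Ω
        · rw [indicator_of_mem hxΩ]
          ext i
          simp [pullGrad_apply, grad_eq_zero_of_notMem_tsupport (hnot x hxΩ hx)]
        · rw [indicator_of_notMem hxΩ]) hε'.ne'
    have m1 : MemLp (fun x => v x - ξ x) 2 (volume.restrict V) := h1.sub hξL
    have m2 : MemLp (fun x => G x - grad ξ x) 2 (volume.restrict V) := h3.sub hgξL
    refine ⟨ζ, hζ, ?_, ?_⟩
    · have e1 : (fun x => v (T x) - ζ x) =ᵐ[volume.restrict Ω]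
          (fun x => v (T x) - ξ (T x)) + fun x => (Ω.indicator fun x => ξ (T x)) x - ζ x := by
        filter_upwards [q1] with x hx
        simp only [Pi.add_apply, ← hx]
        ring
      rw [eLpNorm_congr_ae e1]
      calc _ ≤ eLpNorm (fun x => v (T x) - ξ (T x)) 2 (volume.restrict Ω) +
            eLpNorm (fun x => (Ω.indicator fun x => ξ (T x)) x - ζ x) 2 (volume.restrict Ω) :=
            eLpNorm_add_le (h.memLp_comp m1).1
              (((h.memLp_comp hξL).ae_eq q1).sub (hζ.memLp 2 _)).1 (by norm_num)
        _ ≤ C₁ * ε' + ε' := add_le_add ((hle₁ _ m1.1).trans (by gcongr)) hζ1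
        _ < ε / 2 + ε / 2 := ENNReal.add_lt_add hb1 hb3
        _ = ε := ENNReal.add_halves ε
    · have e1 : (fun x => pullGrad T G x - grad ζ x) =ᵐ[volume.restrict Ω]
          pullGrad T (fun y => G y - grad ξ y) +
            fun x => (Ω.indicator (pullGrad T (grad ξ))) x - grad ζ x := by
        filter_upwards [q2] with x hx
        simp only [Pi.add_apply, ← hx, pullGrad_sub]
        abel
      rw [eLpNorm_congr_ae e1]
      calc _ ≤ eLpNorm (pullGrad T fun y => G y - grad ξ y) 2 (volume.restrict Ω) +
            eLpNorm (fun x => (Ω.indicator (pullGrad T (grad ξ))) x - grad ζ x) 2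
              (volume.restrict Ω) :=
            eLpNorm_add_le (h.memLp_pullGrad m2).1
              (((h.memLp_pullGrad hgξL).ae_eq q2).sub (hζ.memLp_grad 2 _)).1 (by norm_num)
        _ ≤ C₂ * ε' + ε' := add_le_add ((hle₂ _ m2.1).trans (by gcongr)) hζ2
        _ < ε / 2 + ε / 2 := ENNReal.add_lt_add hb2 hb3
        _ = ε := ENNReal.add_halves ε

/-- The form domain C_φ[𝒲] is the Sobolev space of Ω itself, hence the same for φ and φ̃. This is
what allows an eigenfunction of one operator to be inserted into the form of the other. -/
lemma BiLip.memPullback_iff (h : BiLip Ω (T '' Ω) T S) {b : BC} {u : Eu N → ℂ} :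
    MemPullback b Ω T u ↔ MemW b Ω u := by
  constructor
  · rintro ⟨v, hv, huv⟩
    exact (h.memW_comp hv).congr huv.symm
  · intro hu
    refine ⟨fun y => u (S y), h.swap.memW_comp hu, ?_⟩
    filter_upwards [ae_restrict_mem h.isOpen.measurableSet] with x hx
    simp [h.left_inv x hx]

end BiLipschitz

/-! ### Change of variables and the measure g dx. -/

section ChangeOfVariables

open Filter Topology

variable {N : ℕ} {Ω V : Set (Eu N)} {T S : Eu N → Eu N}

lemma jac_eq_toMatrix (T : Eu N → Eu N) (x : Eu N) :
    jac T x = LinearMap.toMatrix (EuclideanSpace.basisFun (Fin N) ℝ).toBasis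
      (EuclideanSpace.basisFun (Fin N) ℝ).toBasis (fderiv ℝ T x : Eu N →ₗ[ℝ] Eu N) := by
  ext i j
  simp [jac, LinearMap.toMatrix_apply]

lemma gdet_eq_abs_det_fderiv (T : Eu N → Eu N) (x : Eu N) :
    gdet T x = |(fderiv ℝ T x).det| := by
  rw [gdet, jac_eq_toMatrix, LinearMap.det_toMatrix]

lemma measurable_gdet (T : Eu N → Eu N) : Measurable (gdet T) := by
  have h1 : Measurable fun x => (fun i j => jac T x i j : Fin N → Fin N → ℝ) :=
    measurable_pi_lambda _ fun i => measurable_pi_lambda _ fun j => measurable_jac T i j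
  have h2 : Continuous fun M : Fin N → Fin N → ℝ => |(Matrix.of M).det| :=
    (Continuous.matrix_det (A := fun M : Fin N → Fin N → ℝ => Matrix.of M) continuous_id).abs
  exact h2.measurable.comp h1

lemma gmeas_absolutelyContinuous (Ω : Set (Eu N)) (T : Eu N → Eu N) :
    gmeas Ω T ≪ volume.restrict Ω := withDensity_absolutelyContinuous _ _

/-- The area formula applies on the set `D` where `T` is differentiable. The rest of Ω is null by
Rademacher's theorem, and its image is null because `T` is Lipschitz. -/
lemma BiLip.map_gmeas (h : BiLip Ω V T S) : (gmeas Ω T).map T = volume.restrict V := by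
  set D : Set (Eu N) := Ω ∩ {x | DifferentiableAt ℝ T x} with hD
  have hDm : MeasurableSet D :=
    h.isOpen.measurableSet.inter (measurableSet_of_differentiableAt ℝ T)
  have hDΩ : volume (Ω \ D) = 0 := by
    have h1 := h.ae_differentiableAt
    rw [ae_restrict_iff' h.isOpen.measurableSet] at h1
    refine measure_mono_null (fun x hx => ?_) h1
    simp only [mem_compl_iff, mem_ofPred_eq]
    exact fun hd => hx.2 ⟨hx.1, hd hx.1⟩
  have hae : D =ᵐ[volume] Ω :=
    (inter_subset_left.eventuallyLE).antisymm (ae_le_set.2 hDΩ)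
  obtain ⟨K, hK⟩ := h.lipschitz
  have hTV : T '' Ω = V := by
    refine Subset.antisymm h.mapsTo.image_subset fun y hy => ⟨S y, h.mapsTo' hy, h.right_inv y hy⟩
  have himg : T '' D =ᵐ[volume] V := by
    refine (show T '' D ⊆ V from (image_mono inter_subset_left).trans hTV.subset).eventuallyLE.antisymm
      (ae_le_set.2 ?_)
    have h1 : V \ T '' D ⊆ T '' (Ω \ D) := by
      rw [← hTV]
      rintro _ ⟨⟨x, hx, rfl⟩, hxD⟩
      exact ⟨x, ⟨hx, fun hd => hxD ⟨x, hd, rfl⟩⟩, rfl⟩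
    refine measure_mono_null h1 (le_antisymm ?_ zero_le)
    refine (volume_image_le_of_lipschitzOn (hK.mono sdiff_subset)).trans ?_
    rw [hDΩ, mul_zero]
  have hinj : InjOn T D := fun x hx y hy hxy => by
    rw [← h.left_inv x hx.1, ← h.left_inv y hy.1, hxy]
  have h1 := map_withDensity_abs_det_fderiv_eq_addHaar volume (f := T)
    (f' := fderiv ℝ T) hDm.nullMeasurableSet
    (fun x hx => hx.2.hasFDerivAt.hasFDerivWithinAt) hinj
  rw [Measure.restrict_congr_set hae, Measure.restrict_congr_set himg] at h1
  simp only [gmeas, gdet_eq_abs_det_fderiv]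
  exact h1

/-- A bi-Lipschitz homeomorphism, extended to a measurable map of the whole space. -/
lemma BiLip.exists_measurePreserving (h : BiLip Ω V T S) :
    ∃ T' S' : Eu N → Eu N, EqOn T' T Ω ∧ EqOn S' S V ∧
      MeasurePreserving T' (gmeas Ω T) (volume.restrict V) ∧
      MeasurePreserving S' (volume.restrict V) (gmeas Ω T) := by
  obtain ⟨K, hK⟩ := h.lipschitz
  obtain ⟨K', hK'⟩ := h.lipschitz'
  obtain ⟨T', hT', hTT'⟩ := hK.extend_finite_dimension
  obtain ⟨S', hS', hSS'⟩ := hK'.extend_finite_dimension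
  have hΩ : ∀ᵐ x ∂gmeas Ω T, x ∈ Ω :=
    gmeas_absolutelyContinuous Ω T (ae_restrict_mem h.isOpen.measurableSet)
  have hmap : (gmeas Ω T).map T' = volume.restrict V := by
    rw [← h.map_gmeas]
    refine Measure.map_congr ?_
    filter_upwards [hΩ] with x hx using (hTT' hx).symm
  refine ⟨T', S', hTT'.symm, hSS'.symm, ⟨hT'.continuous.measurable, hmap⟩,
    ⟨hS'.continuous.measurable, ?_⟩⟩
  rw [← hmap, Measure.map_map hS'.continuous.measurable hT'.continuous.measurable]
  conv_rhs => rw [← Measure.map_id (μ := gmeas Ω T)]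
  refine Measure.map_congr ?_
  filter_upwards [hΩ] with x hx
  simp [← hTT' hx, ← hSS' (h.mapsTo hx), h.left_inv x hx]

/-- The measure g dx is the image under `S` of Lebesgue measure on `V`; the earlier bound on image
measures, applied to the inverse map, gives the comparison with Lebesgue measure on Ω. -/
lemma BiLip.gmeas_le (h : BiLip Ω V T S) :
    ∃ C : ℝ≥0∞, C ≠ ⊤ ∧ gmeas Ω T ≤ C • volume.restrict Ω := by
  obtain ⟨T', S', hT, hS, -, hmp⟩ := h.exists_measurePreserving
  obtain ⟨C, hC, hle⟩ := h.swap.exists_map_le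
  refine ⟨C, hC, ?_⟩
  rw [← hmp.map_eq]
  refine le_trans (le_of_eq (Measure.map_congr ?_)) hle
  filter_upwards [ae_restrict_mem h.isOpen'.measurableSet] with x hx using hS hx

lemma BiLip.le_gmeas (h : BiLip Ω V T S) :
    ∃ C : ℝ≥0∞, C ≠ ⊤ ∧ volume.restrict Ω ≤ C • gmeas Ω T := by
  obtain ⟨T', S', hT, hS, hmT, hmp⟩ := h.exists_measurePreserving
  obtain ⟨C, hC, hle⟩ := h.exists_map_le
  refine ⟨C, hC, ?_⟩
  have h1 : (volume.restrict Ω).map T' ≤ C • volume.restrict V := by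
    refine le_trans (le_of_eq (Measure.map_congr ?_)) hle
    filter_upwards [ae_restrict_mem h.isOpen.measurableSet] with x hx using hT hx
  have h2 := Measure.map_mono h1 hmp.measurable
  rw [Measure.map_smul, hmp.map_eq, Measure.map_map hmp.measurable hmT.measurable] at h2
  refine le_trans (le_of_eq ?_) h2
  conv_lhs => rw [← Measure.map_id (μ := volume.restrict Ω)]
  refine Measure.map_congr ?_
  filter_upwards [ae_restrict_mem h.isOpen.measurableSet] with x hx
  simp [hT hx, hS (h.mapsTo hx), h.left_inv x hx]

lemma BiLip.absolutelyContinuous_gmeas (h : BiLip Ω V T S) :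
    volume.restrict Ω ≪ gmeas Ω T := by
  obtain ⟨C, hC, hle⟩ := h.le_gmeas
  exact (Measure.absolutelyContinuous_of_le hle).trans Measure.smul_absolutelyContinuous

lemma BiLip.ae_gmeas (h : BiLip Ω V T S) : ae (gmeas Ω T) = ae (volume.restrict Ω) :=
  le_antisymm (gmeas_absolutelyContinuous Ω T).ae_le h.absolutelyContinuous_gmeas.ae_le

lemma BiLip.memLp_gmeas_iff (h : BiLip Ω V T S) {F : Type*} [NormedAddCommGroup F]
    {f : Eu N → F} {p : ℝ≥0∞} : MemLp f p (gmeas Ω T) ↔ MemLp f p (volume.restrict Ω) := by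
  obtain ⟨C, hC, hle⟩ := h.gmeas_le
  obtain ⟨C', hC', hle'⟩ := h.le_gmeas
  exact ⟨fun hf => hf.of_measure_le_smul hC' hle', fun hf => hf.of_measure_le_smul hC hle⟩

/-- The zero set of g is null for g dx, and Lebesgue measure on Ω is absolutely continuous with
respect to g dx. -/
lemma BiLip.ae_gdet_pos (h : BiLip Ω V T S) : ∀ᵐ x ∂volume.restrict Ω, 0 < gdet T x := by
  have hm : MeasurableSet {x | gdet T x = 0} := measurable_gdet T (measurableSet_singleton 0)
  have h1 : gmeas Ω T {x | gdet T x = 0} = 0 := by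
    rw [gmeas, withDensity_apply _ hm, setLIntegral_congr_fun (g := fun _ => 0) hm]
    · simp
    · intro x hx
      have : gdet T x = 0 := hx
      simp [this]
  have h2 := h.absolutelyContinuous_gmeas h1
  filter_upwards [compl_mem_ae_iff.2 h2] with x hx
  exact lt_of_le_of_ne (abs_nonneg _) (Ne.symm hx)

lemma integrable_gmeas_iff {f : Eu N → ℂ} :
    Integrable f (gmeas Ω T) ↔ IntegrableOn (fun x => (gdet T x : ℂ) * f x) Ω := by
  rw [gmeas, integrable_withDensity_iff_integrable_smul'
    (measurable_gdet T).ennreal_ofReal (by simp)]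
  simp only [IntegrableOn, ENNReal.toReal_ofReal (abs_nonneg _), gdet, Complex.real_smul]

lemma integral_gmeas (f : Eu N → ℂ) :
    ∫ x, f x ∂gmeas Ω T = ∫ x in Ω, (gdet T x : ℂ) * f x := by
  rw [gmeas, integral_withDensity_eq_integral_toReal_smul
    (measurable_gdet T).ennreal_ofReal (by simp)]
  simp only [ENNReal.toReal_ofReal (abs_nonneg _), gdet, Complex.real_smul]

lemma BiLip.integral_comp (h : BiLip Ω V T S) {f : Eu N → ℂ}
    (hf : AEStronglyMeasurable f (volume.restrict V)) :
    ∫ x in Ω, (gdet T x : ℂ) * f (T x) = ∫ y in V, f y := by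
  rw [← integral_gmeas fun x => f (T x), ← h.map_gmeas, integral_map]
  · exact h.aemeasurable.mono_ac (gmeas_absolutelyContinuous Ω T)
  · rwa [h.map_gmeas]

lemma BiLip.integrable_comp (h : BiLip Ω V T S) {f : Eu N → ℂ} (hf : IntegrableOn f V) :
    IntegrableOn (fun x => (gdet T x : ℂ) * f (T x)) Ω := by
  rw [← integrable_gmeas_iff (f := fun x => f (T x))]
  rw [IntegrableOn, ← h.map_gmeas] at hf
  exact hf.comp_aemeasurable (h.aemeasurable.mono_ac (gmeas_absolutelyContinuous Ω T))

/-- Composition with a bi-Lipschitz homeomorphism, as a unitary operator. -/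
lemma BiLip.exists_compEquiv (h : BiLip Ω V T S) :
    ∃ U : Lp ℂ 2 (volume.restrict V) ≃ₗᵢ[ℂ] Lp ℂ 2 (gmeas Ω T),
      ∀ v, U v =ᵐ[volume.restrict Ω] fun x => v (T x) := by
  obtain ⟨T', S', hT, hS, hmT, hmS⟩ := h.exists_measurePreserving
  set U := Lp.compMeasurePreservingₗᵢ ℂ (E := ℂ) (p := 2) T' hmT with hU
  have hUv : ∀ v, U v =ᵐ[gmeas Ω T] v ∘ T' := fun v => Lp.coeFn_compMeasurePreserving v hmT
  have hsurj : Function.Surjective U := fun u => by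
    refine ⟨Lp.compMeasurePreserving S' hmS u, Lp.ext ?_⟩
    have h1 := (Lp.coeFn_compMeasurePreserving u hmS)
    have h2 := hmT.quasiMeasurePreserving.ae_eq_comp h1
    refine (hUv _).trans (h2.trans ?_)
    rw [h.ae_gmeas]
    filter_upwards [ae_restrict_mem h.isOpen.measurableSet] with x hx
    simp [hT hx, hS (h.mapsTo hx), h.left_inv x hx]
  refine ⟨LinearIsometryEquiv.ofSurjective U hsurj, fun v => ?_⟩
  have h1 := hUv v
  rw [h.ae_gmeas] at h1
  filter_upwards [h1, ae_restrict_mem h.isOpen.measurableSet] with x hx hxΩ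
  rw [LinearIsometryEquiv.coe_ofSurjective, hx, Function.comp_apply, hT hxΩ]

end ChangeOfVariables

/-! ### Sesquilinear forms with real coefficients on complex vectors. -/

section Forms

open Matrix

variable {N : ℕ}

/-- The sesquilinear form `∑ B_{ij} ξ_i η̄_j`. -/
def cform (B : Mat N) (ξ η : EuclideanSpace ℂ (Fin N)) : ℂ :=
  ∑ i, ∑ j, (B i j : ℂ) * ξ i * conj (η j)

/-- A real matrix acting on complex vectors. -/
def capply (P : Mat N) (ξ : EuclideanSpace ℂ (Fin N)) : EuclideanSpace ℂ (Fin N) :=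
  WithLp.toLp 2 fun i => ∑ j, (P i j : ℂ) * ξ j

lemma capply_apply (P : Mat N) (ξ : EuclideanSpace ℂ (Fin N)) (i : Fin N) :
    capply P ξ i = ∑ j, (P i j : ℂ) * ξ j := rfl

lemma capply_mul (P Q : Mat N) (ξ : EuclideanSpace ℂ (Fin N)) :
    capply (P * Q) ξ = capply P (capply Q ξ) := by
  ext i
  simp only [capply_apply, Matrix.mul_apply, Finset.mul_sum, Complex.ofReal_sum, Finset.sum_mul,
    Complex.ofReal_mul]
  rw [Finset.sum_comm]
  simp only [mul_assoc]

lemma capply_one (ξ : EuclideanSpace ℂ (Fin N)) : capply (1 : Mat N) ξ = ξ := by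
  ext i
  simp [capply_apply, Matrix.one_apply, apply_ite Complex.ofReal]

lemma cform_add_left (B : Mat N) (ξ ξ' η : EuclideanSpace ℂ (Fin N)) :
    cform B (ξ + ξ') η = cform B ξ η + cform B ξ' η := by
  simp only [cform, PiLp.add_apply, mul_add, add_mul, Finset.sum_add_distrib]

lemma cform_smul_left (B : Mat N) (c : ℂ) (ξ η : EuclideanSpace ℂ (Fin N)) :
    cform B (c • ξ) η = c * cform B ξ η := by
  simp only [cform, PiLp.smul_apply, smul_eq_mul, Finset.mul_sum]
  exact Finset.sum_congr rfl fun i _ => Finset.sum_congr rfl fun j _ => by ring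

lemma cform_zero_left (B : Mat N) (η : EuclideanSpace ℂ (Fin N)) : cform B 0 η = 0 := by
  simp [cform]

lemma cform_sum_left {ι : Type*} (B : Mat N) (s : Finset ι) (f : ι → EuclideanSpace ℂ (Fin N))
    (η : EuclideanSpace ℂ (Fin N)) : cform B (∑ i ∈ s, f i) η = ∑ i ∈ s, cform B (f i) η := by
  classical
  induction s using Finset.induction_on with
  | empty => simp [cform_zero_left]
  | insert a s ha ih => rw [Finset.sum_insert ha, Finset.sum_insert ha, cform_add_left, ih]

lemma conj_cform {B : Mat N} (hB : B.IsSymm) (ξ η : EuclideanSpace ℂ (Fin N)) :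
    conj (cform B ξ η) = cform B η ξ := by
  simp only [cform, map_sum, map_mul, Complex.conj_conj, Complex.conj_ofReal]
  rw [Finset.sum_comm]
  refine Finset.sum_congr rfl fun i _ => Finset.sum_congr rfl fun j _ => ?_
  rw [hB.apply i j]
  ring

lemma cform_sub_mat (B B' : Mat N) (ξ η : EuclideanSpace ℂ (Fin N)) :
    cform (B - B') ξ η = cform B ξ η - cform B' ξ η := by
  simp only [cform, Matrix.sub_apply, Complex.ofReal_sub, sub_mul, Finset.sum_sub_distrib]

lemma cform_smul_mat (c : ℝ) (B : Mat N) (ξ η : EuclideanSpace ℂ (Fin N)) :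
    cform (c • B) ξ η = (c : ℂ) * cform B ξ η := by
  simp only [cform, Matrix.smul_apply, smul_eq_mul, Complex.ofReal_mul, Finset.mul_sum, mul_assoc]

lemma cform_capply_right (B Q : Mat N) (ξ η : EuclideanSpace ℂ (Fin N)) :
    cform B ξ (capply Q η) = cform (B * Q) ξ η := by
  simp only [cform, capply_apply, Matrix.mul_apply, map_sum, map_mul, Complex.conj_ofReal,
    Complex.ofReal_sum, Complex.ofReal_mul, Finset.mul_sum, Finset.sum_mul]
  refine Finset.sum_congr rfl fun i _ => ?_
  rw [Finset.sum_comm]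
  exact Finset.sum_congr rfl fun j _ => Finset.sum_congr rfl fun k _ => by ring

lemma cform_capply_left (B P : Mat N) (ξ η : EuclideanSpace ℂ (Fin N)) :
    cform B (capply P ξ) η = cform (Pᵀ * B) ξ η := by
  simp only [cform, capply_apply, Matrix.mul_apply, Matrix.transpose_apply,
    Complex.ofReal_sum, Complex.ofReal_mul, Finset.mul_sum, Finset.sum_mul]
  calc _ = ∑ i, ∑ k, ∑ j, (B i j : ℂ) * ((P i k : ℂ) * ξ k) * conj (η j) :=
        Finset.sum_congr rfl fun i _ => Finset.sum_comm
    _ = ∑ k, ∑ i, ∑ j, (B i j : ℂ) * ((P i k : ℂ) * ξ k) * conj (η j) := Finset.sum_comm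
    _ = ∑ k, ∑ j, ∑ i, (B i j : ℂ) * ((P i k : ℂ) * ξ k) * conj (η j) :=
        Finset.sum_congr rfl fun i _ => Finset.sum_comm
    _ = _ := Finset.sum_congr rfl fun i _ => Finset.sum_congr rfl fun k _ =>
        Finset.sum_congr rfl fun j _ => by ring

lemma cform_one (ξ η : EuclideanSpace ℂ (Fin N)) : cform (1 : Mat N) ξ η = inner ℂ η ξ := by
  simp [cform, Matrix.one_apply, PiLp.inner_apply, apply_ite Complex.ofReal]

/-- Since a positive semidefinite matrix is PᵀP, positivity and the Cauchy–Schwarz inequality for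
its form reduce to those of the Hermitian inner product. -/
lemma cform_transpose_mul (P Q : Mat N) (ξ η : EuclideanSpace ℂ (Fin N)) :
    cform (Pᵀ * Q) ξ η = inner ℂ (capply Q η) (capply P ξ) := by
  rw [← cform_one, cform_capply_left, cform_capply_right, mul_one]

lemma isSymm_of_posSemidef {B : Mat N} (hB : B.PosSemidef) : B.IsSymm := by
  simpa [Matrix.IsSymm, Matrix.IsHermitian] using hB.isHermitian

lemma exists_eq_transpose_mul_self {B : Mat N} (hB : B.PosSemidef) : ∃ P : Mat N, B = Pᵀ * P := by
  have h1 := (isSymm_of_posSemidef (Matrix.nonneg_iff_posSemidef.1 (CFC.sqrt_nonneg B))).eq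
  exact ⟨CFC.sqrt B, by rw [h1, CFC.sqrt_mul_sqrt_self B hB.nonneg]⟩

lemma cform_self_eq_ofReal {B : Mat N} (hB : B.PosSemidef) (ξ : EuclideanSpace ℂ (Fin N)) :
    cform B ξ ξ = ((cform B ξ ξ).re : ℂ) := by
  obtain ⟨P, rfl⟩ := exists_eq_transpose_mul_self hB
  rw [cform_transpose_mul, inner_self_eq_norm_sq_to_K]
  norm_cast

lemma cform_self_nonneg {B : Mat N} (hB : B.PosSemidef) (ξ : EuclideanSpace ℂ (Fin N)) :
    0 ≤ (cform B ξ ξ).re := by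
  obtain ⟨P, rfl⟩ := exists_eq_transpose_mul_self hB
  rw [cform_transpose_mul]
  exact inner_self_nonneg (𝕜 := ℂ)

lemma two_mul_norm_cform_le {B : Mat N} (hB : B.PosSemidef) (ξ η : EuclideanSpace ℂ (Fin N)) :
    2 * ‖cform B ξ η‖ ≤ (cform B ξ ξ).re + (cform B η η).re := by
  obtain ⟨P, rfl⟩ := exists_eq_transpose_mul_self hB
  simp only [cform_transpose_mul]
  have h1 := norm_inner_le_norm (𝕜 := ℂ) (capply P η) (capply P ξ)
  have h2 : ∀ v : EuclideanSpace ℂ (Fin N), (inner ℂ v v).re = ‖v‖ ^ 2 := fun v =>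
    (norm_sq_eq_re_inner (𝕜 := ℂ) v).symm
  rw [h2, h2]
  nlinarith [sq_nonneg (‖capply P η‖ - ‖capply P ξ‖)]

lemma eq_zero_of_cform_self {B : Mat N} (hB : B.PosDef) {ξ : EuclideanSpace ℂ (Fin N)}
    (h : (cform B ξ ξ).re = 0) : ξ = 0 := by
  obtain ⟨P, rfl⟩ := exists_eq_transpose_mul_self hB.posSemidef
  have h2 : (inner ℂ (capply P ξ) (capply P ξ)).re = ‖capply P ξ‖ ^ 2 :=
    (norm_sq_eq_re_inner (𝕜 := ℂ) _).symm
  rw [cform_transpose_mul, h2] at h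
  have h3 : capply P ξ = 0 := by simpa using h
  have hu : IsUnit (Pᵀ * P) := hB.isUnit
  have h4 : capply ((Pᵀ * P)⁻¹ * (Pᵀ * P)) ξ = 0 := by
    rw [capply_mul, capply_mul, h3]
    ext i
    simp [capply_apply]
  rwa [Matrix.nonsing_inv_mul _ ((Matrix.isUnit_iff_isUnit_det _).1 hu), capply_one] at h4

/-- Splitting a complex vector into its real and imaginary parts. -/
lemma norm_sq_eq_re_add_im (ξ : EuclideanSpace ℂ (Fin N)) :
    ‖ξ‖ ^ 2 = ‖(WithLp.toLp 2 fun i => (ξ i).re : Eu N)‖ ^ 2 +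
      ‖(WithLp.toLp 2 fun i => (ξ i).im : Eu N)‖ ^ 2 := by
  rw [EuclideanSpace.norm_sq_eq, EuclideanSpace.norm_sq_eq, EuclideanSpace.norm_sq_eq,
    ← Finset.sum_add_distrib]
  refine Finset.sum_congr rfl fun i _ => ?_
  rw [← Complex.normSq_eq_norm_sq, Complex.normSq_apply]
  simp [sq]

/-- The quantities δ use the operator norm on real vectors, whereas gradients are complex. A real
matrix acts separately on real and imaginary parts, and their squared norms add. -/
lemma norm_capply_le (P : Mat N) (ξ : EuclideanSpace ℂ (Fin N)) :
    ‖capply P ξ‖ ≤ ‖Matrix.toEuclideanCLM (𝕜 := ℝ) P‖ * ‖ξ‖ := by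
  set x : Eu N := WithLp.toLp 2 fun i => (ξ i).re with hx
  set y : Eu N := WithLp.toLp 2 fun i => (ξ i).im with hy
  have h1 : (WithLp.toLp 2 fun i => (capply P ξ i).re : Eu N) =
      Matrix.toEuclideanCLM (𝕜 := ℝ) P x := by
    ext i
    simp [capply_apply, Matrix.mulVec, dotProduct, hx]
  have h2 : (WithLp.toLp 2 fun i => (capply P ξ i).im : Eu N) =
      Matrix.toEuclideanCLM (𝕜 := ℝ) P y := by
    ext i
    simp [capply_apply, Matrix.mulVec, dotProduct, hy]
  refine le_of_sq_le_sq ?_ (by positivity)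
  rw [mul_pow, norm_sq_eq_re_add_im, norm_sq_eq_re_add_im ξ, h1, h2, mul_add, ← mul_pow, ← mul_pow]
  gcongr <;> exact ContinuousLinearMap.le_opNorm _ _

end Forms

/-! ### Matrix identities for the quantities in δ. -/

section SquareRoots

open Matrix

variable {N : ℕ}

lemma posDef_sqrt_facts {a : Mat N} (ha : a.PosDef) :
    (CFC.sqrt a)ᵀ = CFC.sqrt a ∧ CFC.sqrt a * CFC.sqrt a = a ∧
      CFC.sqrt a * (CFC.sqrt a)⁻¹ = 1 ∧ (CFC.sqrt a)⁻¹ * CFC.sqrt a = 1 := by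
  have h0 := ha.posSemidef.nonneg
  have hu : IsUnit (CFC.sqrt a) := (CFC.isUnit_sqrt_iff a h0).2 ha.isUnit
  have hd := (Matrix.isUnit_iff_isUnit_det _).1 hu
  exact ⟨(isSymm_of_posSemidef (Matrix.nonneg_iff_posSemidef.1 (CFC.sqrt_nonneg a))).eq,
    CFC.sqrt_mul_sqrt_self a h0, Matrix.mul_nonsing_inv _ hd, Matrix.nonsing_inv_mul _ hd⟩

/-- For `S = t a^{-1/2} ã a^{-1/2}`, the square of `(S^{1/2} - S^{-1/2}) a^{1/2}`. -/
lemma transpose_mul_self_sqrt_sub_inv {a a' : Mat N} (ha : a.PosDef) (ha' : a'.PosDef) {t : ℝ}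
    (ht : 0 < t) {S M : Mat N} (hS : S = t • ((CFC.sqrt a)⁻¹ * a' * (CFC.sqrt a)⁻¹))
    (hM : M = (CFC.sqrt S - (CFC.sqrt S)⁻¹) * CFC.sqrt a) :
    Mᵀ * M = (t • a' - a) * (t • a')⁻¹ * (t • a' - a) := by
  obtain ⟨r1, r2, r3, r4⟩ := posDef_sqrt_facts ha
  set r := CFC.sqrt a with hr
  have hrinv : (r⁻¹)ᵀ = r⁻¹ := by rw [Matrix.transpose_nonsing_inv, r1]
  have hSp : S.PosDef := by
    have hru : IsUnit r⁻¹ := ⟨⟨r⁻¹, r, r4, r3⟩, rfl⟩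
    have h1 := (Matrix.IsUnit.posDef_star_left_conjugate_iff (x := a') hru).2 ha'
    have h2 : star r⁻¹ = r⁻¹ := by
      rw [Matrix.star_eq_conjTranspose, Matrix.conjTranspose_eq_transpose_of_trivial, hrinv]
    rw [h2] at h1
    rw [hS]
    exact h1.smul ht
  obtain ⟨s1, s2, s3, s4⟩ := posDef_sqrt_facts hSp
  set s := CFC.sqrt S with hs
  have hsinv : (s⁻¹)ᵀ = s⁻¹ := by rw [Matrix.transpose_nonsing_inv, s1]
  -- Conjugation by r = a^(1/2) turns S into t a' and 1 into a. Both t a' - a and (t a')⁻¹ then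
  -- become expressions in r and s = S^(1/2), and powers of s commute.
  have hB : r * S * r = t • a' := by
    rw [hS, Matrix.mul_smul, Matrix.smul_mul]
    congr 1
    calc r * (r⁻¹ * a' * r⁻¹) * r = (r * r⁻¹) * a' * (r⁻¹ * r) := by simp only [mul_assoc]
      _ = a' := by rw [r3, r4, one_mul, mul_one]
  have hSi : s⁻¹ * s⁻¹ * S = 1 := by
    rw [← s2]
    calc s⁻¹ * s⁻¹ * (s * s) = s⁻¹ * (s⁻¹ * s) * s := by simp only [mul_assoc]
      _ = 1 := by rw [s4, mul_one, s4]
  have hBi : (t • a')⁻¹ = r⁻¹ * (s⁻¹ * s⁻¹) * r⁻¹ := by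
    refine Matrix.inv_eq_left_inv ?_
    rw [← hB]
    calc r⁻¹ * (s⁻¹ * s⁻¹) * r⁻¹ * (r * S * r) = r⁻¹ * (s⁻¹ * s⁻¹) * (r⁻¹ * r) * S * r := by
          simp only [mul_assoc]
      _ = r⁻¹ * (s⁻¹ * s⁻¹ * S) * r := by rw [r4, mul_one]; simp only [mul_assoc]
      _ = 1 := by rw [hSi, mul_one, r4]
  have hE : t • a' - a = r * (s * s - 1) * r := by
    rw [s2, mul_sub, sub_mul, hB, mul_one, r2]
  have hss : s * s - 1 = s * (s - s⁻¹) := by rw [mul_sub, s3]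
  have hss' : s * s - 1 = (s - s⁻¹) * s := by rw [sub_mul, s4]
  rw [hBi, hE, hM, Matrix.transpose_mul, Matrix.transpose_sub, r1, s1, hsinv]
  symm
  calc r * (s * s - 1) * r * (r⁻¹ * (s⁻¹ * s⁻¹) * r⁻¹) * (r * (s * s - 1) * r)
      = r * (s * s - 1) * (r * r⁻¹) * (s⁻¹ * s⁻¹) * (r⁻¹ * r) * (s * s - 1) * r := by
        simp only [mul_assoc]
    _ = r * ((s * s - 1) * s⁻¹) * (s⁻¹ * (s * s - 1)) * r := by
        rw [r3, r4, mul_one, mul_one]; simp only [mul_assoc]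
    _ = r * (s - s⁻¹) * (s - s⁻¹) * r := by
        nth_rewrite 1 [hss']
        rw [hss, mul_assoc (s - s⁻¹) s, s3, mul_one, ← mul_assoc s⁻¹ s, s4, one_mul]
    _ = _ := by simp only [mul_assoc]

/-- For `S = t a^{-1/2} ã a^{-1/2}`, the square of `(S - 1) a^{1/2}`. -/
lemma transpose_mul_self_sub_one {a a' : Mat N} (ha : a.PosDef) (ha' : a'.PosDef) {t : ℝ}
    {S M : Mat N} (hS : S = t • ((CFC.sqrt a)⁻¹ * a' * (CFC.sqrt a)⁻¹))
    (hM : M = (S - 1) * CFC.sqrt a) :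
    Mᵀ * M = (t • a' - a) * a⁻¹ * (t • a' - a) := by
  obtain ⟨r1, r2, r3, r4⟩ := posDef_sqrt_facts ha
  set r := CFC.sqrt a with hr
  have hrinv : (r⁻¹)ᵀ = r⁻¹ := by rw [Matrix.transpose_nonsing_inv, r1]
  have ha't : a'ᵀ = a' := (isSymm_of_posSemidef ha'.posSemidef).eq
  have hSt : Sᵀ = S := by
    rw [hS, Matrix.transpose_smul, Matrix.transpose_mul, Matrix.transpose_mul, hrinv, ha't,
      mul_assoc]
  have hB : r * S * r = t • a' := by
    rw [hS, Matrix.mul_smul, Matrix.smul_mul]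
    congr 1
    calc r * (r⁻¹ * a' * r⁻¹) * r = (r * r⁻¹) * a' * (r⁻¹ * r) := by simp only [mul_assoc]
      _ = a' := by rw [r3, r4, one_mul, mul_one]
  have hai : a⁻¹ = r⁻¹ * r⁻¹ := by
    refine Matrix.inv_eq_left_inv ?_
    rw [← r2]
    calc r⁻¹ * r⁻¹ * (r * r) = r⁻¹ * (r⁻¹ * r) * r := by simp only [mul_assoc]
      _ = 1 := by rw [r4, mul_one, r4]
  have hE : t • a' - a = r * (S - 1) * r := by
    rw [mul_sub, sub_mul, hB, mul_one, r2]
  rw [hai, hE, hM, Matrix.transpose_mul, Matrix.transpose_sub, r1, hSt, Matrix.transpose_one]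
  symm
  calc r * (S - 1) * r * (r⁻¹ * r⁻¹) * (r * (S - 1) * r)
      = r * (S - 1) * (r * r⁻¹) * (r⁻¹ * r) * (S - 1) * r := by simp only [mul_assoc]
    _ = _ := by rw [r3, r4, mul_one, mul_one]; simp only [mul_assoc]

end SquareRoots

/-! ### Measurability of matrix-valued functions. -/

section Measurability

open Matrix

variable {N : ℕ} {X : Type*} [MeasurableSpace X] {μ : Measure X}

lemma aestronglyMeasurable_mat {M : X → Mat N}
    (h : ∀ i j, AEStronglyMeasurable (fun x => M x i j) μ) : AEStronglyMeasurable M μ := by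
  have h1 : AEStronglyMeasurable (fun x => (fun i j => M x i j : Fin N → Fin N → ℝ)) μ :=
    (aemeasurable_pi_iff.2 fun i => aemeasurable_pi_iff.2 fun j =>
      (h i j).aemeasurable).aestronglyMeasurable
  exact h1

lemma _root_.MeasureTheory.AEStronglyMeasurable.mat_apply {M : X → Mat N} (h : AEStronglyMeasurable M μ) (i j : Fin N) :
    AEStronglyMeasurable (fun x => M x i j) μ :=
  (continuous_id.matrix_elem i j).comp_aestronglyMeasurable h

lemma _root_.MeasureTheory.AEStronglyMeasurable.mat_mul {M M' : X → Mat N} (h : AEStronglyMeasurable M μ)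
    (h' : AEStronglyMeasurable M' μ) : AEStronglyMeasurable (fun x => M x * M' x) μ :=
  (continuous_fst.matrix_mul continuous_snd).comp_aestronglyMeasurable (h.prodMk h')

lemma _root_.MeasureTheory.AEStronglyMeasurable.mat_transpose {M : X → Mat N} (h : AEStronglyMeasurable M μ) :
    AEStronglyMeasurable (fun x => (M x)ᵀ) μ :=
  continuous_id.matrix_transpose.comp_aestronglyMeasurable h

lemma _root_.MeasureTheory.AEStronglyMeasurable.mat_smul {M : X → Mat N} {c : X → ℝ} (hc : AEStronglyMeasurable c μ)
    (h : AEStronglyMeasurable M μ) : AEStronglyMeasurable (fun x => c x • M x) μ :=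
  aestronglyMeasurable_mat fun i j => hc.mul (h.mat_apply i j)

lemma _root_.MeasureTheory.AEStronglyMeasurable.mat_sub {M M' : X → Mat N} (h : AEStronglyMeasurable M μ)
    (h' : AEStronglyMeasurable M' μ) : AEStronglyMeasurable (fun x => M x - M' x) μ :=
  aestronglyMeasurable_mat fun i j => (h.mat_apply i j).sub (h'.mat_apply i j)

lemma _root_.MeasureTheory.AEStronglyMeasurable.mat_inv {M : X → Mat N} (h : AEStronglyMeasurable M μ) :
    AEStronglyMeasurable (fun x => (M x)⁻¹) μ := by
  simp only [Matrix.inv_def, Ring.inverse_eq_inv']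
  refine AEStronglyMeasurable.mat_smul ?_ ?_
  · exact (continuous_id.matrix_det.comp_aestronglyMeasurable h).aemeasurable.inv.aestronglyMeasurable
  · exact continuous_id.matrix_adjugate.comp_aestronglyMeasurable h

lemma aestronglyMeasurable_cform {B : X → Mat N} {G G' : X → EuclideanSpace ℂ (Fin N)}
    (hB : AEStronglyMeasurable B μ) (hG : AEStronglyMeasurable G μ)
    (hG' : AEStronglyMeasurable G' μ) :
    AEStronglyMeasurable (fun x => cform (B x) (G x) (G' x)) μ := by
  have hp : ∀ {G : X → EuclideanSpace ℂ (Fin N)}, AEStronglyMeasurable G μ → ∀ i,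
      AEStronglyMeasurable (fun x => G x i) μ := fun hG i =>
    (EuclideanSpace.proj (𝕜 := ℂ) i).continuous.comp_aestronglyMeasurable hG
  refine Finset.aestronglyMeasurable_fun_sum _ fun i _ =>
    Finset.aestronglyMeasurable_fun_sum _ fun j _ => ?_
  exact ((Complex.continuous_ofReal.comp_aestronglyMeasurable (hB.mat_apply i j)).mul (hp hG i)).mul
    (Complex.continuous_conj.comp_aestronglyMeasurable (hp hG' j))

lemma aestronglyMeasurable_capply {B : X → Mat N} {G : X → EuclideanSpace ℂ (Fin N)}
    (hB : AEStronglyMeasurable B μ) (hG : AEStronglyMeasurable G μ) :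
    AEStronglyMeasurable (fun x => capply (B x) (G x)) μ := by
  refine (PiLp.continuous_toLp 2 _).comp_aestronglyMeasurable
    (aemeasurable_pi_iff.2 fun i => AEStronglyMeasurable.aemeasurable ?_).aestronglyMeasurable
  refine Finset.aestronglyMeasurable_fun_sum _ fun j _ => ?_
  exact (Complex.continuous_ofReal.comp_aestronglyMeasurable (hB.mat_apply i j)).mul
    ((EuclideanSpace.proj (𝕜 := ℂ) j).continuous.comp_aestronglyMeasurable hG)

/-- The operator norm of `M` is measurable as soon as `Mᵀ M` is. -/
lemma aestronglyMeasurable_opNorm {M : X → Mat N}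
    (h : AEStronglyMeasurable (fun x => (M x)ᵀ * M x) μ) :
    AEStronglyMeasurable (fun x => ‖Matrix.toEuclideanCLM (𝕜 := ℝ) (M x)‖) μ := by
  -- By the C*-identity ‖M‖² = ‖MᵀM‖. Thus the square roots inside `M` need not be known to be
  -- measurable; in the application MᵀM is a rational expression in the coefficients.
  have h1 : ∀ x, ‖Matrix.toEuclideanCLM (𝕜 := ℝ) (M x)‖ =
      √‖Matrix.toEuclideanCLM (𝕜 := ℝ) ((M x)ᵀ * M x)‖ := fun x => by
    rw [map_mul, ← Matrix.conjTranspose_eq_transpose_of_trivial, ← Matrix.star_eq_conjTranspose,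
      map_star, ContinuousLinearMap.star_eq_adjoint]
    exact (by rw [← Real.sqrt_mul_self (norm_nonneg _), ← ContinuousLinearMap.norm_adjoint_comp_self]
      : ‖Matrix.toEuclideanCLM (𝕜 := ℝ) (M x)‖ =
        √‖(ContinuousLinearMap.adjoint (Matrix.toEuclideanCLM (𝕜 := ℝ) (M x))).comp
          (Matrix.toEuclideanCLM (𝕜 := ℝ) (M x))‖)
  simp_rw [h1]
  have h2 : Continuous fun M : Mat N => ‖Matrix.toEuclideanCLM (𝕜 := ℝ) M‖ :=
    continuous_norm.comp (LinearMap.continuous_of_finiteDimensional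
      (Matrix.toEuclideanCLM (n := Fin N) (𝕜 := ℝ)).toAlgEquiv.toLinearMap)
  exact (Real.continuous_sqrt.comp h2).comp_aestronglyMeasurable h

end Measurability

/-! ### Transformation of the coefficients and invariance of the form. -/

section Coefficients

open Filter Topology Matrix

variable {N : ℕ} {Ω V : Set (Eu N)} {T S : Eu N → Eu N} {A : Eu N → Mat N}

lemma BiLip.ae_jac_mul_jac (h : BiLip Ω V T S) :
    ∀ᵐ x ∂volume.restrict Ω, jac S (T x) * jac T x = 1 := by
  filter_upwards [h.ae_differentiableAt, h.ae_comp h.swap.ae_differentiableAt,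
    ae_restrict_mem h.isOpen.measurableSet] with x h1 h2 hx
  have h3 : (fun y => S (T y)) =ᶠ[𝓝 x] id := by
    filter_upwards [h.isOpen.mem_nhds hx] with y hy using h.left_inv y hy
  have h4 : (fderiv ℝ S (T x)).comp (fderiv ℝ T x) = ContinuousLinearMap.id ℝ (Eu N) := by
    rw [← fderiv_comp x h2 h1, ← fderiv_id (x := x)]
    exact h3.fderiv_eq
  rw [jac_eq_toMatrix, jac_eq_toMatrix, ← LinearMap.toMatrix_comp]
  have h5 : ((fderiv ℝ S (T x) : Eu N →L[ℝ] Eu N) : Eu N →ₗ[ℝ] Eu N) ∘ₗ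
      (fderiv ℝ T x : Eu N →ₗ[ℝ] Eu N) = LinearMap.id := by
    ext1 v
    exact DFunLike.congr_fun h4 v
  rw [h5, LinearMap.toMatrix_id]

lemma BiLip.exists_gdet_le (h : BiLip Ω V T S) : ∃ C : ℝ, ∀ x ∈ Ω, gdet T x ≤ C := by
  obtain ⟨K, hK⟩ := h.lipschitz
  exact ⟨_, fun x hx => Matrix.det_le (abv := AbsoluteValue.abs) fun i j =>
    abs_jac_le h.isOpen hK hx i j⟩

lemma pullGrad_eq_capply (T : Eu N → Eu N) (G : Eu N → EuclideanSpace ℂ (Fin N)) (x : Eu N) :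
    pullGrad T G x = capply (jac T x)ᵀ (G (T x)) := rfl

lemma BiLip.pullGrad_pullGrad (h : BiLip Ω V T S) (G : Eu N → EuclideanSpace ℂ (Fin N)) :
    pullGrad T (pullGrad S G) =ᵐ[volume.restrict Ω] G := by
  filter_upwards [h.ae_jac_mul_jac, ae_restrict_mem h.isOpen.measurableSet] with x hx hxΩ
  rw [pullGrad_eq_capply, pullGrad_eq_capply, ← capply_mul, ← Matrix.transpose_mul, hx,
    Matrix.transpose_one, capply_one, h.left_inv x hxΩ]

/-- The Jacobian factors in the pulled-back gradients cancel the inverse Jacobians in `coeff`; this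
pointwise identity underlies the equivalence of `L` and `H`. -/
lemma cform_coeff {x : Eu N} (hx : jac S (T x) * jac T x = 1)
    (G G' : Eu N → EuclideanSpace ℂ (Fin N)) :
    cform (gdet T x • coeff A T x) (pullGrad T G x) (pullGrad T G' x) =
      (gdet T x : ℂ) * cform (A (T x)) (G (T x)) (G' (T x)) := by
  have h1 : (jac T x)⁻¹ = jac S (T x) := Matrix.inv_eq_left_inv hx
  have h2 : jac T x * jac S (T x) = 1 := mul_eq_one_comm.1 hx
  rw [cform_smul_mat, pullGrad_eq_capply, pullGrad_eq_capply, cform_capply_left,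
    cform_capply_right, Matrix.transpose_transpose, coeff, h1]
  congr 2
  calc jac T x * (jac S (T x) * A (T x) * (jac S (T x))ᵀ) * (jac T x)ᵀ
      = (jac T x * jac S (T x)) * A (T x) * (jac T x * jac S (T x))ᵀ := by
        rw [Matrix.transpose_mul]; simp only [Matrix.mul_assoc]
    _ = A (T x) := by rw [h2, Matrix.one_mul, Matrix.transpose_one, Matrix.mul_one]

lemma IsEllipticCoeff.posDef (hA : IsEllipticCoeff A) (x : Eu N) : (A x).PosDef := by
  obtain ⟨-, h2, θ, hθ, h3⟩ := hA
  refine Matrix.PosDef.of_dotProduct_mulVec_pos ?_ fun v hv => ?_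
  · simpa [Matrix.IsHermitian] using (h2 x).eq
  · have h4 := (h3 x (WithLp.toLp 2 v)).1
    have h5 : (WithLp.toLp 2 v : Eu N) ≠ 0 := fun h => hv (by simpa using h)
    have h6 : 0 < θ⁻¹ * ‖(WithLp.toLp 2 v : Eu N)‖ ^ 2 := by positivity
    refine (h6.trans_le h4).trans_eq ?_
    simp only [dotProduct, Matrix.mulVec, Finset.mul_sum, star_trivial]
    exact Finset.sum_congr rfl fun i _ => Finset.sum_congr rfl fun j _ => by ring

lemma posDef_coeff {x : Eu N} (hA : (A (T x)).PosDef) (hx : 0 < gdet T x) :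
    (coeff A T x).PosDef := by
  have h1 : IsUnit (jac T x) :=
    (Matrix.isUnit_iff_isUnit_det _).2 (isUnit_iff_ne_zero.2 (abs_pos.1 hx))
  have h3 : IsUnit ((jac T x)⁻¹)ᵀ := by
    rw [Matrix.isUnit_transpose]
    exact Matrix.isUnit_nonsing_inv_iff.2 h1
  have h4 := (Matrix.IsUnit.posDef_star_left_conjugate_iff (x := A (T x)) h3).2 hA
  rwa [Matrix.star_eq_conjTranspose, Matrix.conjTranspose_eq_transpose_of_trivial,
    Matrix.transpose_transpose] at h4

/-- A measurable family of positive definite matrices, such that the associated form is defined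
on square integrable vector fields. -/
structure FormCoeff (Ω : Set (Eu N)) (B : Eu N → Mat N) : Prop where
  meas : AEStronglyMeasurable B (volume.restrict Ω)
  posDef : ∀ᵐ x ∂volume.restrict Ω, (B x).PosDef
  integrable : ∀ G G', MemLp G 2 (volume.restrict Ω) → MemLp G' 2 (volume.restrict Ω) →
    IntegrableOn (fun x => cform (B x) (G x) (G' x)) Ω

lemma IsEllipticCoeff.integrable_cform (hA : IsEllipticCoeff A)
    {G G' : Eu N → EuclideanSpace ℂ (Fin N)} (hG : MemLp G 2 (volume.restrict V))
    (hG' : MemLp G' 2 (volume.restrict V)) :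
    IntegrableOn (fun x => cform (A x) (G x) (G' x)) V := by
  have hp : ∀ {G : Eu N → EuclideanSpace ℂ (Fin N)}, MemLp G 2 (volume.restrict V) → ∀ i,
      MemLp (fun x => G x i) 2 (volume.restrict V) := fun hG i =>
    (EuclideanSpace.proj (𝕜 := ℂ) i).comp_memLp' hG
  refine integrable_finsetSum _ fun i _ => integrable_finsetSum _ fun j _ => ?_
  have h1 : MemLp (fun x => (A x i j : ℂ)) ⊤ (volume.restrict V) :=
    ((hA.1 i j).restrict V).ofReal
  have h2 : MemLp (fun x => conj (G' x j)) 2 (volume.restrict V) := (hp hG' j).star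
  have h3 : MemLp (fun x => (A x i j : ℂ) * G x i) 2 (volume.restrict V) := (hp hG i).mul h1
  exact h3.integrable_mul h2

lemma BiLip.aestronglyMeasurable_coeff (h : BiLip Ω V T S) (hA : IsEllipticCoeff A) :
    AEStronglyMeasurable (fun x => coeff A T x) (volume.restrict Ω) := by
  have hJ : AEStronglyMeasurable (fun x => jac T x) (volume.restrict Ω) :=
    aestronglyMeasurable_mat fun i j => (measurable_jac T i j).aestronglyMeasurable
  have hAT : AEStronglyMeasurable (fun x => A (T x)) (volume.restrict Ω) :=
    aestronglyMeasurable_mat fun i j => h.aestronglyMeasurable_comp ((hA.1 i j).1.restrict)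
  exact (hJ.mat_inv.mat_mul hAT).mat_mul hJ.mat_inv.mat_transpose

/-- Integrability is obtained by pulling the vector fields back to `V` through the inverse map,
where the bounded matrix A acts, and then changing variables; no bound on the inverse Jacobian is
required. -/
lemma BiLip.formCoeff (h : BiLip Ω V T S) (hA : IsEllipticCoeff A) :
    FormCoeff Ω fun x => gdet T x • coeff A T x where
  meas := ((measurable_gdet T).aestronglyMeasurable).mat_smul (h.aestronglyMeasurable_coeff hA)
  posDef := by
    filter_upwards [h.ae_gdet_pos] with x hx
    exact (posDef_coeff (hA.posDef _) hx).smul hx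
  integrable := fun G G' hG hG' => by
    have h1 := h.integrable_comp
      (hA.integrable_cform (h.swap.memLp_pullGrad hG) (h.swap.memLp_pullGrad hG'))
    refine h1.congr ?_
    filter_upwards [h.ae_jac_mul_jac, h.pullGrad_pullGrad G, h.pullGrad_pullGrad G']
      with x hx e1 e2
    rw [← cform_coeff hx, e1, e2]

/-- Invariance of the form under change of variables. -/
lemma BiLip.integral_cform (h : BiLip Ω V T S) (hA : IsEllipticCoeff A)
    {G G' : Eu N → EuclideanSpace ℂ (Fin N)} (hG : MemLp G 2 (volume.restrict V))
    (hG' : MemLp G' 2 (volume.restrict V)) :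
    ∫ x in Ω, cform (gdet T x • coeff A T x) (pullGrad T G x) (pullGrad T G' x) =
      ∫ y in V, cform (A y) (G y) (G' y) := by
  rw [← h.integral_comp (hA.integrable_cform hG hG').1]
  refine integral_congr_ae ?_
  filter_upwards [h.ae_jac_mul_jac] with x hx using cform_coeff hx G G'

end Coefficients

/-! ### Form operators as non-negative symmetric relations. -/

section Operators

open Filter Topology

variable {N : ℕ} {Ω V : Set (Eu N)} {T S : Eu N → Eu N} {A : Eu N → Mat N} {b : BC}

/-- Uniqueness of weak gradients allows any representative in place of the gradient supplied by the
definition. -/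
lemma formOp.integral_eq (hU : IsOpen Ω) {μ : Measure (Eu N)} {B : Eu N → Mat N}
    {D : (Eu N → ℂ) → Prop} {u f v : Lp ℂ 2 μ} (h : formOp Ω μ B D u f)
    {Gu Gv : Eu N → EuclideanSpace ℂ (Fin N)} (hu : HasWeakGrad Ω u Gu) (hDv : D v)
    (hv : HasWeakGrad Ω v Gv) :
    ∫ x in Ω, cform (B x) (Gu x) (Gv x) = ∫ x, f x * conj (v x) ∂μ := by
  obtain ⟨-, G, hG, h1⟩ := h
  rw [← h1 v Gv hDv hv]
  refine integral_congr_ae ?_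
  filter_upwards [hu.ae_eq hU hG] with x hx
  rw [hx]
  rfl

lemma formOp.intro {μ : Measure (Eu N)} {B : Eu N → Mat N}
    {D : (Eu N → ℂ) → Prop} {u f : Lp ℂ 2 μ} {Gu : Eu N → EuclideanSpace ℂ (Fin N)}
    (hD : D u) (hu : HasWeakGrad Ω u Gu)
    (h : ∀ (v : Lp ℂ 2 μ) (Gv : Eu N → EuclideanSpace ℂ (Fin N)), D v → HasWeakGrad Ω v Gv →
      ∫ x in Ω, cform (B x) (Gu x) (Gv x) = ∫ x, f x * conj (v x) ∂μ) : formOp Ω μ B D u f :=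
  ⟨hD, Gu, hu, h⟩

lemma integral_mul_conj_eq_inner {μ : Measure (Eu N)} (u v : Lp ℂ 2 μ) :
    ∫ x, u x * conj (v x) ∂μ = inner ℂ v u := by
  rw [L2.inner_def]
  exact integral_congr_ae (ae_of_all _ fun x => by simp [RCLike.inner_apply])

/-- Form operators are symmetric, non-negative and single valued. -/
lemma BiLip.isNonnegSymm_formOp (h : BiLip Ω V T S) {B : Eu N → Mat N} (hB : FormCoeff Ω B) :
    IsNonnegSymm (formOp Ω (gmeas Ω T) B (MemW b Ω)) where
  symm u f v k hu hv := by
    obtain ⟨hDu, Gu, hGu, -⟩ := id hu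
    obtain ⟨hDv, Gv, hGv, -⟩ := id hv
    have e1 := hu.integral_eq h.isOpen hGu hDv hGv
    have e2 := hv.integral_eq h.isOpen hGv hDu hGu
    rw [integral_mul_conj_eq_inner] at e1 e2
    have e3 : conj (∫ x in Ω, cform (B x) (Gu x) (Gv x)) = ∫ x in Ω, cform (B x) (Gv x) (Gu x) := by
      rw [← integral_conj]
      refine integral_congr_ae ?_
      filter_upwards [hB.posDef] with x hx using conj_cform (isSymm_of_posSemidef hx.posSemidef) _ _
    rw [e1, e2] at e3
    rwa [inner_conj_symm] at e3
  nonneg u f hu := by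
    obtain ⟨hDu, Gu, hGu, -⟩ := id hu
    have e1 := hu.integral_eq h.isOpen hGu hDu hGu
    rw [integral_mul_conj_eq_inner] at e1
    rw [← e1]
    have e2 : ∫ x in Ω, cform (B x) (Gu x) (Gu x) =
        ((∫ x in Ω, (cform (B x) (Gu x) (Gu x)).re : ℝ) : ℂ) := by
      rw [← integral_complex_ofReal]
      refine integral_congr_ae ?_
      filter_upwards [hB.posDef] with x hx using cform_self_eq_ofReal hx.posSemidef _
    rw [e2, Complex.ofReal_re]
    refine integral_nonneg_of_ae ?_
    filter_upwards [hB.posDef] with x hx using cform_self_nonneg hx.posSemidef _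
  eq_zero f hf := by
    obtain ⟨hD, G, hG, -⟩ := id hf
    have h0 : HasWeakGrad Ω ((0 : Lp ℂ 2 (gmeas Ω T)) : Eu N → ℂ) fun _ => 0 := by
      have h1 : HasWeakGrad Ω (fun _ : Eu N => (0 : ℂ)) fun _ => 0 :=
        ⟨locallyIntegrableOn_zero, locallyIntegrableOn_zero, fun ζ hζ i => by simp⟩
      refine h1.congr ?_ ae_eq_rfl
      have h2 := Lp.coeFn_zero ℂ 2 (gmeas Ω T)
      rw [h.ae_gmeas] at h2
      exact h2.symm
    have hf2 : MemLp f 2 (gmeas Ω T) := Lp.memLp f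
    have hloc : LocallyIntegrableOn (fun x => (gdet T x : ℂ) * f x) Ω volume := by
      obtain ⟨C, hC⟩ := h.exists_gdet_le
      intro x hx
      obtain ⟨t, ht, hft⟩ := locallyIntegrableOn_of_memLp (h.memLp_gmeas_iff.1 hf2) x hx
      refine ⟨t ∩ Ω, inter_mem ht self_mem_nhdsWithin,
        (hft.mono_set inter_subset_left).bdd_mul (c := C) ?_ ?_⟩
      · exact (Complex.measurable_ofReal.comp (measurable_gdet T)).aestronglyMeasurable
      · filter_upwards [ae_mono (Measure.restrict_mono_set volume inter_subset_right)
          (ae_restrict_mem h.isOpen.measurableSet)] with y hy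
        rw [Complex.norm_real, Real.norm_eq_abs, gdet, abs_abs]
        exact hC y hy
    -- Testing with the conjugate of ζ gives ∫ g f ζ = 0 for every test function ζ. Test functions
    -- lie in the form domain for either boundary condition.
    have h1 : (fun x => (gdet T x : ℂ) * f x) =ᵐ[volume.restrict Ω] 0 := by
      refine ae_eq_zero_of_integral_test h.isOpen hloc fun ζ hζ => ?_
      have hζ' : IsTest Ω fun x => conj (ζ x) := by
        exact ⟨Complex.conjCLE.contDiff.comp hζ.1, hζ.2.1.comp_left (map_zero _),
          (tsupport_comp_subset (map_zero (starRingEnd ℂ)) ζ).trans hζ.2.2⟩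
      have hL : MemLp (fun x => conj (ζ x)) 2 (gmeas Ω T) :=
        h.memLp_gmeas_iff.2 (hζ'.memLp 2 _)
      have hae : hL.toLp =ᵐ[volume.restrict Ω] fun x => conj (ζ x) := by
        have := hL.coeFn_toLp
        rwa [h.ae_gmeas] at this
      have e1 := hf.integral_eq h.isOpen h0 ((hζ'.memW b).congr hae.symm)
        (hζ'.hasWeakGrad.congr hae.symm ae_eq_rfl)
      simp only [cform_zero_left, integral_zero] at e1
      rw [integral_gmeas] at e1
      rw [e1]
      refine integral_congr_ae ?_
      filter_upwards [hae] with x hx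
      rw [hx, Complex.conj_conj, mul_assoc]
    refine Lp.ext ((?_ : _ =ᵐ[gmeas Ω T] (0 : Eu N → ℂ)).trans (Lp.coeFn_zero ℂ 2 _).symm)
    rw [h.ae_gmeas]
    filter_upwards [h1, h.ae_gdet_pos] with x hx hpos
    have : (gdet T x : ℂ) ≠ 0 := Complex.ofReal_ne_zero.2 hpos.ne'
    simpa [this] using hx

end Operators

/-! ### Unitary equivalences between `L` and `H`, and between `H̃` and `w⁻¹ H̃ w`. -/

section Equivalences

open Filter Topology

variable {N : ℕ} {Ω V V' : Set (Eu N)} {T S T' S' φ φ' : Eu N → Eu N} {A : Eu N → Mat N} {b : BC}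

lemma BiLip.opH_eq (h : BiLip Ω (T '' Ω) T S) : opH b A Ω T =
    formOp Ω (gmeas Ω T) (fun x => gdet T x • coeff A T x) (MemW b Ω) := by
  unfold opH
  congr 1
  funext u
  exact propext h.memPullback_iff

lemma BiLip.opTST_eq (h : BiLip Ω (T '' Ω) T S) (φ' : Eu N → Eu N) : opTST b A Ω T φ' =
    formOp Ω (gmeas Ω T) (fun x => gdet φ' x • coeff A φ' x) (MemW b Ω) := by
  unfold opTST
  congr 1
  funext u
  exact propext h.memPullback_iff

lemma MemW.memLp_grad {U : Set (Eu N)} (hU : IsOpen U) {u : Eu N → ℂ} (h : MemW b U u)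
    {G : Eu N → EuclideanSpace ℂ (Fin N)} (hG : HasWeakGrad U u G) :
    MemLp G 2 (volume.restrict U) := by
  obtain ⟨G', h1, h2⟩ := h.exists_grad.2
  exact h2.ae_eq (h1.ae_eq hU hG)

/-- The operators `L` and `H` are unitarily equivalent. -/
lemma BiLip.exists_equiv_opL (h : BiLip Ω (T '' Ω) T S) (hA : IsEllipticCoeff A) :
    ∃ U : Lp ℂ 2 (volume.restrict (T '' Ω)) ≃ₗᵢ[ℂ] Lp ℂ 2 (gmeas Ω T),
      ∀ u f, opL b A Ω T u f ↔ opH b A Ω T (U u) (U f) := by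
  obtain ⟨U, hU⟩ := h.exists_compEquiv
  have hmem : ∀ v : Lp ℂ 2 (volume.restrict (T '' Ω)), MemW b (T '' Ω) v ↔ MemW b Ω (U v) := fun v => by
    refine ⟨fun hv => (h.memW_comp hv).congr (hU v).symm, fun hv => ?_⟩
    refine (h.swap.memW_comp hv).congr ?_
    filter_upwards [h.swap.ae_comp (hU v), ae_restrict_mem h.isOpen'.measurableSet] with y hy hyV
    rw [hy, h.right_inv y hyV]
  have hgrad : ∀ {v : Lp ℂ 2 (volume.restrict (T '' Ω))} {G}, MemW b (T '' Ω) v →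
      HasWeakGrad (T '' Ω) v G → HasWeakGrad Ω (U v) (pullGrad T G) := fun {v G} hv hG =>
    (h.hasWeakGrad_comp hv.exists_grad.1 (hv.memLp_grad h.isOpen' hG) hG).congr (hU v).symm
      ae_eq_rfl
  refine ⟨U, fun u f => ?_⟩
  rw [h.opH_eq]
  constructor
  · intro hu
    obtain ⟨hD, G, hG, -⟩ := id hu
    refine formOp.intro ((hmem u).1 hD) (hgrad hD hG) fun v Gv hDv hGv => ?_
    obtain ⟨v, rfl⟩ := U.surjective v
    have hDv' := (hmem v).2 hDv
    obtain ⟨G', hG', hG'2⟩ := hDv'.exists_grad.2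
    have e1 := hu.integral_eq h.isOpen' hG hDv' hG'
    rw [← h.integral_cform hA (hD.memLp_grad h.isOpen' hG) hG'2, integral_mul_conj_eq_inner] at e1
    rw [integral_mul_conj_eq_inner, U.inner_map_map, ← e1]
    refine integral_congr_ae ?_
    filter_upwards [hGv.ae_eq h.isOpen (hgrad hDv' hG')] with x hx
    rw [hx]
  · intro hu
    have hD := (hmem u).2 hu.1
    obtain ⟨G, hG, hG2⟩ := hD.exists_grad.2
    refine formOp.intro hD hG fun v Gv hDv hGv => ?_
    have e1 := hu.integral_eq h.isOpen (hgrad hD hG) ((hmem v).1 hDv) (hgrad hDv hGv)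
    rw [h.integral_cform hA hG2 (hDv.memLp_grad h.isOpen' hGv), integral_mul_conj_eq_inner,
      U.inner_map_map] at e1
    rw [e1, integral_mul_conj_eq_inner]

lemma measurable_wfun (φ φ' : Eu N → Eu N) : Measurable (wfun φ φ') :=
  (measurable_gdet φ).sqrt.div (measurable_gdet φ').sqrt

lemma wfun_swap (φ φ' : Eu N → Eu N) (x : Eu N) : wfun φ' φ x = (wfun φ φ' x)⁻¹ := by
  rw [wfun, wfun, inv_div]

lemma wfun_sq_mul {x : Eu N} (h : 0 ≤ gdet φ x) (h' : 0 < gdet φ' x) :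
    wfun φ φ' x ^ 2 * gdet φ' x = gdet φ x := by
  rw [wfun, div_pow, Real.sq_sqrt h, Real.sq_sqrt h'.le, div_mul_cancel₀ _ h'.ne']

lemma wfun_pos {x : Eu N} (h : 0 < gdet φ x) (h' : 0 < gdet φ' x) : 0 < wfun φ φ' x :=
  div_pos (Real.sqrt_pos.2 h) (Real.sqrt_pos.2 h')

lemma eLpNorm_gmeas_sq {F : Type*} [NormedAddCommGroup F] {f : Eu N → F}
    (hf : AEStronglyMeasurable f (volume.restrict Ω)) :
    eLpNorm f 2 (gmeas Ω φ) ^ 2 = ∫⁻ x in Ω, ENNReal.ofReal (gdet φ x) * ‖f x‖ₑ ^ 2 := by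
  rw [eLpNorm_two_sq, gmeas, lintegral_withDensity_eq_lintegral_mul₀
    (measurable_gdet φ).ennreal_ofReal.aemeasurable (hf.enorm.pow_const 2)]
  rfl

/-- This is the relation w² g̃ = g. -/
lemma BiLip.eLpNorm_wfun_mul (h' : BiLip Ω V' φ' S') {f : Eu N → ℂ}
    (hf : AEStronglyMeasurable f (volume.restrict Ω)) :
    eLpNorm (fun x => (wfun φ φ' x : ℂ) * f x) 2 (gmeas Ω φ') = eLpNorm f 2 (gmeas Ω φ) := by
  have hw : AEStronglyMeasurable (fun x => (wfun φ φ' x : ℂ)) (volume.restrict Ω) :=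
    (Complex.measurable_ofReal.comp (measurable_wfun φ φ')).aestronglyMeasurable
  have h1 : eLpNorm (fun x => (wfun φ φ' x : ℂ) * f x) 2 (gmeas Ω φ') ^ 2 =
      eLpNorm f 2 (gmeas Ω φ) ^ 2 := by
    rw [eLpNorm_gmeas_sq (f := fun x => (wfun φ φ' x : ℂ) * f x) (hw.mul hf), eLpNorm_gmeas_sq hf]
    refine lintegral_congr_ae ?_
    filter_upwards [h'.ae_gdet_pos] with x hx
    rw [enorm_mul, mul_pow, ← mul_assoc]
    congr 1
    rw [← wfun_sq_mul (φ := φ) (abs_nonneg _) hx, mul_comm (wfun φ φ' x ^ 2),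
      ENNReal.ofReal_mul hx.le, ENNReal.ofReal_pow (by unfold wfun; positivity),
      ← ofReal_norm, Complex.norm_real, Real.norm_of_nonneg (by unfold wfun; positivity)]
  exact (ENNReal.pow_right_strictMono two_ne_zero).injective h1

/-- Multiplication by `w`, as a unitary operator. -/
lemma BiLip.exists_mulEquiv (h : BiLip Ω V φ S) (h' : BiLip Ω V' φ' S') :
    ∃ W : Lp ℂ 2 (gmeas Ω φ) ≃ₗᵢ[ℂ] Lp ℂ 2 (gmeas Ω φ'),
      ∀ u, W u =ᵐ[volume.restrict Ω] fun x => (wfun φ φ' x : ℂ) * u x := by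
  have key : ∀ {φ φ' S S' : Eu N → Eu N} {V V' : Set (Eu N)}, BiLip Ω V φ S → BiLip Ω V' φ' S' →
      ∀ u : Lp ℂ 2 (gmeas Ω φ), MemLp (fun x => (wfun φ φ' x : ℂ) * u x) 2 (gmeas Ω φ') := by
    intro φ φ' S S' V V' h h' u
    have hu := Lp.memLp u
    have hu1 := (h.memLp_gmeas_iff.1 hu).1
    have hw : AEStronglyMeasurable (fun x => (wfun φ φ' x : ℂ)) (volume.restrict Ω) :=
      (Complex.measurable_ofReal.comp (measurable_wfun φ φ')).aestronglyMeasurable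
    refine ⟨(hw.mul hu1).mono_ac (gmeas_absolutelyContinuous Ω φ'), ?_⟩
    rw [h'.eLpNorm_wfun_mul hu1]
    exact hu.2
  have hae : ∀ {φ φ' S S' : Eu N → Eu N} {V V' : Set (Eu N)} (h : BiLip Ω V φ S)
      (h' : BiLip Ω V' φ' S') (u : Lp ℂ 2 (gmeas Ω φ)), (key h h' u).toLp =ᵐ[volume.restrict Ω]
        fun x => (wfun φ φ' x : ℂ) * u x := by
    intro φ φ' S S' V V' h h' u
    have := (key h h' u).coeFn_toLp
    rwa [h'.ae_gmeas] at this
  have hext : ∀ {u v : Lp ℂ 2 (gmeas Ω φ')}, u =ᵐ[volume.restrict Ω] v → u = v := by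
    intro u v huv
    rw [← h'.ae_gmeas] at huv
    exact Lp.ext huv
  let W₀ : Lp ℂ 2 (gmeas Ω φ) →ₗ[ℂ] Lp ℂ 2 (gmeas Ω φ') :=
    { toFun := fun u => (key h h' u).toLp
      map_add' := fun u v => by
        have h1 := Lp.coeFn_add u v
        have h2 := Lp.coeFn_add (key h h' u).toLp (key h h' v).toLp
        rw [h.ae_gmeas] at h1
        rw [h'.ae_gmeas] at h2
        refine hext ?_
        filter_upwards [h1, h2, hae h h' u, hae h h' v, hae h h' (u + v)] with x e1 e2 e3 e4 e5
        rw [e5, e2, Pi.add_apply, e3, e4, e1, Pi.add_apply, mul_add]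
      map_smul' := fun c u => by
        have h1 := Lp.coeFn_smul c u
        have h2 := Lp.coeFn_smul c (key h h' u).toLp
        rw [h.ae_gmeas] at h1
        rw [h'.ae_gmeas] at h2
        refine hext ?_
        filter_upwards [h1, h2, hae h h' u, hae h h' (c • u)] with x e1 e2 e3 e5
        rw [e5, RingHom.id_apply, e2, Pi.smul_apply, e3, e1, Pi.smul_apply, smul_eq_mul,
          smul_eq_mul, mul_left_comm] }
  let W₁ : Lp ℂ 2 (gmeas Ω φ) →ₗᵢ[ℂ] Lp ℂ 2 (gmeas Ω φ') :=
    ⟨W₀, fun u => by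
      change ‖(key h h' u).toLp‖ = ‖u‖
      rw [Lp.norm_toLp, h'.eLpNorm_wfun_mul (h.memLp_gmeas_iff.1 (Lp.memLp u)).1, Lp.norm_def]⟩
  have hsurj : Function.Surjective W₁ := fun v => by
    refine ⟨(key h' h v).toLp, hext ?_⟩
    have e1 := hae h h' (key h' h v).toLp
    refine EventuallyEq.trans e1 ?_
    filter_upwards [hae h' h v, h.ae_gdet_pos, h'.ae_gdet_pos] with x hx h1 h2
    have h3 : (wfun φ φ' x : ℂ) ≠ 0 := Complex.ofReal_ne_zero.2 (wfun_pos h1 h2).ne'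
    rw [hx, wfun_swap φ φ', Complex.ofReal_inv, mul_inv_cancel_left₀ h3]
  exact ⟨LinearIsometryEquiv.ofSurjective W₁ hsurj, fun u => hae h h' u⟩

/-- The operators `w⁻¹ H̃ w` and `H̃` are unitarily equivalent. -/
lemma BiLip.opConj_iff (h' : BiLip Ω V' φ' S')
    (W : Lp ℂ 2 (gmeas Ω φ) ≃ₗᵢ[ℂ] Lp ℂ 2 (gmeas Ω φ'))
    (hW : ∀ u, W u =ᵐ[volume.restrict Ω] fun x => (wfun φ φ' x : ℂ) * u x)
    (u f : Lp ℂ 2 (gmeas Ω φ)) : opConj b A Ω φ φ' u f ↔ opH b A Ω φ' (W u) (W f) := by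
  constructor
  · rintro ⟨u', f', hu', hf', hop⟩
    have h1 : W u = u' := Lp.ext (by rw [h'.ae_gmeas]; exact (hW u).trans hu'.symm)
    have h2 : W f = f' := Lp.ext (by rw [h'.ae_gmeas]; exact (hW f).trans hf'.symm)
    rwa [h1, h2]
  · intro hop
    exact ⟨W u, W f, hW u, hW f, hop⟩

end Equivalences

/-! ### Transfer of symmetry and positivity along a unitary equivalence. -/

section Transfer

variable {H H' : Type*} [NormedAddCommGroup H] [InnerProductSpace ℂ H]
  [NormedAddCommGroup H'] [InnerProductSpace ℂ H'] {E : H → H → Prop} {E' : H' → H' → Prop}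

lemma IsNonnegSymm.of_equiv (U : H ≃ₗᵢ[ℂ] H') (h : ∀ u f, E u f ↔ E' (U u) (U f))
    (hE : IsNonnegSymm E') : IsNonnegSymm E where
  symm u f v k hu hv := by
    rw [← U.inner_map_map, ← U.inner_map_map]
    exact hE.symm _ _ _ _ ((h _ _).1 hu) ((h _ _).1 hv)
  nonneg u f hu := by
    rw [← U.inner_map_map]
    exact hE.nonneg _ _ ((h _ _).1 hu)
  eq_zero f hf := by
    have h1 := (h _ _).1 hf
    rw [map_zero] at h1
    exact (map_eq_zero_iff U U.injective).1 (hE.eq_zero _ h1)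

end Transfer

/-! ### Bessel and Hölder inequalities for energy forms. -/

section Bessel

open Matrix

variable {N : ℕ} {Ω : Set (Eu N)} {B E : Eu N → Mat N} {φ : Eu N → Eu N}

/-- The field `F` need not be square integrable; finite energy is enough, by the pointwise
inequality 2|B(G, F)| ≤ B(G, G) + B(F, F). -/
lemma FormCoeff.integrable_of_lintegral (hB : FormCoeff Ω B)
    {G F : Eu N → EuclideanSpace ℂ (Fin N)} (hG : MemLp G 2 (volume.restrict Ω))
    (hF : AEStronglyMeasurable F (volume.restrict Ω))
    (hFF : IntegrableOn (fun x => (cform (B x) (F x) (F x)).re) Ω) :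
    IntegrableOn (fun x => cform (B x) (G x) (F x)) Ω := by
  refine Integrable.mono' ((hB.integrable G G hG hG).re.add hFF)
    (aestronglyMeasurable_cform hB.meas hG.1 hF) ?_
  filter_upwards [hB.posDef] with x hx
  have h1 := two_mul_norm_cform_le hx.posSemidef (G x) (F x)
  have h2 := norm_nonneg (cform (B x) (G x) (F x))
  simp only [Pi.add_apply]
  change _ ≤ (cform (B x) (G x) (G x)).re + _
  linarith

/-- Bessel's inequality with respect to the form given by `B`. -/
lemma FormCoeff.bessel (hB : FormCoeff Ω B) {G : ℕ → Eu N → EuclideanSpace ℂ (Fin N)} {ev : ℕ → ℝ}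
    (h0 : ∀ m, 0 ≤ ev m) (hG : ∀ m, MemLp (G m) 2 (volume.restrict Ω))
    (horth : ∀ m n, ∫ x in Ω, cform (B x) (G m x) (G n x) = if m = n then (ev m : ℂ) else 0)
    {F : Eu N → EuclideanSpace ℂ (Fin N)} (hF : AEStronglyMeasurable F (volume.restrict Ω)) :
    ∑' m, (if ev m = 0 then 0 else ENNReal.ofReal (ev m)⁻¹) *
        ‖∫ x in Ω, cform (B x) (G m x) (F x)‖ₑ ^ 2 ≤
      ∫⁻ x in Ω, ENNReal.ofReal (cform (B x) (F x) (F x)).re := by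
  rcases eq_top_or_lt_top (∫⁻ x in Ω, ENNReal.ofReal (cform (B x) (F x) (F x)).re) with htop | hlt
  · rw [htop]; exact le_top
  have hnn : 0 ≤ᵐ[volume.restrict Ω] fun x => (cform (B x) (F x) (F x)).re := by
    filter_upwards [hB.posDef] with x hx using cform_self_nonneg hx.posSemidef _
  have hmeas : AEStronglyMeasurable (fun x => (cform (B x) (F x) (F x)).re) (volume.restrict Ω) :=
    Complex.continuous_re.comp_aestronglyMeasurable (aestronglyMeasurable_cform hB.meas hF hF)
  have hFF : IntegrableOn (fun x => (cform (B x) (F x) (F x)).re) Ω :=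
    ⟨hmeas, (hasFiniteIntegral_iff_ofReal hnn).2 hlt⟩
  rw [← ofReal_integral_eq_lintegral_ofReal hFF hnn, ENNReal.tsum_eq_iSup_sum]
  refine iSup_le fun s => ?_
  set d : ℕ → ℂ := fun m => ∫ x in Ω, cform (B x) (G m x) (F x) with hd
  -- The coefficients of the projection `Gs` of `F` onto the span of the finitely many `G m`, which
  -- have energy `ev m`; modes of zero energy are left out. Then B(Gs, F) and B(Gs, Gs) both equal
  -- `X`, and 2 Re B(Gs, F) ≤ B(Gs, Gs) + B(F, F) yields X ≤ B(F, F).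
  set c : ℕ → ℂ := fun m => if ev m = 0 then 0 else conj (d m) * ((ev m)⁻¹ : ℝ) with hc
  set X : ℝ := ∑ m ∈ s, if ev m = 0 then 0 else (ev m)⁻¹ * ‖d m‖ ^ 2 with hX
  set Gs : Eu N → EuclideanSpace ℂ (Fin N) := fun x => ∑ m ∈ s, c m • G m x with hGs
  have hGsL : MemLp Gs 2 (volume.restrict Ω) := memLp_finsetSum _ fun m _ => (hG m).const_smul (c m)
  have hXs : ENNReal.ofReal X = ∑ m ∈ s, (if ev m = 0 then 0 else ENNReal.ofReal (ev m)⁻¹) *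
      ‖d m‖ₑ ^ 2 := by
    rw [hX, ENNReal.ofReal_sum_of_nonneg]
    · refine Finset.sum_congr rfl fun m _ => ?_
      split_ifs
      · simp
      · rw [ENNReal.ofReal_mul (inv_nonneg.2 (h0 m)), ENNReal.ofReal_pow (norm_nonneg _),
          ofReal_norm]
    · intro m _
      have := h0 m
      split_ifs <;> positivity
  rw [← hXs]
  refine ENNReal.ofReal_le_ofReal ?_
  have hsum : ∀ η : Eu N → EuclideanSpace ℂ (Fin N),
      (∀ m, IntegrableOn (fun x => cform (B x) (G m x) (η x)) Ω) →
      ∫ x in Ω, cform (B x) (Gs x) (η x) = ∑ m ∈ s, c m * ∫ x in Ω, cform (B x) (G m x) (η x) := by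
    intro η hη
    simp only [hGs, cform_sum_left, cform_smul_left]
    rw [integral_finsetSum _ fun m _ => (hη m).const_mul _]
    exact Finset.sum_congr rfl fun m _ => integral_const_mul _ _
  have e1 : ∫ x in Ω, cform (B x) (Gs x) (F x) = (X : ℂ) := by
    rw [hsum F fun m => hB.integrable_of_lintegral (hG m) hF hFF, hX, Complex.ofReal_sum]
    refine Finset.sum_congr rfl fun m _ => ?_
    change c m * d m = _
    simp only [hc]
    split_ifs
    · simp
    · rw [mul_right_comm, Complex.conj_mul', mul_comm]
      push_cast
      ring
  have hsymm : ∀ ξ η : Eu N → EuclideanSpace ℂ (Fin N),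
      ∫ x in Ω, cform (B x) (ξ x) (η x) = conj (∫ x in Ω, cform (B x) (η x) (ξ x)) := by
    intro ξ η
    rw [← integral_conj]
    refine integral_congr_ae ?_
    filter_upwards [hB.posDef] with x hx
    exact (conj_cform (isSymm_of_posSemidef hx.posSemidef) _ _).symm
  have e2 : ∫ x in Ω, cform (B x) (Gs x) (Gs x) = (X : ℂ) := by
    rw [hsum Gs fun m => hB.integrable _ _ (hG m) hGsL, hX, Complex.ofReal_sum]
    refine Finset.sum_congr rfl fun m hm => ?_
    rw [hsymm, hsum (G m) fun n => hB.integrable _ _ (hG n) (hG m)]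
    simp only [horth, mul_ite, mul_zero, Finset.sum_ite_eq', hm, if_true]
    simp only [hc]
    split_ifs with h
    · simp
    · have h' : (ev m : ℂ) ≠ 0 := Complex.ofReal_ne_zero.2 h
      simp only [map_mul, Complex.conj_conj, Complex.conj_ofReal]
      push_cast
      rw [← Complex.conj_mul']
      field_simp
  have hi1 := hB.integrable_of_lintegral hGsL hF hFF
  have hi2 := hB.integrable _ _ hGsL hGsL
  have key : 2 * X ≤ X + ∫ x in Ω, (cform (B x) (F x) (F x)).re := by
    have r1 : X = ∫ x in Ω, (cform (B x) (Gs x) (F x)).re := by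
      have := integral_re hi1
      change ∫ x in Ω, (cform (B x) (Gs x) (F x)).re = _ at this
      rw [this, e1]
      simp
    have r2 : X = ∫ x in Ω, (cform (B x) (Gs x) (Gs x)).re := by
      have := integral_re hi2
      change ∫ x in Ω, (cform (B x) (Gs x) (Gs x)).re = _ at this
      rw [this, e2]
      simp
    calc 2 * X = ∫ x in Ω, 2 * (cform (B x) (Gs x) (F x)).re := by
          rw [integral_const_mul, ← r1]
      _ ≤ ∫ x in Ω, ((cform (B x) (Gs x) (Gs x)).re + (cform (B x) (F x) (F x)).re) := by
          refine integral_mono_ae (hi1.re.const_mul 2) (hi2.re.add hFF) ?_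
          filter_upwards [hB.posDef] with x hx
          have h1 := two_mul_norm_cform_le hx.posSemidef (Gs x) (F x)
          have h2 := Complex.re_le_norm (cform (B x) (Gs x) (F x))
          change 2 * (cform (B x) (Gs x) (F x)).re ≤ _
          linarith
      _ = _ := by
          have := integral_add hi2.re hFF
          rw [r2]
          exact this
  linarith

/-- Bessel's inequality for the form given by `E`, relative to the form given by `B`. -/
lemma FormCoeff.bessel_rel (hB : FormCoeff Ω B) {G : ℕ → Eu N → EuclideanSpace ℂ (Fin N)}
    {ev : ℕ → ℝ} (h0 : ∀ m, 0 ≤ ev m) (hG : ∀ m, MemLp (G m) 2 (volume.restrict Ω))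
    (horth : ∀ m n, ∫ x in Ω, cform (B x) (G m x) (G n x) = if m = n then (ev m : ℂ) else 0)
    (hE : AEStronglyMeasurable E (volume.restrict Ω))
    (hEs : ∀ᵐ x ∂volume.restrict Ω, (E x).IsSymm)
    {ξ : Eu N → EuclideanSpace ℂ (Fin N)} (hξ : AEStronglyMeasurable ξ (volume.restrict Ω)) :
    ∑' m, (if ev m = 0 then 0 else ENNReal.ofReal (ev m)⁻¹) *
        ‖∫ x in Ω, cform (E x) (G m x) (ξ x)‖ₑ ^ 2 ≤
      ∫⁻ x in Ω, ENNReal.ofReal (cform (E x * (B x)⁻¹ * E x) (ξ x) (ξ x)).re := by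
  -- Bessel's inequality for F = B⁻¹Eξ: then B(G, F) = E(G, ξ), and the energy of F is the form of E
  -- B⁻¹ E at ξ.
  have h1 := hB.bessel h0 hG horth
    (aestronglyMeasurable_capply (hB.meas.mat_inv.mat_mul hE) hξ)
  have hinv : ∀ᵐ x ∂volume.restrict Ω, B x * (B x)⁻¹ = 1 := by
    filter_upwards [hB.posDef] with x hx
    exact Matrix.mul_nonsing_inv _ ((Matrix.isUnit_iff_isUnit_det _).1 hx.isUnit)
  have e1 : ∀ m, ∫ x in Ω, cform (B x) (G m x) (capply ((B x)⁻¹ * E x) (ξ x)) =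
      ∫ x in Ω, cform (E x) (G m x) (ξ x) := fun m => by
    refine integral_congr_ae ?_
    filter_upwards [hinv] with x hx
    rw [cform_capply_right, ← Matrix.mul_assoc, hx, Matrix.one_mul]
  simp only [e1] at h1
  refine h1.trans (le_of_eq (lintegral_congr_ae ?_))
  filter_upwards [hinv, hEs, hB.posDef] with x hx hs hp
  have h2 : ((B x)⁻¹)ᵀ = (B x)⁻¹ := by
    rw [Matrix.transpose_nonsing_inv, (isSymm_of_posSemidef hp.posSemidef).eq]
  rw [cform_capply_right, cform_capply_left, Matrix.transpose_mul, h2, hs.eq]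
  congr 3
  calc E x * (B x)⁻¹ * (B x * ((B x)⁻¹ * E x)) = E x * (B x)⁻¹ * (B x * (B x)⁻¹) * E x := by
        simp only [Matrix.mul_assoc]
    _ = _ := by rw [hx, Matrix.mul_one]

/-- The relation (1 - 2/q₀)/2 + 1/q₀ = 1/2, valid also for q₀ = ∞; it explains the exponent 2q₀/(q₀
- 2) in the theorem. -/
lemma holderTriple_qratio {q₀ : ℝ≥0∞} (hq₀ : 2 < q₀) :
    ENNReal.HolderTriple (2 * qratio q₀) q₀ 2 := by
  refine ⟨?_⟩
  have h1 : (2 : ℝ≥0∞) / q₀ ≤ 1 := ENNReal.div_le_of_le_mul (by rw [one_mul]; exact hq₀.le)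
  rw [qratio, ENNReal.mul_inv (Or.inl (by norm_num)) (Or.inl (by norm_num)), inv_inv]
  have h2 : q₀⁻¹ = 2⁻¹ * (2 / q₀) := by
    rw [div_eq_mul_inv, ← mul_assoc, ENNReal.inv_mul_cancel (by norm_num) (by norm_num), one_mul]
  rw [h2, ← mul_add, tsub_add_cancel_of_le h1, mul_one]

/-- Hölder's inequality for the form `E B⁻¹ E = g Mᵀ M`. -/
lemma lintegral_cform_le {q₀ : ℝ≥0∞} (hq₀ : 2 < q₀) {M Q : Eu N → Mat N}
    (hQ : AEStronglyMeasurable Q (volume.restrict Ω))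
    (hg : ∀ᵐ x ∂volume.restrict Ω, 0 < gdet φ x)
    (hM : ∀ᵐ x ∂volume.restrict Ω, Q x = gdet φ x • ((M x)ᵀ * M x))
    {ξ : Eu N → EuclideanSpace ℂ (Fin N)} (hξ : AEStronglyMeasurable ξ (volume.restrict Ω)) :
    ∫⁻ x in Ω, ENNReal.ofReal (cform (Q x) (ξ x) (ξ x)).re ≤
      (matNorm (2 * qratio q₀) (gmeas Ω φ) M * eLpNorm ξ q₀ (gmeas Ω φ)) ^ 2 := by
  -- Here MᵀM = g⁻¹Q is measurable, although `M` itself is not assumed to be.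
  have hMM : AEStronglyMeasurable (fun x => (M x)ᵀ * M x) (volume.restrict Ω) := by
    have h1 : AEStronglyMeasurable (fun x => (gdet φ x)⁻¹ • Q x) (volume.restrict Ω) :=
      ((measurable_gdet φ).inv.aestronglyMeasurable).mat_smul hQ
    refine h1.congr ?_
    filter_upwards [hg, hM] with x hx hMx
    rw [hMx, smul_smul, inv_mul_cancel₀ hx.ne', one_smul]
  have hn := aestronglyMeasurable_opNorm hMM
  set n : Eu N → ℝ := fun x => ‖Matrix.toEuclideanCLM (𝕜 := ℝ) (M x)‖ with hn'
  have hac := gmeas_absolutelyContinuous Ω φ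
  have := holderTriple_qratio hq₀
  have h1 := eLpNorm_smul_le_mul_eLpNorm (p := 2 * qratio q₀) (q := q₀) (r := 2)
    (hξ.mono_ac hac) (hn.mono_ac hac)
  refine le_trans ?_ (pow_le_pow_left' h1 2)
  rw [eLpNorm_gmeas_sq (hn.smul hξ)]
  refine lintegral_mono_ae ?_
  filter_upwards [hg, hM] with x hx hMx
  have h2 : (cform (Q x) (ξ x) (ξ x)).re = gdet φ x * ‖capply (M x) (ξ x)‖ ^ 2 := by
    rw [hMx, cform_smul_mat, cform_transpose_mul, inner_self_eq_norm_sq_to_K,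
      RCLike.ofReal_eq_complex_ofReal, ← Complex.ofReal_pow, ← Complex.ofReal_mul,
      Complex.ofReal_re]
  rw [h2, ENNReal.ofReal_mul hx.le, ENNReal.ofReal_pow (norm_nonneg _)]
  gcongr
  rw [Pi.smul_apply', enorm_smul, ← ofReal_norm (n x), ← ofReal_norm (ξ x),
    ← ENNReal.ofReal_mul (norm_nonneg _)]
  refine ENNReal.ofReal_le_ofReal ((norm_capply_le _ _).trans_eq ?_)
  rw [hn', norm_norm]

end Bessel

/-! ### Same Hilbert space, different forms: `H` against `T^*ST`. -/

section CompareForms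

open Filter Topology

variable {N : ℕ} {Ω V : Set (Eu N)} {φ S : Eu N → Eu N} {b : BC} {B B' : Eu N → Mat N}

/-- The energy of a kernel element is 0, and the coefficients are positive definite. -/
lemma BiLip.formOp_zero_of_zero (h : BiLip Ω V φ S) (hB : FormCoeff Ω B)
    {u : Lp ℂ 2 (gmeas Ω φ)} (hu : formOp Ω (gmeas Ω φ) B (MemW b Ω) u 0)
    {G : Eu N → EuclideanSpace ℂ (Fin N)} (hG : HasWeakGrad Ω u G) :
    G =ᵐ[volume.restrict Ω] 0 := by
  have hG2 := hu.1.memLp_grad h.isOpen hG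
  have h1 := hu.integral_eq h.isOpen hG hu.1 hG
  rw [integral_mul_conj_eq_inner, inner_zero_right] at h1
  have h2 : ∫ x in Ω, (cform (B x) (G x) (G x)).re = 0 := by
    have := integral_re (hB.integrable G G hG2 hG2)
    rw [h1, map_zero] at this
    exact this
  have hnn : 0 ≤ᵐ[volume.restrict Ω] fun x => (cform (B x) (G x) (G x)).re := by
    filter_upwards [hB.posDef] with x hx using cform_self_nonneg hx.posSemidef _
  have h3 := (integral_eq_zero_iff_of_nonneg_ae hnn (hB.integrable G G hG2 hG2).re).1 h2
  filter_upwards [h3, hB.posDef] with x hx hp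
  exact eq_zero_of_cform_self hp hx

/-- A kernel element has zero gradient, a condition independent of the coefficients. So all form
operators with this domain have the same kernel. -/
lemma BiLip.formOp_zero (h : BiLip Ω V φ S) (hB : FormCoeff Ω B)
    {u : Lp ℂ 2 (gmeas Ω φ)} (hu : formOp Ω (gmeas Ω φ) B (MemW b Ω) u 0) :
    formOp Ω (gmeas Ω φ) B' (MemW b Ω) u 0 := by
  obtain ⟨hD, G, hG, -⟩ := id hu
  refine formOp.intro hD hG fun v Gv _ _ => ?_
  rw [integral_mul_conj_eq_inner, inner_zero_right]
  refine integral_eq_zero_of_ae ?_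
  filter_upwards [h.formOp_zero_of_zero hB hu hG] with x hx
  rw [hx, Pi.zero_apply, cform_zero_left, Pi.zero_apply]

lemma IsEigenSeq.integral_cform {ψ : ℕ → Lp ℂ 2 (gmeas Ω φ)} (hΩ : IsOpen Ω)
    (hψ : IsEigenSeq (formOp Ω (gmeas Ω φ) B (MemW b Ω)) ψ)
    {G : ℕ → Eu N → EuclideanSpace ℂ (Fin N)} (hG : ∀ n, HasWeakGrad Ω (ψ n) (G n))
    {v : Lp ℂ 2 (gmeas Ω φ)} {Gv : Eu N → EuclideanSpace ℂ (Fin N)} (hv : MemW b Ω v)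
    (hGv : HasWeakGrad Ω v Gv) (n : ℕ) :
    ∫ x in Ω, cform (B x) (G n x) (Gv x) =
      (eig (formOp Ω (gmeas Ω φ) B (MemW b Ω)) n : ℂ) * inner ℂ v (ψ n) := by
  rw [formOp.integral_eq hΩ (hψ.2 n) (hG n) hv hGv, integral_mul_conj_eq_inner, inner_smul_right]

lemma enorm_inner_symm {H : Type*} [NormedAddCommGroup H] [InnerProductSpace ℂ H] (x y : H) :
    ‖inner ℂ x y‖ₑ = ‖inner ℂ y x‖ₑ := by
  rw [← ofReal_norm, ← ofReal_norm, norm_inner_symm]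

lemma Orthonormal.enorm_eq_one {H : Type*} [NormedAddCommGroup H] [InnerProductSpace ℂ H]
    {ψ : ℕ → H} (h : Orthonormal ℂ ψ) (n : ℕ) : ‖ψ n‖ₑ = 1 := by
  rw [← ofReal_norm, h.1 n, ENNReal.ofReal_one]

/-- Bound for the differences of the forms at the eigenfunctions. -/
lemma BiLip.bessel_eigenfunctions (h : BiLip Ω V φ S) (hB : FormCoeff Ω B) {E M : Eu N → Mat N}
    (hE : AEStronglyMeasurable E (volume.restrict Ω))
    (hEs : ∀ᵐ x ∂volume.restrict Ω, (E x).IsSymm)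
    (hM : ∀ᵐ x ∂volume.restrict Ω, E x * (B x)⁻¹ * E x = gdet φ x • ((M x).transpose * M x))
    {ψ : ℕ → Lp ℂ 2 (gmeas Ω φ)} (hψ : IsEigenSeq (formOp Ω (gmeas Ω φ) B (MemW b Ω)) ψ)
    {G : ℕ → Eu N → EuclideanSpace ℂ (Fin N)} (hG : ∀ n, HasWeakGrad Ω (ψ n) (G n))
    {q₀ : ℝ≥0∞} (hq₀ : 2 < q₀) {δ : ℝ≥0∞} (hδ : matNorm (2 * qratio q₀) (gmeas Ω φ) M ≤ δ)
    {γ C ν : ℝ} (hC : 0 < C) (hν : 0 ≤ ν) {ξ : Eu N → EuclideanSpace ℂ (Fin N)}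
    (hξ : AEStronglyMeasurable ξ (volume.restrict Ω))
    (hb : eLpNorm ξ q₀ (gmeas Ω φ) ≤ ENNReal.ofReal (C * ν ^ (1 / 2 + γ))) :
    ∑' m, (if eig (formOp Ω (gmeas Ω φ) B (MemW b Ω)) m = 0 then 0
        else ENNReal.ofReal (eig (formOp Ω (gmeas Ω φ) B (MemW b Ω)) m)⁻¹) *
        ‖∫ x in Ω, cform (E x) (G m x) (ξ x)‖ₑ ^ 2 ≤
      δ ^ 2 * ENNReal.ofReal (C ^ 2) * ENNReal.ofReal (ν ^ (1 + 2 * γ)) := by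
  have hE' : AEStronglyMeasurable (fun x => E x * (B x)⁻¹ * E x) (volume.restrict Ω) :=
    (hE.mat_mul hB.meas.mat_inv).mat_mul hE
  have hnn := (h.isNonnegSymm_formOp (b := b) hB)
  have hG2 : ∀ n, MemLp (G n) 2 (volume.restrict Ω) := fun n =>
    (hψ.2 n).1.memLp_grad h.isOpen (hG n)
  refine (hB.bessel_rel (hnn.eig_nonneg) hG2 (fun m n => ?_) hE hEs hξ).trans ?_
  · rw [hψ.integral_cform h.isOpen hG (hψ.2 n).1 (hG n) m, orthonormal_iff_ite.1 hψ.1 n m]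
    simp only [eq_comm (a := n), mul_ite, mul_one, mul_zero]
  refine (lintegral_cform_le hq₀ hE' h.ae_gdet_pos hM hξ).trans ?_
  refine (pow_le_pow_left' (mul_le_mul' hδ hb) 2).trans_eq ?_
  rw [mul_pow, ← ENNReal.ofReal_pow (by positivity), mul_pow, ← Real.rpow_natCast (ν ^ _),
    ← Real.rpow_mul hν, ENNReal.ofReal_mul (by positivity), mul_assoc]
  congr 4
  push_cast
  ring

/-- Comparison of the eigenvalues of two form operators with the same form domain on the same
Hilbert space. -/
theorem BiLip.tsum_formOp_comparison (h : BiLip Ω V φ S) (hB : FormCoeff Ω B)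
    (hB' : FormCoeff Ω B') {M M' : Eu N → Mat N}
    (hM : ∀ᵐ x ∂volume.restrict Ω,
      (B' x - B x) * (B x)⁻¹ * (B' x - B x) = gdet φ x • ((M x).transpose * M x))
    (hM' : ∀ᵐ x ∂volume.restrict Ω,
      (B' x - B x) * (B' x)⁻¹ * (B' x - B x) = gdet φ x • ((M' x).transpose * M' x))
    {q₀ : ℝ≥0∞} (hq₀ : 2 < q₀) {δ : ℝ≥0∞} (hδ : matNorm (2 * qratio q₀) (gmeas Ω φ) M ≤ δ)
    (hδ' : matNorm (2 * qratio q₀) (gmeas Ω φ) M' ≤ δ)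
    {α γ C₁ C₂ : ℝ} {k : ℕ} (hα : 0 < α) (hC₁ : 0 < C₁) (hγ : 0 < γ)
    (he : α < 2 * k - 3 - 2 * γ) (hC₂ : 0 < C₂)
    (hc : HasCompactResolvent (formOp Ω (gmeas Ω φ) B (MemW b Ω)))
    (hc' : HasCompactResolvent (formOp Ω (gmeas Ω φ) B' (MemW b Ω)))
    (hg : EigGrowth (formOp Ω (gmeas Ω φ) B (MemW b Ω)) α C₁)
    (hg' : EigGrowth (formOp Ω (gmeas Ω φ) B' (MemW b Ω)) α C₁)
    {ψ ψ' : ℕ → Lp ℂ 2 (gmeas Ω φ)} (hψ : IsEigenSeq (formOp Ω (gmeas Ω φ) B (MemW b Ω)) ψ)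
    (hψ' : IsEigenSeq (formOp Ω (gmeas Ω φ) B' (MemW b Ω)) ψ')
    (hP : PropP2 Ω (formOp Ω (gmeas Ω φ) B (MemW b Ω)) ψ q₀ γ C₂)
    (hP' : PropP2 Ω (formOp Ω (gmeas Ω φ) B' (MemW b Ω)) ψ' q₀ γ C₂) :
    ∑' n, ENNReal.ofReal ((((eig (formOp Ω (gmeas Ω φ) B (MemW b Ω)) n + 1) ^ k)⁻¹ -
        ((eig (formOp Ω (gmeas Ω φ) B' (MemW b Ω)) n + 1) ^ k)⁻¹) ^ 2) ≤
      2 * (ENNReal.ofReal ((k : ℝ) ^ 2) * (δ ^ 2 * ENNReal.ofReal (C₂ ^ 2))) *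
        growthSum α C₁ (2 * k - 3 - 2 * γ) := by
  have hS := h.isNonnegSymm_formOp (b := b) hB
  have hS' := h.isNonnegSymm_formOp (b := b) hB'
  have ht := hψ.tendsto_eig hS hc hα hC₁ hg
  have ht' := hψ'.tendsto_eig hS' hc' hα hC₁ hg'
  choose G hG hGb using hP
  choose G' hG' hGb' using hP'
  have hG2 : ∀ n, MemLp (G n) 2 (volume.restrict Ω) := fun n =>
    (hψ.2 n).1.memLp_grad h.isOpen (hG n)
  have hG2' : ∀ n, MemLp (G' n) 2 (volume.restrict Ω) := fun n =>
    (hψ'.2 n).1.memLp_grad h.isOpen (hG' n)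
  set ev := eig (formOp Ω (gmeas Ω φ) B (MemW b Ω)) with hev
  set ev' := eig (formOp Ω (gmeas Ω φ) B' (MemW b Ω)) with hev'
  have hE : AEStronglyMeasurable (fun x => B' x - B x) (volume.restrict Ω) :=
    hB'.meas.mat_sub hB.meas
  have hEs : ∀ᵐ x ∂volume.restrict Ω, (B' x - B x).IsSymm := by
    filter_upwards [hB.posDef, hB'.posDef] with x h1 h2
    exact (isSymm_of_posSemidef h2.posSemidef).sub (isSymm_of_posSemidef h1.posSemidef)
  have hconj : ∀ i m, conj (∫ x in Ω, cform (B' x - B x) (G i x) (G' m x)) =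
      ∫ x in Ω, cform (B' x - B x) (G' m x) (G i x) := fun i m => by
    rw [← integral_conj]
    refine integral_congr_ae ?_
    filter_upwards [hEs] with x hx using conj_cform hx _ _
  have hnorm : ∀ i m, ‖∫ x in Ω, cform (B' x - B x) (G' m x) (G i x)‖ₑ =
      ‖∫ x in Ω, cform (B' x - B x) (G i x) (G' m x)‖ₑ := fun i m => by
    rw [← hconj i m, ← ofReal_norm, ← ofReal_norm, RCLike.norm_conj]
  -- Each of the two forms is evaluated through the eigenvalue equation of the eigenfunction
  -- belonging to it.
  have hd : ∀ i m, ∫ x in Ω, cform (B' x - B x) (G i x) (G' m x) =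
      ((ev' m - ev i : ℝ) : ℂ) * inner ℂ (ψ' m) (ψ i) := fun i m => by
    have e1 := hψ.integral_cform h.isOpen hG (hψ'.2 m).1 (hG' m) i
    have e2 := hψ'.integral_cform h.isOpen hG' (hψ.2 i).1 (hG i) m
    have e3 : ∫ x in Ω, cform (B' x) (G i x) (G' m x) = (ev' m : ℂ) * inner ℂ (ψ' m) (ψ i) := by
      rw [← inner_conj_symm (ψ' m), ← Complex.conj_ofReal, ← map_mul, ← e2, ← integral_conj]
      refine integral_congr_ae ?_
      filter_upwards [hB'.posDef] with x hx
      exact (conj_cform (isSymm_of_posSemidef hx.posSemidef) _ _).symm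
    simp only [cform_sub_mat]
    rw [integral_sub (hB'.integrable _ _ (hG2 i) (hG2' m)) (hB.integrable _ _ (hG2 i) (hG2' m)),
      e1, e3]
    push_cast
    ring
  refine tsum_eigenvalue_comparison_form (hS.eig_nonneg) (hS'.eig_nonneg) (hψ.eig_mono hS)
    (hψ'.eig_mono hS') ht ht' (fun n => ⟨fun h0 => ?_, fun h0 => ?_⟩) hα hC₁ hγ he hg hg'
    (p := fun i m => ‖inner ℂ (ψ' m) (ψ i)‖ₑ ^ 2) (fun i => ?_) (fun m => ?_)
    (D := fun i m => ‖∫ x in Ω, cform (B' x - B x) (G i x) (G' m x)‖ₑ ^ 2)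
    (fun i m => ?_) (fun i m h0 => ?_) (fun i m h0 => ?_) (fun i _ => ?_) (fun m _ => ?_)
  · exact hψ.eig_eq_zero_of_ker hS hS' hψ' LinearMap.id Function.injective_id
      (fun u hu => h.formOp_zero hB hu) h0
  · exact hψ'.eig_eq_zero_of_ker hS' hS hψ LinearMap.id Function.injective_id
      (fun u hu => h.formOp_zero hB' hu) h0
  · rw [tsum_enorm_inner_sq hψ'.1 (hψ'.orthogonal_eq_bot hS' hc' ht'),
      Orthonormal.enorm_eq_one hψ.1, one_pow]
  · simp_rw [enorm_inner_symm (ψ' m)]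
    rw [tsum_enorm_inner_sq hψ.1 (hψ.orthogonal_eq_bot hS hc ht),
      Orthonormal.enorm_eq_one hψ'.1, one_pow]
  · rw [hd, enorm_mul, mul_pow]
    congr 1
    rw [← ofReal_norm, Complex.norm_real, ← ENNReal.ofReal_pow (norm_nonneg _), Real.norm_eq_abs,
      sq_abs, ← neg_sub, neg_sq]
  · have h1 : G i =ᵐ[volume.restrict Ω] 0 := by
      have h2 := hψ.2 i
      rw [h0, Complex.ofReal_zero, zero_smul] at h2
      exact h.formOp_zero_of_zero hB h2 (hG i)
    rw [integral_eq_zero_of_ae]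
    · simp
    · filter_upwards [h1] with x hx
      rw [hx, Pi.zero_apply, cform_zero_left, Pi.zero_apply]
  · have h1 : G' m =ᵐ[volume.restrict Ω] 0 := by
      have h2 := hψ'.2 m
      rw [h0, Complex.ofReal_zero, zero_smul] at h2
      exact h.formOp_zero_of_zero hB' h2 (hG' m)
    rw [← hnorm, integral_eq_zero_of_ae]
    · simp
    · filter_upwards [h1] with x hx
      rw [hx, Pi.zero_apply, cform_zero_left, Pi.zero_apply]
  -- The sum over eigenfunctions of B' involves (B')⁻¹, hence the matrix `M'`; the last bullet,
  -- which sums over those of B, involves `M`.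
  · simp_rw [← hnorm]
    exact h.bessel_eigenfunctions hB' hE hEs hM' hψ' hG' hq₀ hδ' hC₂ (hS.eig_nonneg i)
      (hG2 i).1 (hGb i)
  · exact h.bessel_eigenfunctions hB hE hEs hM hψ hG hq₀ hδ hC₂ (hS'.eig_nonneg m)
      (hG2' m).1 (hGb' m)

end CompareForms

/-! ### Same form, different inner products: `w⁻¹ H̃ w` against `T^*ST`. -/

section CompareWeights

open Filter Topology

variable {N : ℕ} {Ω V V' : Set (Eu N)} {φ φ' S S' : Eu N → Eu N} {b : BC} {A : Eu N → Mat N}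

lemma BiLip.lp_ext (h : BiLip Ω V φ S) {u v : Lp ℂ 2 (gmeas Ω φ)}
    (huv : u =ᵐ[volume.restrict Ω] v) : u = v := by
  rw [← h.ae_gmeas] at huv
  exact Lp.ext huv

/-- The identity, between the `L²` spaces of two equivalent measures. -/
lemma BiLip.exists_inclusion (h : BiLip Ω V φ S) (h' : BiLip Ω V' φ' S') :
    ∃ I : Lp ℂ 2 (gmeas Ω φ) →ₗ[ℂ] Lp ℂ 2 (gmeas Ω φ'), ∀ u, I u =ᵐ[volume.restrict Ω] u := by
  have key : ∀ u : Lp ℂ 2 (gmeas Ω φ), MemLp u 2 (gmeas Ω φ') := fun u =>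
    h'.memLp_gmeas_iff.2 (h.memLp_gmeas_iff.1 (Lp.memLp u))
  have hae : ∀ u : Lp ℂ 2 (gmeas Ω φ), (key u).toLp =ᵐ[volume.restrict Ω] u := fun u => by
    have := (key u).coeFn_toLp
    rwa [h'.ae_gmeas] at this
  refine ⟨{ toFun := fun u => (key u).toLp, map_add' := fun u v => ?_, map_smul' := fun c u => ?_ },
    hae⟩
  · have h1 := Lp.coeFn_add u v
    have h2 := Lp.coeFn_add (key u).toLp (key v).toLp
    rw [h.ae_gmeas] at h1
    rw [h'.ae_gmeas] at h2
    refine h'.lp_ext ?_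
    filter_upwards [h1, h2, hae u, hae v, hae (u + v)] with x e1 e2 e3 e4 e5
    rw [e5, e2, Pi.add_apply, e3, e4, e1, Pi.add_apply]
  · have h1 := Lp.coeFn_smul c u
    have h2 := Lp.coeFn_smul c (key u).toLp
    rw [h.ae_gmeas] at h1
    rw [h'.ae_gmeas] at h2
    refine h'.lp_ext ?_
    filter_upwards [h1, h2, hae u, hae (c • u)] with x e1 e2 e3 e5
    rw [e5, RingHom.id_apply, e2, Pi.smul_apply, e3, e1, Pi.smul_apply]

/-- Multiplication by `w` as an operator on `L²(Ω, g dx)`. -/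
lemma BiLip.exists_mulOp (h : BiLip Ω V φ S) (h' : BiLip Ω V' φ' S') :
    ∃ P : Lp ℂ 2 (gmeas Ω φ) →ₗ[ℂ] Lp ℂ 2 (gmeas Ω φ),
      (∀ u, P u =ᵐ[volume.restrict Ω] fun x => (wfun φ φ' x : ℂ) * u x) ∧
      Function.Injective P := by
  obtain ⟨W, hW⟩ := h.exists_mulEquiv h'
  obtain ⟨I, hI⟩ := h'.exists_inclusion h
  refine ⟨I ∘ₗ W.toLinearEquiv.toLinearMap, fun u => (hI (W u)).trans (hW u), ?_⟩
  refine Function.Injective.comp (g := I) (fun u v huv => ?_) W.injective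
  refine h'.lp_ext (((hI u).symm.trans ?_).trans (hI v))
  rw [huv]

/-- Multiplication by `w⁻¹` as an operator on `L²(Ω, g dx)`. -/
lemma BiLip.exists_mulInvOp (h : BiLip Ω V φ S) (h' : BiLip Ω V' φ' S') :
    ∃ P : Lp ℂ 2 (gmeas Ω φ) →ₗ[ℂ] Lp ℂ 2 (gmeas Ω φ),
      (∀ u, P u =ᵐ[volume.restrict Ω] fun x => (((wfun φ φ' x)⁻¹ : ℝ) : ℂ) * u x) ∧
      Function.Injective P := by
  obtain ⟨W, hW⟩ := h'.exists_mulEquiv h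
  obtain ⟨I, hI⟩ := h.exists_inclusion h'
  refine ⟨W.toLinearEquiv.toLinearMap ∘ₗ I, fun u => ?_, ?_⟩
  · refine (hW (I u)).trans ?_
    filter_upwards [hI u] with x hx
    rw [hx, ← wfun_swap]
  · refine Function.Injective.comp W.injective (f := I) (fun u v huv => ?_)
    refine h.lp_ext (((hI u).symm.trans ?_).trans (hI v))
    rw [huv]

lemma BiLip.inner_mulOp (h : BiLip Ω V φ S) {m : Eu N → ℝ}
    {P : Lp ℂ 2 (gmeas Ω φ) →ₗ[ℂ] Lp ℂ 2 (gmeas Ω φ)}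
    (hP : ∀ u, P u =ᵐ[volume.restrict Ω] fun x => (m x : ℂ) * u x) (u v : Lp ℂ 2 (gmeas Ω φ)) :
    inner ℂ (P v) u = inner ℂ v (P u) := by
  rw [← integral_mul_conj_eq_inner, ← integral_mul_conj_eq_inner]
  refine integral_congr_ae ?_
  rw [EventuallyEq, h.ae_gmeas]
  filter_upwards [hP u, hP v] with x h1 h2
  rw [h1, h2, map_mul, Complex.conj_ofReal]
  ring

/-- Hölder's inequality for (m - 1)u. It will be used with m = w and m = w⁻¹, the two functions in
`delta1`. -/
lemma BiLip.enorm_mulOp_sub_le (h : BiLip Ω V φ S) {m : Eu N → ℝ} (hm : Measurable m)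
    {P : Lp ℂ 2 (gmeas Ω φ) →ₗ[ℂ] Lp ℂ 2 (gmeas Ω φ)}
    (hP : ∀ u, P u =ᵐ[volume.restrict Ω] fun x => (m x : ℂ) * u x) {q₀ : ℝ≥0∞} (hq₀ : 2 < q₀)
    (u : Lp ℂ 2 (gmeas Ω φ)) :
    ‖P u - u‖ₑ ≤ eLpNorm (fun x => m x - 1) (2 * qratio q₀) (gmeas Ω φ) *
      eLpNorm u q₀ (gmeas Ω φ) := by
  have := holderTriple_qratio hq₀
  have h1 := eLpNorm_smul_le_mul_eLpNorm (p := 2 * qratio q₀) (q := q₀) (r := 2) (μ := gmeas Ω φ)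
    (Lp.memLp u).1 ((hm.sub_const 1).aestronglyMeasurable (μ := gmeas Ω φ))
  refine le_trans (le_of_eq ?_) h1
  rw [Lp.enorm_def]
  refine eLpNorm_congr_ae ?_
  have h2 := Lp.coeFn_sub (P u) u
  rw [EventuallyEq, h.ae_gmeas] at h2 ⊢
  filter_upwards [h2, hP u] with x e1 e2
  rw [e1, Pi.sub_apply, e2, Pi.smul_apply', Complex.real_smul]
  push_cast
  ring

/-- The form of `H̃` at `w u` and `v`, computed in two ways. -/
lemma BiLip.conj_eigen_identity (h : BiLip Ω (φ '' Ω) φ S) (h' : BiLip Ω (φ' '' Ω) φ' S')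
    (hA : IsEllipticCoeff A)
    {P Q : Lp ℂ 2 (gmeas Ω φ) →ₗ[ℂ] Lp ℂ 2 (gmeas Ω φ)}
    (hP : ∀ u, P u =ᵐ[volume.restrict Ω] fun x => (wfun φ φ' x : ℂ) * u x)
    (hQ : ∀ u, Q u =ᵐ[volume.restrict Ω] fun x => (((wfun φ φ' x)⁻¹ : ℝ) : ℂ) * u x)
    {u v f k : Lp ℂ 2 (gmeas Ω φ)} (hu : opConj b A Ω φ φ' u f) (hv : opTST b A Ω φ φ' v k) :
    inner ℂ v (Q f) = inner ℂ k (P u) := by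
  have hB := h'.formCoeff hA
  rw [h.opTST_eq] at hv
  obtain ⟨u', f', hu', hf', hop⟩ := hu
  rw [h'.opH_eq] at hop
  obtain ⟨hD, G, hG, -⟩ := id hop
  obtain ⟨hDv, Gv, hGv, -⟩ := id hv
  obtain ⟨I, hI⟩ := h.exists_inclusion h'
  have hPu : P u =ᵐ[volume.restrict Ω] u' := (hP u).trans hu'.symm
  have e1 := hop.integral_eq h'.isOpen hG (v := I v) (hDv.congr (hI v).symm)
    (hGv.congr (hI v).symm ae_eq_rfl)
  have e2 := hv.integral_eq h.isOpen hGv (v := P u) (hD.congr hPu.symm)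
    (hG.congr hPu.symm ae_eq_rfl)
  rw [integral_mul_conj_eq_inner] at e2
  have e3 : conj (∫ x in Ω, cform (gdet φ' x • coeff A φ' x) (Gv x) (G x)) =
      ∫ x in Ω, cform (gdet φ' x • coeff A φ' x) (G x) (Gv x) := by
    rw [← integral_conj]
    refine integral_congr_ae ?_
    filter_upwards [hB.posDef] with x hx using conj_cform (isSymm_of_posSemidef hx.posSemidef) _ _
  rw [e1, e2, inner_conj_symm] at e3
  rw [e3, integral_gmeas, ← integral_mul_conj_eq_inner, integral_gmeas]
  refine integral_congr_ae ?_
  filter_upwards [hI v, hf', hQ f, h.ae_gdet_pos, h'.ae_gdet_pos] with x x1 x2 x3 x4 x5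
  rw [x1, x2, x3]
  have hw := (wfun_pos x4 x5).ne'
  -- From w² g̃ = g follows g w⁻¹ = g̃ w: the pairing of `w f` in L²(g̃ dx) is the pairing of `w⁻¹
  -- f` in L²(g dx).
  have h3 : gdet φ x * (wfun φ φ' x)⁻¹ = gdet φ' x * wfun φ φ' x := by
    rw [← wfun_sq_mul (φ := φ) x4.le x5]
    field_simp
  have h4 : (gdet φ x : ℂ) * (((wfun φ φ' x)⁻¹ : ℝ) : ℂ) = (gdet φ' x : ℂ) * (wfun φ φ' x : ℂ) := by
    exact_mod_cast h3
  rw [← mul_assoc, ← mul_assoc, ← mul_assoc, ← mul_assoc, h4]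

/-- Comparison of the eigenvalues of `w⁻¹ H̃ w` and `T^*ST`. -/
theorem BiLip.tsum_opConj_comparison (h : BiLip Ω (φ '' Ω) φ S) (h' : BiLip Ω (φ' '' Ω) φ' S')
    (hA : IsEllipticCoeff A)
    {q₀ : ℝ≥0∞} (hq₀ : 2 < q₀) {δ : ℝ≥0∞} (hδ : delta1 Ω (2 * qratio q₀) φ φ' ≤ δ)
    {α γ C₁ C₂ : ℝ} {k : ℕ} (hα : 0 < α) (hC₁ : 0 < C₁) (hγ : 0 < γ)
    (he : α < 2 * k - 3 - 2 * γ) (hC₂ : 0 < C₂)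
    (hS : IsNonnegSymm (opConj b A Ω φ φ')) (hS' : IsNonnegSymm (opTST b A Ω φ φ'))
    (hc : HasCompactResolvent (opConj b A Ω φ φ')) (hc' : HasCompactResolvent (opTST b A Ω φ φ'))
    (hg : EigGrowth (opConj b A Ω φ φ') α C₁) (hg' : EigGrowth (opTST b A Ω φ φ') α C₁)
    {ψ ψ' : ℕ → Lp ℂ 2 (gmeas Ω φ)} (hψ : IsEigenSeq (opConj b A Ω φ φ') ψ)
    (hψ' : IsEigenSeq (opTST b A Ω φ φ') ψ')
    (hP1 : PropP1 (opConj b A Ω φ φ') ψ q₀ γ C₂) (hP1' : PropP1 (opTST b A Ω φ φ') ψ' q₀ γ C₂) :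
    ∑' n, ENNReal.ofReal ((((eig (opConj b A Ω φ φ') n + 1) ^ k)⁻¹ -
        ((eig (opTST b A Ω φ φ') n + 1) ^ k)⁻¹) ^ 2) ≤
      2 * (2 * ENNReal.ofReal ((k : ℝ) ^ 2) * (δ ^ 2 * ENNReal.ofReal (C₂ ^ 2))) *
        growthSum α C₁ (2 * k - 3 - 2 * γ) := by
  have ht := hψ.tendsto_eig hS hc hα hC₁ hg
  have ht' := hψ'.tendsto_eig hS' hc' hα hC₁ hg'
  obtain ⟨P, hP, hPinj⟩ := h.exists_mulOp h'
  obtain ⟨Q, hQ, hQinj⟩ := h.exists_mulInvOp h'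
  set ev := eig (opConj b A Ω φ φ') with hev
  set ev' := eig (opTST b A Ω φ φ') with hev'
  have hid : ∀ i m, (ev i : ℂ) * inner ℂ (ψ' m) (Q (ψ i)) =
      (ev' m : ℂ) * inner ℂ (ψ' m) (P (ψ i)) := fun i m => by
    have := h.conj_eigen_identity h' hA hP hQ (hψ.2 i) (hψ'.2 m)
    rwa [map_smul, inner_smul_right, inner_smul_left, Complex.conj_ofReal] at this
  have hsum : ∀ u : Lp ℂ 2 (gmeas Ω φ), ∀ ν : ℝ, 0 ≤ ν →
      eLpNorm u q₀ (gmeas Ω φ) ≤ ENNReal.ofReal (C₂ * ν ^ γ) →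
      ‖Q u - u‖ₑ ^ 2 + ‖P u - u‖ₑ ^ 2 ≤
        δ ^ 2 * ENNReal.ofReal (C₂ ^ 2) * ENNReal.ofReal (ν ^ (2 * γ)) := by
    intro u ν hν hu
    have h1 := h.enorm_mulOp_sub_le (measurable_wfun φ φ') hP hq₀ u
    have h2 := h.enorm_mulOp_sub_le (measurable_wfun φ φ').inv hQ hq₀ u
    set a := eLpNorm (fun x => wfun φ φ' x - 1) (2 * qratio q₀) (gmeas Ω φ)
    set a' := eLpNorm (fun x => (wfun φ φ')⁻¹ x - 1) (2 * qratio q₀) (gmeas Ω φ)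
    have h3 : a + a' ≤ δ := hδ
    calc _ ≤ (a' * ENNReal.ofReal (C₂ * ν ^ γ)) ^ 2 + (a * ENNReal.ofReal (C₂ * ν ^ γ)) ^ 2 := by
          gcongr
          · exact h2.trans (by gcongr)
          · exact h1.trans (by gcongr)
      _ = (a' ^ 2 + a ^ 2) * ENNReal.ofReal (C₂ * ν ^ γ) ^ 2 := by ring
      _ ≤ (a + a') ^ 2 * ENNReal.ofReal (C₂ * ν ^ γ) ^ 2 := by
          gcongr
          calc a' ^ 2 + a ^ 2 ≤ a' ^ 2 + a ^ 2 + 2 * a * a' := le_self_add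
            _ = _ := by ring
      _ ≤ δ ^ 2 * ENNReal.ofReal (C₂ * ν ^ γ) ^ 2 := by gcongr
      _ = _ := by
          rw [← ENNReal.ofReal_pow (by positivity), mul_pow, ← Real.rpow_natCast (ν ^ γ),
            ← Real.rpow_mul hν, ENNReal.ofReal_mul (by positivity), mul_assoc]
          congr 4
          push_cast
          ring
  have hbot := hψ.orthogonal_eq_bot hS hc ht
  have hbot' := hψ'.orthogonal_eq_bot hS' hc' ht'
  refine tsum_eigenvalue_comparison_weight (hS.eig_nonneg) (hS'.eig_nonneg) (hψ.eig_mono hS)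
    (hψ'.eig_mono hS') ht ht' (fun n => ⟨fun h0 => ?_, fun h0 => ?_⟩) hα hC₁ hγ he hg hg'
    (p := fun i m => ‖inner ℂ (ψ' m) (ψ i)‖ₑ ^ 2) (fun i => ?_) (fun m => ?_)
    (R := fun i m => ‖inner ℂ (ψ' m) (Q (ψ i) - ψ i)‖ₑ ^ 2)
    (T := fun i m => ‖inner ℂ (ψ' m) (P (ψ i) - ψ i)‖ₑ ^ 2)
    (fun i m => ?_) (fun i h0 => ?_) (fun m h0 => ?_)
  -- Multiplication by w maps the kernel of `w⁻¹ H̃ w` into that of `T^*ST`, as kernel elements are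
  -- the functions with zero gradient; multiplication by w⁻¹ serves in the opposite direction.
  · refine hψ.eig_eq_zero_of_ker hS hS' hψ' P hPinj (fun u hu => ?_) h0
    obtain ⟨u', f', hu', hf', hop⟩ := hu
    have hf0 : f' = 0 := by
      refine h'.lp_ext (hf'.trans ?_)
      have e1 := Lp.coeFn_zero ℂ 2 (gmeas Ω φ)
      have e2 := Lp.coeFn_zero ℂ 2 (gmeas Ω φ')
      rw [h.ae_gmeas] at e1
      rw [h'.ae_gmeas] at e2
      filter_upwards [e1, e2] with x x1 x2
      rw [x1, x2]
      exact mul_zero _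
    rw [hf0, h'.opH_eq] at hop
    rw [h.opTST_eq]
    obtain ⟨hD, G, hG, -⟩ := id hop
    have hPu : P u =ᵐ[volume.restrict Ω] u' := (hP u).trans hu'.symm
    refine formOp.intro (hD.congr hPu.symm) (hG.congr hPu.symm ae_eq_rfl) fun v Gv _ _ => ?_
    rw [integral_mul_conj_eq_inner, inner_zero_right]
    refine integral_eq_zero_of_ae ?_
    filter_upwards [h'.formOp_zero_of_zero (h'.formCoeff hA) hop hG] with x hx
    rw [hx, Pi.zero_apply, cform_zero_left, Pi.zero_apply]
  · refine hψ'.eig_eq_zero_of_ker hS' hS hψ Q hQinj (fun v hv => ?_) h0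
    obtain ⟨I, hI⟩ := h.exists_inclusion h'
    refine ⟨I v, 0, ?_, ?_, ?_⟩
    · filter_upwards [hI v, hQ v, h.ae_gdet_pos, h'.ae_gdet_pos] with x x1 x2 x4 x5
      have hw : (wfun φ φ' x : ℂ) ≠ 0 := Complex.ofReal_ne_zero.2 (wfun_pos x4 x5).ne'
      rw [x1, x2, Complex.ofReal_inv, mul_inv_cancel_left₀ hw]
    · have e1 := Lp.coeFn_zero ℂ 2 (gmeas Ω φ)
      have e2 := Lp.coeFn_zero ℂ 2 (gmeas Ω φ')
      rw [h.ae_gmeas] at e1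
      rw [h'.ae_gmeas] at e2
      filter_upwards [e1, e2] with x x1 x2
      rw [x1, x2]
      exact (mul_zero _).symm
    · rw [h'.opH_eq]
      rw [h.opTST_eq] at hv
      obtain ⟨hD, G, hG, -⟩ := id hv
      refine formOp.intro (hD.congr (hI v).symm) (hG.congr (hI v).symm ae_eq_rfl)
        fun v Gv _ _ => ?_
      rw [integral_mul_conj_eq_inner, inner_zero_right]
      refine integral_eq_zero_of_ae ?_
      filter_upwards [h.formOp_zero_of_zero (h'.formCoeff hA) hv hG] with x hx
      rw [hx, Pi.zero_apply, cform_zero_left, Pi.zero_apply]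
  · rw [tsum_enorm_inner_sq hψ'.1 hbot', Orthonormal.enorm_eq_one hψ.1, one_pow]
  · simp_rw [enorm_inner_symm (ψ' m)]
    rw [tsum_enorm_inner_sq hψ.1 hbot, Orthonormal.enorm_eq_one hψ'.1, one_pow]
  · have h1 : ((ev i - ev' m : ℝ) : ℂ) * inner ℂ (ψ' m) (ψ i) =
        (ev' m : ℂ) * inner ℂ (ψ' m) (P (ψ i) - ψ i) -
          (ev i : ℂ) * inner ℂ (ψ' m) (Q (ψ i) - ψ i) := by
      rw [inner_sub_right, inner_sub_right, mul_sub, mul_sub, hid]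
      push_cast
      ring
    set x := inner ℂ (ψ' m) (P (ψ i) - ψ i)
    set y := inner ℂ (ψ' m) (Q (ψ i) - ψ i)
    have h2 : |ev i - ev' m| * ‖inner ℂ (ψ' m) (ψ i)‖ ≤ |ev' m| * ‖x‖ + |ev i| * ‖y‖ := by
      have := norm_sub_le ((ev' m : ℂ) * x) ((ev i : ℂ) * y)
      rwa [← h1, norm_mul, norm_mul, norm_mul, Complex.norm_real, Complex.norm_real,
        Complex.norm_real] at this
    have h4 : ∀ t : ℝ, (2 : ℝ≥0∞) * ENNReal.ofReal t = ENNReal.ofReal (2 * t) := fun t => by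
      rw [ENNReal.ofReal_mul (by norm_num)]
      simp
    simp only [← ofReal_norm]
    rw [← ENNReal.ofReal_pow (norm_nonneg _), ← ENNReal.ofReal_pow (norm_nonneg _),
      ← ENNReal.ofReal_pow (norm_nonneg _), ← ENNReal.ofReal_mul (sq_nonneg _),
      ← ENNReal.ofReal_mul (sq_nonneg _), ← ENNReal.ofReal_mul (sq_nonneg _),
      ← ENNReal.ofReal_add (by positivity) (by positivity), h4]
    refine ENNReal.ofReal_le_ofReal ?_
    have h3 := pow_le_pow_left₀ (by positivity) h2 2
    rw [mul_pow, sq_abs] at h3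
    refine h3.trans ?_
    rw [← sq_abs (ev i), ← sq_abs (ev' m)]
    nlinarith [sq_nonneg (|ev' m| * ‖x‖ - |ev i| * ‖y‖)]
  · rw [ENNReal.tsum_add, tsum_enorm_inner_sq hψ'.1 hbot', tsum_enorm_inner_sq hψ'.1 hbot']
    exact hsum _ _ (hS.eig_nonneg i) (hP1 i h0)
  -- Multiplication by a real function is symmetric, so w and w⁻¹ are moved onto ψ'_m. Parseval in
  -- ψ_i then applies, with (P1) for `T^*ST`.
  · have e1 : ∀ i, ‖inner ℂ (ψ' m) (Q (ψ i) - ψ i)‖ₑ = ‖inner ℂ (ψ i) (Q (ψ' m) - ψ' m)‖ₑ :=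
      fun i => by
        rw [enorm_inner_symm (ψ i), inner_sub_right, inner_sub_left, h.inner_mulOp hQ]
    have e2 : ∀ i, ‖inner ℂ (ψ' m) (P (ψ i) - ψ i)‖ₑ = ‖inner ℂ (ψ i) (P (ψ' m) - ψ' m)‖ₑ :=
      fun i => by
        rw [enorm_inner_symm (ψ i), inner_sub_right, inner_sub_left, h.inner_mulOp hP]
    simp_rw [e1, e2]
    rw [ENNReal.tsum_add, tsum_enorm_inner_sq hψ.1 hbot, tsum_enorm_inner_sq hψ.1 hbot]
    exact hsum _ _ (hS'.eig_nonneg m) (hP1' m h0)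

end CompareWeights

/-! ### Assembly of the two comparisons. -/

section Stability

open Filter Topology

variable {N : ℕ} {Ω : Set (Eu N)} {φ φ' S S' : Eu N → Eu N} {b : BC} {A : Eu N → Mat N}

lemma smul_mul_inv_smul_mul_smul {c : ℝ} (hc : c ≠ 0) (X : Mat N) {Y : Mat N} (hY : Y.PosDef) :
    (c • X) * (c • Y)⁻¹ * (c • X) = c • (X * Y⁻¹ * X) := by
  have hd := (Matrix.isUnit_iff_isUnit_det _).1 hY.isUnit
  have h1 : (c • Y)⁻¹ = c⁻¹ • Y⁻¹ := by
    refine Matrix.inv_eq_left_inv ?_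
    rw [Matrix.smul_mul, Matrix.mul_smul, smul_smul, inv_mul_cancel₀ hc, one_smul,
      Matrix.nonsing_inv_mul _ hd]
  simp only [h1, Matrix.smul_mul, Matrix.mul_smul, smul_smul]
  congr 1
  field_simp

/-- The matrices whose norms enter the measure of vicinity. -/
lemma BiLip.ae_vicinity (h : BiLip Ω (φ '' Ω) φ S) (h' : BiLip Ω (φ' '' Ω) φ' S')
    (hA : IsEllipticCoeff A) : ∀ᵐ x ∂volume.restrict Ω,
      (gdet φ' x • coeff A φ' x - gdet φ x • coeff A φ x) * (gdet φ x • coeff A φ x)⁻¹ *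
          (gdet φ' x • coeff A φ' x - gdet φ x • coeff A φ x) =
        gdet φ x • (((Smat A φ φ' x - 1) * CFC.sqrt (coeff A φ x)).transpose *
          ((Smat A φ φ' x - 1) * CFC.sqrt (coeff A φ x))) ∧
      (gdet φ' x • coeff A φ' x - gdet φ x • coeff A φ x) * (gdet φ' x • coeff A φ' x)⁻¹ *
          (gdet φ' x • coeff A φ' x - gdet φ x • coeff A φ x) =
        gdet φ x • (((CFC.sqrt (Smat A φ φ' x) - (CFC.sqrt (Smat A φ φ' x))⁻¹) *
            CFC.sqrt (coeff A φ x)).transpose *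
          ((CFC.sqrt (Smat A φ φ' x) - (CFC.sqrt (Smat A φ φ' x))⁻¹) *
            CFC.sqrt (coeff A φ x))) := by
  filter_upwards [h.ae_gdet_pos, h'.ae_gdet_pos] with x hx hx'
  have ha := posDef_coeff (hA.posDef (φ x)) hx
  have ha' := posDef_coeff (hA.posDef (φ' x)) hx'
  have hw := wfun_pos hx hx'
  have ht : 0 < (wfun φ φ' x ^ 2)⁻¹ := by positivity
  -- As g̃ = g w⁻², both coefficient matrices share the factor g. What remains is tã - a with t =
  -- w⁻², to which the square-root identities apply.
  have hgt : gdet φ x * (wfun φ φ' x ^ 2)⁻¹ = gdet φ' x := by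
    rw [← wfun_sq_mul (φ := φ) hx.le hx']
    field_simp
  have hB' : gdet φ' x • coeff A φ' x = gdet φ x • ((wfun φ φ' x ^ 2)⁻¹ • coeff A φ' x) := by
    rw [smul_smul, hgt]
  rw [hB', ← smul_sub, smul_mul_inv_smul_mul_smul hx.ne' _ ha,
    smul_mul_inv_smul_mul_smul hx.ne' _ (ha'.smul ht),
    ← transpose_mul_self_sub_one ha ha' (S := Smat A φ φ' x) rfl rfl,
    ← transpose_mul_self_sqrt_sub_inv ha ha' ht (S := Smat A φ φ' x) rfl rfl]
  exact ⟨rfl, rfl⟩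

lemma ofReal_sub_sq_le (x y z : ℝ) : ENNReal.ofReal ((x - z) ^ 2) ≤
    2 * ENNReal.ofReal ((x - y) ^ 2) + 2 * ENNReal.ofReal ((z - y) ^ 2) := by
  have h4 : ∀ t : ℝ, (2 : ℝ≥0∞) * ENNReal.ofReal t = ENNReal.ofReal (2 * t) := fun t => by
    rw [ENNReal.ofReal_mul (by norm_num)]
    simp
  rw [h4, h4, ← ENNReal.ofReal_add (by positivity) (by positivity)]
  refine ENNReal.ofReal_le_ofReal ?_
  nlinarith [sq_nonneg (x - y + (z - y))]

/-- Stability of eigenvalues, in terms of sums of squares. -/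
theorem BiLip.tsum_opL_comparison (h : BiLip Ω (φ '' Ω) φ S) (h' : BiLip Ω (φ' '' Ω) φ' S')
    (hA : IsEllipticCoeff A) {q₀ : ℝ≥0∞} (hq₀ : 2 < q₀) {α γ C₁ C₂ : ℝ} {k : ℕ} (hα : 0 < α)
    (hC₁ : 0 < C₁) (hγ : 0 < γ) (he : α < 2 * k - 3 - 2 * γ) (hC₂ : 0 < C₂)
    (hL : HasCompactResolvent (opL b A Ω φ)) (hL' : HasCompactResolvent (opL b A Ω φ'))
    (hT : HasCompactResolvent (opTST b A Ω φ φ'))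
    (gL : EigGrowth (opL b A Ω φ) α C₁) (gL' : EigGrowth (opL b A Ω φ') α C₁)
    (gT : EigGrowth (opTST b A Ω φ φ') α C₁) {ψH ψT ψW : ℕ → Lp ℂ 2 (gmeas Ω φ)}
    (eH : IsEigenSeq (opH b A Ω φ) ψH) (eT : IsEigenSeq (opTST b A Ω φ φ') ψT)
    (eW : IsEigenSeq (opConj b A Ω φ φ') ψW)
    (p2H : PropP2 Ω (opH b A Ω φ) ψH q₀ γ C₂)
    (p1T : PropP1 (opTST b A Ω φ φ') ψT q₀ γ C₂)
    (p2T : PropP2 Ω (opTST b A Ω φ φ') ψT q₀ γ C₂)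
    (p1W : PropP1 (opConj b A Ω φ φ') ψW q₀ γ C₂) :
    ∑' n : ℕ, ENNReal.ofReal
        ((((eig (opL b A Ω φ') n + 1) ^ k)⁻¹ - ((eig (opL b A Ω φ) n + 1) ^ k)⁻¹) ^ 2) ≤
      12 * (ENNReal.ofReal ((k : ℝ) ^ 2) * ENNReal.ofReal (C₂ ^ 2) *
        growthSum α C₁ (2 * k - 3 - 2 * γ)) * delta A Ω (2 * qratio q₀) φ φ' ^ 2 := by
  obtain ⟨U, hU⟩ := h.exists_equiv_opL (b := b) hA
  obtain ⟨U', hU'⟩ := h'.exists_equiv_opL (b := b) hA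
  obtain ⟨W, hW⟩ := h.exists_mulEquiv h'
  have hWiff := h'.opConj_iff (b := b) (A := A) W hW
  have hWsymm : ∀ u f, opH b A Ω φ' u f ↔ opConj b A Ω φ φ' (W.symm u) (W.symm f) := fun u f => by
    rw [hWiff, W.apply_symm_apply, W.apply_symm_apply]
  have eigH : eig (opL b A Ω φ) = eig (opH b A Ω φ) := eig_eq_of_equiv U hU
  have eigW : eig (opL b A Ω φ') = eig (opConj b A Ω φ φ') :=
    (eig_eq_of_equiv U' hU').trans (eig_eq_of_equiv W.symm hWsymm)
  have hcH : HasCompactResolvent (opH b A Ω φ) := hL.of_equiv U hU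
  have hcW : HasCompactResolvent (opConj b A Ω φ φ') :=
    (hL'.of_equiv U' hU').of_equiv W.symm hWsymm
  have gH : EigGrowth (opH b A Ω φ) α C₁ := fun n => by
    rw [← eigH]
    exact gL n
  have gW : EigGrowth (opConj b A Ω φ φ') α C₁ := fun n => by
    rw [← eigW]
    exact gL' n
  have hST : IsNonnegSymm (opTST b A Ω φ φ') := by
    rw [h.opTST_eq]
    exact h.isNonnegSymm_formOp (h'.formCoeff hA)
  have hSW : IsNonnegSymm (opConj b A Ω φ φ') := by
    refine IsNonnegSymm.of_equiv W hWiff ?_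
    rw [h'.opH_eq]
    exact h'.isNonnegSymm_formOp (h'.formCoeff hA)
  have hd1 : delta1 Ω (2 * qratio q₀) φ φ' ≤ delta A Ω (2 * qratio q₀) φ φ' := by
    unfold delta
    exact le_self_add
  have hd2 : delta2 A Ω (2 * qratio q₀) φ φ' ≤ delta A Ω (2 * qratio q₀) φ φ' := by
    unfold delta
    exact le_add_self
  have b1 := h.tsum_opConj_comparison h' hA hq₀ hd1 hα hC₁ hγ he hC₂ hSW hST hcW hT
    gW gT eW eT p1W p1T
  have b2 : ∑' n : ℕ, ENNReal.ofReal ((((eig (opH b A Ω φ) n + 1) ^ k)⁻¹ -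
      ((eig (opTST b A Ω φ φ') n + 1) ^ k)⁻¹) ^ 2) ≤
      2 * (ENNReal.ofReal ((k : ℝ) ^ 2) * (delta A Ω (2 * qratio q₀) φ φ' ^ 2 * ENNReal.ofReal (C₂ ^ 2))) *
        growthSum α C₁ (2 * k - 3 - 2 * γ) := by
    have hv := h.ae_vicinity h' hA
    rw [h.opTST_eq] at hT gT eT p2T ⊢
    rw [h.opH_eq] at hcH gH eH p2H ⊢
    exact h.tsum_formOp_comparison (h.formCoeff hA) (h'.formCoeff hA)
      (hv.mono fun x hx => hx.1) (hv.mono fun x hx => hx.2) hq₀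
      (le_trans (by unfold delta2; exact le_add_self) hd2)
      (le_trans (by unfold delta2; exact le_self_add) hd2) hα hC₁ hγ he hC₂ hcH hT gH gT
      eH eT p2H p2T
  rw [eigH, eigW]
  refine (ENNReal.tsum_le_tsum fun n =>
    ofReal_sub_sq_le _ (((eig (opTST b A Ω φ φ') n + 1) ^ k)⁻¹) _).trans ?_
  rw [ENNReal.tsum_add, ENNReal.tsum_mul_left, ENNReal.tsum_mul_left]
  -- The constant is 12 = 2·4 + 2·2: the weight comparison contributes 4, the form comparison 2, and
  -- inserting the intermediate eigenvalues of `T^*ST` doubles both.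
  refine (add_le_add (mul_le_mul_right b1 _) (mul_le_mul_right b2 _)).trans_eq ?_
  ring

end Stability

end

end SpectralStability

/-! ### The stability theorem. -/

open SpectralStability in
theorem theorem3p2 :
    -- `k` large depends only on `α` and `γ`
    ∃ k₀ : ℝ → ℝ → ℕ, ∀ α γ : ℝ, 0 < α → 0 < γ → ∀ k : ℕ, k₀ α γ ≤ k →
    ∀ s C₁ C₂ : ℝ, 0 < C₁ → 0 < C₂ →
    -- the constant, depending also on the `L^{q₀}` norm of `g`, but only for Neumann conditions
    ∃ c : BC → ℝ → ℝ, (∀ b r, 0 < c b r) ∧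
      (∀ r r' : ℝ, c BC.dirichlet r = c BC.dirichlet r') ∧
    ∀ (N : ℕ) (hN : 1 ≤ N) (b : BC) (A : Eu N → Mat N) (hA : IsEllipticCoeff A)
      (Ω : Set (Eu N)) (hΩ : IsBoundedDomain Ω)
      (φ φ' : Eu N → Eu N) (hφ : IsTransformation Ω φ) (hφ' : IsTransformation Ω φ')
      (q₀ : ℝ≥0∞) (hq₀ : 2 < q₀)
      (hs : qratio q₀ * ENNReal.ofReal (α + 2 * γ) < ENNReal.ofReal s)
      -- standing assumptions: compact resolvents and growth of the eigenvalues
      (hL : HasCompactResolvent (opL b A Ω φ)) (hL' : HasCompactResolvent (opL b A Ω φ'))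
      (hT : HasCompactResolvent (opTST b A Ω φ φ'))
      (gL : EigGrowth (opL b A Ω φ) α C₁) (gL' : EigGrowth (opL b A Ω φ') α C₁)
      (gT : EigGrowth (opTST b A Ω φ φ') α C₁)
      -- `H` and `T^*ST` satisfy (P1) and (P2), and `w⁻¹ H̃ w` satisfies (P1)
      (ψH ψT ψW : ℕ → Lp ℂ 2 (gmeas Ω φ))
      (eH : IsEigenSeq (opH b A Ω φ) ψH) (eT : IsEigenSeq (opTST b A Ω φ φ') ψT)
      (eW : IsEigenSeq (opConj b A Ω φ φ') ψW)
      (p1H : PropP1 (opH b A Ω φ) ψH q₀ γ C₂) (p2H : PropP2 Ω (opH b A Ω φ) ψH q₀ γ C₂)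
      (p1T : PropP1 (opTST b A Ω φ φ') ψT q₀ γ C₂)
      (p2T : PropP2 Ω (opTST b A Ω φ φ') ψT q₀ γ C₂)
      (p1W : PropP1 (opConj b A Ω φ φ') ψW q₀ γ C₂),
      (∑' n : ℕ, ENNReal.ofReal
          ((((eig (opL b A Ω φ') n + 1) ^ k)⁻¹ - ((eig (opL b A Ω φ) n + 1) ^ k)⁻¹) ^ 2))
            ^ (1 / 2 : ℝ) ≤
        ENNReal.ofReal (c b (eLpNorm (gdet φ) q₀ (volume.restrict Ω)).toReal) *
          (1 + delta A Ω (ENNReal.ofReal s) φ φ') * delta A Ω (2 * qratio q₀) φ φ' := by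
  -- The threshold ensures k > (α + 2γ + 3)/2, that is α < 2k - 3 - 2γ, the condition for
  -- convergence of `growthSum`.
  refine ⟨fun α γ => ⌈(α + 2 * γ + 3) / 2⌉₊ + 1, fun α γ hα hγ k hk s C₁ C₂ hC₁ hC₂ => ?_⟩
  have he : α < 2 * k - 3 - 2 * γ := by
    have h1 := Nat.le_ceil ((α + 2 * γ + 3) / 2)
    have h2 : ((⌈(α + 2 * γ + 3) / 2⌉₊ : ℕ) : ℝ) + 1 ≤ k := by exact_mod_cast hk
    linarith
  set X : ENNReal := 12 * (ENNReal.ofReal ((k : ℝ) ^ 2) * ENNReal.ofReal (C₂ ^ 2) *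
    growthSum α C₁ (2 * k - 3 - 2 * γ)) with hX
  have hXfin : X ^ (1 / 2 : ℝ) ≠ ⊤ := by
    refine ENNReal.rpow_ne_top_of_nonneg (by norm_num) ?_
    have := growthSum_ne_top hC₁ he hα
    finiteness
  -- One constant serves both boundary conditions and every value of the norm of g; the added 1
  -- makes it positive.
  refine ⟨fun _ _ => (X ^ (1 / 2 : ℝ)).toReal + 1, fun _ _ => by positivity, fun _ _ => rfl, ?_⟩
  intro N _ b A hA Ω hΩ φ φ' hφ hφ' q₀ hq₀ _ hL hL' hT gL gL' gT ψH ψT ψW eH eT eW _ p2H p1T p2T p1W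
  obtain ⟨S, h⟩ := hφ.exists_biLip hΩ.1
  obtain ⟨S', h'⟩ := hφ'.exists_biLip hΩ.1
  have key := h.tsum_opL_comparison h' hA hq₀ hα hC₁ hγ he hC₂ hL hL' hT gL gL' gT eH eT eW
    p2H p1T p2T p1W
  have hroot : (delta A Ω (2 * qratio q₀) φ φ' ^ 2) ^ (1 / 2 : ℝ) =
      delta A Ω (2 * qratio q₀) φ φ' := by
    rw [← ENNReal.rpow_natCast, ← ENNReal.rpow_mul]
    norm_num
  refine (ENNReal.rpow_le_rpow key (by norm_num)).trans ?_
  rw [ENNReal.mul_rpow_of_nonneg _ _ (by norm_num), hroot]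
  refine mul_le_mul_left ?_ _
  calc X ^ (1 / 2 : ℝ) = ENNReal.ofReal (X ^ (1 / 2 : ℝ)).toReal :=
        (ENNReal.ofReal_toReal hXfin).symm
    _ ≤ ENNReal.ofReal ((X ^ (1 / 2 : ℝ)).toReal + 1) :=
        ENNReal.ofReal_le_ofReal (by linarith)
    -- The estimate obtained is linear in δ alone, and the factor 1 + δ_s is at least 1.
    _ ≤ _ := le_mul_of_one_le_right' le_self_add
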